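/- Let $n\ge 0$ and $0\le 1-\rho\le\delta<\rho\le 1$. On $\mathbb R^{2n}=\mathbb R^n\oplus\mathbb R^n$ consider the symplectic form $\sigma(x,\xi;y,\eta)=\langle\xi,y\rangle-\langle x,\eta\rangle$ and the metric $$g_{x,\xi}(y,\eta)=(1+|x|^2+|\xi|^2)^{\delta}|y|^2+(1+|x|^2+|\xi|^2)^{-\rho}|\eta|^2 ,$$ and put $g^\sigma_X(T)=\sup_{S\ne0}\sigma(T,S)^2/g_X(S)$ and $h_\sigma(X)^2=\sup_{T\neq 0} g_X(T)/g_X^\sigma(T)$ (so that $h_\sigma(x,\xi)=(1+|x|^2+|\xi|^2)^{(\delta-\rho)/2}$ for $n\ge1$). Let $m>0$ be a $\sigma,g$-temperate function on $\mathbb R^{2n}$: there are constants $c,C>0$ with $C^{-1}m(X)\le m(Y)\le C\,m(X)$ whenever $g_X(Y-X)\le c$, and there are $C>0$, $M\in\mathbb N$ with $m(X)\le C\,m(Y)(1+g^\sigma_Y(X-Y))^M$ for all $X,Y$. For a positive (or zero) weight $w$, let $S(g,w)$ be the set of all $u\in C^\infty(\mathbb R^{2n},\mathbb C)$ such that for every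 $k\ge0$ there is a constant $C_k$ with $|u^{(k)}(X;t_1,\dots,t_k)|\le C_k\, w(X)\prod_{j=1}^k g_X(t_j)^{1/2}$ for all $X,t_1,\dots,t_k\in\mathbb R^{2n}$ (for $w=m$ this is the class $\Gamma_{\rho,\delta}(m,\mathbb R^{2n})$). For $\tau\in\mathbb R$, a function $a$ on $\mathbb R^{2n}$ is called a $\tau$-symbol of a continuous linear operator $A:\mathcal S(\mathbb R^n)\to\mathcal S(\mathbb R^n)$, written $A=\mathrm{Op}^\tau(a)$, if for all $u\in\mathcal S(\mathbb R^n)$ and $x\in\mathbb R^n$ $$Au(x)=(2\pi)^{-n}\int_{\mathbb R^n}\Big(\int_{\mathbb R^n}e^{i(x-y)\cdot\xi}\,a((1-\tau)x+\tau y,\xi)\,u(y)\,dy\Big)d\xi ,$$ the two successive integrals being absolutely convergent. Let $\tau,\tau'\in\mathbb R$, let $a\in S(g,m)$, and let $\kappa:\mathbb R^n\to\mathbb R^n$ be an invertible linear map such that $m(\kappa^{-1}x,{}^t\kappa\,\xi)=m(x,\xi)$ for all $x,\xi$. Then $a$ is the $\tau'$-symbol of a continuous operator $A=\mathrm{Op}^{\tau'}(a)$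 on $\mathcal S(\mathbb R^n)$, and the operator $$A_1u=[A(u\circ\kappa)]\circ\kappa^{-1},\qquad u\in\mathcal S(\mathbb R^n),$$ has exactly one $\tau$-symbol $\sigma^\tau(A_1)$ in $S(g,m)$. With $D=-i\partial$ and $$a_1(x,y,\xi)=a\big((1-\tau')\kappa^{-1}x+\tau'\kappa^{-1}y,\,{}^t\kappa\,\xi\big)\,|\det\kappa^{-1}|\,|\det{}^t\kappa| ,$$ it satisfies, for every integer $N\ge0$, $$\sigma^\tau(A_1)(x,\xi)-\sum_{|\beta+\gamma|\le N-1}\frac{1}{\beta!\,\gamma!}\,\tau^{|\beta|}(1-\tau)^{|\gamma|}\,\partial_\xi^{\beta+\gamma}(-D_x)^\beta D_y^\gamma a_1(x,y,\xi)\Big|_{y=x}\in S(g,h_\sigma^N m).$$ If, in addition, $a(\kappa^{-1}x,{}^t\kappa\,\xi)=a(x,\xi)$ for all $x,\xi$ and $\det\kappa=\pm1$, then $A_1=A$, and for every integer $N\ge0$ $$\sigma^\tau(A)(x,\xi)-\sum_{|\beta+\gamma|\le N-1}\frac{1}{\beta!\,\gamma!}\,\tau^{|\beta|}(1-\tau)^{|\gamma|}(\tau'-1)^{|\beta|}{\tau'}^{|\gamma|}\,\partial_\xi^{\beta+\gamma}D_x^{\beta+\gamma}a(x,\xi)\in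 S(g,h_\sigma^N m).$$ -/

import Mathlib

open MeasureTheory SchwartzMap
open scoped ContDiff

noncomputable section

/-- The Euclidean space `ℝⁿ`. -/
abbrev Euc (n : ℕ) : Type := EuclideanSpace ℝ (Fin n)

/-- The phase space `ℝ²ⁿ = ℝⁿ ⊕ ℝⁿ`, with points `(x, ξ)`. -/
abbrev Phase (n : ℕ) : Type := Euc n × Euc n

/-- The symplectic form `σ(x, ξ; y, η) = ⟨ξ, y⟩ - ⟨x, η⟩`. -/
def symplForm {n : ℕ} (X Y : Phase n) : ℝ :=
  inner ℝ X.2 Y.1 - inner ℝ X.1 Y.2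

/-- The metric
`g_{x,ξ}(y, η) = (1 + |x|² + |ξ|²)^δ |y|² + (1 + |x|² + |ξ|²)^{-ρ} |η|²`. -/
def stdMetric (n : ℕ) (ρ δ : ℝ) (X T : Phase n) : ℝ :=
  (1 + ‖X.1‖ ^ 2 + ‖X.2‖ ^ 2) ^ δ * ‖T.1‖ ^ 2
    + (1 + ‖X.1‖ ^ 2 + ‖X.2‖ ^ 2) ^ (-ρ) * ‖T.2‖ ^ 2

/-- The metric dual to `g` with respect to `σ`:
`g^σ_X(T) = sup_{S ≠ 0} σ(T, S)² / g_X(S)`  (the quotient is `0` at `S = 0`). -/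
def dualMetric {n : ℕ} (g : Phase n → Phase n → ℝ) (X T : Phase n) : ℝ :=
  ⨆ S : Phase n, symplForm T S ^ 2 / g X S

/-- `h_σ(X) = (sup_{T ≠ 0} g_X(T) / g^σ_X(T))^{1/2}`. -/
def hSigma {n : ℕ} (g : Phase n → Phase n → ℝ) (X : Phase n) : ℝ :=
  Real.sqrt (⨆ T : Phase n, g X T / dualMetric g X T)

/-- `m` is `g`-continuous. -/
def IsMetricContinuous {n : ℕ} (g : Phase n → Phase n → ℝ) (m : Phase n → ℝ) : Prop :=
  ∃ c > 0, ∃ C > 0, ∀ X Y : Phase n, g X (Y - X) ≤ c → m X / C ≤ m Y ∧ m Y ≤ C * m X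

/-- `m` is a `σ, g`-temperate weight: positive, `g`-continuous, and
`m(X) ≤ C m(Y) (1 + g^σ_Y(X - Y))^N`. -/
structure IsTemperateWeight {n : ℕ} (g : Phase n → Phase n → ℝ) (m : Phase n → ℝ) : Prop where
  pos : ∀ X, 0 < m X
  metricContinuous : IsMetricContinuous g m
  temperate : ∃ C > 0, ∃ N : ℕ, ∀ X Y : Phase n,
    m X ≤ C * m Y * (1 + dualMetric g Y (X - Y)) ^ N

/-- The symbol class `S(g, m)`. -/
def symbolClass {n : ℕ} (g : Phase n → Phase n → ℝ) (m : Phase n → ℝ) : Set (Phase n → ℂ) :=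
  {u | ContDiff ℝ ∞ u ∧ ∀ k : ℕ, ∃ C : ℝ, ∀ (X : Phase n) (t : Fin k → Phase n),
    ‖iteratedFDeriv ℝ k u X t‖ ≤ C * ((∏ j, Real.sqrt (g X (t j))) * m X)}

/-- The integrand `e^{i(x-y)·ξ} a((1-τ)x + τy, ξ) u(y)`. -/
def tauIntegrand {n : ℕ} (τ : ℝ) (a : Phase n → ℂ) (u : Euc n → ℂ) (x ξ y : Euc n) : ℂ :=
  Complex.exp (Complex.I * (inner ℝ (x - y) ξ : ℝ)) * a ((1 - τ) • x + τ • y, ξ) * u y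

/-- `A = Op^τ(a)`, i.e. `a` is a `τ`-symbol of the continuous operator `A` on `𝓢(ℝⁿ)`:
`A u(x) = (2π)⁻ⁿ ∫ (∫ e^{i(x-y)·ξ} a((1-τ)x + τy, ξ) u(y) dy) dξ`,
both successive integrals being absolutely convergent. -/
def IsOpTau {n : ℕ} (τ : ℝ) (a : Phase n → ℂ)
    (A : 𝓢(Euc n, ℂ) →L[ℂ] 𝓢(Euc n, ℂ)) : Prop :=
  ∀ (u : 𝓢(Euc n, ℂ)) (x : Euc n),
    (∀ ξ, Integrable (fun y => tauIntegrand τ a u x ξ y)) ∧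
    Integrable (fun ξ => ∫ y, tauIntegrand τ a u x ξ y) ∧
    A u x = ((2 * Real.pi : ℝ) : ℂ)⁻¹ ^ n * ∫ ξ, ∫ y, tauIntegrand τ a u x ξ y

/-- The transpose of a linear automorphism of `ℝⁿ`. -/
def transposeMap {n : ℕ} (κ : Euc n ≃L[ℝ] Euc n) : Euc n →L[ℝ] Euc n :=
  ContinuousLinearMap.adjoint (κ : Euc n →L[ℝ] Euc n)

/-- The operator `u ↦ [A(u ∘ κ)] ∘ κ⁻¹`. -/
def conjOp {n : ℕ} (κ : Euc n ≃L[ℝ] Euc n) (A : 𝓢(Euc n, ℂ) →L[ℂ] 𝓢(Euc n, ℂ)) :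
    𝓢(Euc n, ℂ) →L[ℂ] 𝓢(Euc n, ℂ) :=
  (compCLMOfContinuousLinearEquiv ℂ κ.symm).comp
    (A.comp (compCLMOfContinuousLinearEquiv ℂ κ))

theorem conjOp_apply {n : ℕ} (κ : Euc n ≃L[ℝ] Euc n)
    (A : 𝓢(Euc n, ℂ) →L[ℂ] 𝓢(Euc n, ℂ)) (u : 𝓢(Euc n, ℂ)) (x : Euc n) :
    conjOp κ A u x = A (compCLMOfContinuousLinearEquiv ℂ κ u) (κ.symm x) := rfl

/-- The `j`-th standard basis vector of `ℝⁿ`. -/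
def stdVec {n : ℕ} (j : Fin n) : Euc n := EuclideanSpace.single j 1

/-- For the metric above, `g^σ_{x,ξ}(y, η) = (1+|x|²+|ξ|²)^ρ |y|² + (1+|x|²+|ξ|²)^{-δ} |η|²`. -/
theorem dualMetric_stdMetric (n : ℕ) (ρ δ : ℝ) (X T : Phase n) :
    dualMetric (stdMetric n ρ δ) X T =
      (1 + ‖X.1‖ ^ 2 + ‖X.2‖ ^ 2) ^ ρ * ‖T.1‖ ^ 2
        + (1 + ‖X.1‖ ^ 2 + ‖X.2‖ ^ 2) ^ (-δ) * ‖T.2‖ ^ 2 := by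
  have hL : 0 < 1 + ‖X.1‖ ^ 2 + ‖X.2‖ ^ 2 := by positivity
  unfold dualMetric stdMetric symplForm
  rw [Real.rpow_neg hL.le, Real.rpow_neg hL.le]
  generalize (1 + ‖X.1‖ ^ 2 + ‖X.2‖ ^ 2) = L at *
  have hl : 0 < L ^ δ := Real.rpow_pos_of_pos hL _
  have hr : 0 < L ^ ρ := Real.rpow_pos_of_pos hL _
  generalize L ^ δ = l at *
  generalize L ^ ρ = r at *
  have hub : ∀ S : Phase n, (inner ℝ T.2 S.1 - inner ℝ T.1 S.2) ^ 2 /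
      (l * ‖S.1‖ ^ 2 + r⁻¹ * ‖S.2‖ ^ 2) ≤ r * ‖T.1‖ ^ 2 + l⁻¹ * ‖T.2‖ ^ 2 := by
    intro S
    apply div_le_of_le_mul₀ (by positivity) (by positivity)
    have h1 := abs_real_inner_le_norm T.2 S.1
    have h2 := abs_real_inner_le_norm T.1 S.2
    have h3 : |inner ℝ T.2 S.1 - inner ℝ T.1 S.2| ≤ ‖T.2‖ * ‖S.1‖ + ‖T.1‖ * ‖S.2‖ :=
      (abs_sub _ _).trans (add_le_add h1 h2)
    have h4 : (inner ℝ T.2 S.1 - inner ℝ T.1 S.2) ^ 2 ≤ (‖T.2‖ * ‖S.1‖ + ‖T.1‖ * ‖S.2‖) ^ 2 := by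
      rw [← sq_abs]; gcongr
    refine h4.trans ?_
    have : (r * ‖T.1‖ ^ 2 + l⁻¹ * ‖T.2‖ ^ 2) * (l * ‖S.1‖ ^ 2 + r⁻¹ * ‖S.2‖ ^ 2)
      - (‖T.2‖ * ‖S.1‖ + ‖T.1‖ * ‖S.2‖) ^ 2
      = (r * l * (‖T.1‖ * ‖S.1‖) - ‖T.2‖ * ‖S.2‖) ^ 2 / (r * l) := by
      field_simp; ring
    have h5 : 0 ≤ (r * l * (‖T.1‖ * ‖S.1‖) - ‖T.2‖ * ‖S.2‖) ^ 2 / (r * l) := by positivity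
    linarith
  apply le_antisymm (ciSup_le hub)
  refine le_ciSup_of_le ⟨_, Set.forall_mem_range.2 hub⟩ (l⁻¹ • T.2, -(r • T.1)) ?_
  simp only [inner_smul_right, inner_neg_right, real_inner_self_eq_norm_sq, norm_smul, norm_neg,
    Real.norm_eq_abs, abs_of_pos hr, abs_of_pos (inv_pos.2 hl)]
  have e1 : l * (l⁻¹ * ‖T.2‖) ^ 2 + r⁻¹ * (r * ‖T.1‖) ^ 2 = l⁻¹ * ‖T.2‖ ^ 2 + r * ‖T.1‖ ^ 2 := by
    field_simp
  rw [e1, sub_neg_eq_add, sq (_ + _), mul_self_div_self, add_comm]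

/-- For the metric above and `n ≥ 1`, `h_σ(x, ξ)² = (1 + |x|² + |ξ|²)^{δ-ρ}`. -/
theorem hSigma_stdMetric (n : ℕ) [NeZero n] (ρ δ : ℝ) (X : Phase n) :
    hSigma (stdMetric n ρ δ) X = (1 + ‖X.1‖ ^ 2 + ‖X.2‖ ^ 2) ^ ((δ - ρ) / 2) := by
  have hL : 0 < 1 + ‖X.1‖ ^ 2 + ‖X.2‖ ^ 2 := by positivity
  unfold hSigma
  simp only [dualMetric_stdMetric]
  unfold stdMetric
  generalize (1 + ‖X.1‖ ^ 2 + ‖X.2‖ ^ 2) = L at *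
  have key : ∀ T : Phase n, (L ^ δ * ‖T.1‖ ^ 2 + L ^ (-ρ) * ‖T.2‖ ^ 2) =
      L ^ (δ - ρ) * (L ^ ρ * ‖T.1‖ ^ 2 + L ^ (-δ) * ‖T.2‖ ^ 2) := by
    intro T
    rw [mul_add, ← mul_assoc, ← mul_assoc, ← Real.rpow_add hL, ← Real.rpow_add hL]
    congr 3 <;> ring_nf
  have hp : 0 < L ^ (δ - ρ) := Real.rpow_pos_of_pos hL _
  have hub : ∀ T : Phase n, (L ^ δ * ‖T.1‖ ^ 2 + L ^ (-ρ) * ‖T.2‖ ^ 2) /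
      (L ^ ρ * ‖T.1‖ ^ 2 + L ^ (-δ) * ‖T.2‖ ^ 2) ≤ L ^ (δ - ρ) := by
    intro T
    exact div_le_of_le_mul₀ (by positivity) hp.le (key T).le
  have : (⨆ T : Phase n, (L ^ δ * ‖T.1‖ ^ 2 + L ^ (-ρ) * ‖T.2‖ ^ 2) /
      (L ^ ρ * ‖T.1‖ ^ 2 + L ^ (-δ) * ‖T.2‖ ^ 2)) = L ^ (δ - ρ) := by
    apply le_antisymm (ciSup_le hub)
    refine le_ciSup_of_le ⟨_, Set.forall_mem_range.2 hub⟩ (stdVec 0, 0) ?_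
    rw [key, mul_div_assoc, div_self, mul_one]
    have : 0 < L ^ ρ := Real.rpow_pos_of_pos hL _
    simp [stdVec, this.ne']
  rw [this, Real.sqrt_eq_rpow, ← Real.rpow_mul hL.le]
  congr 1
  ring

/-- The directional derivative `∂_v f`. -/
def dirDeriv {V : Type*} [NormedAddCommGroup V] [NormedSpace ℝ V] (v : V) (f : V → ℂ) : V → ℂ :=
  fun x => fderiv ℝ f x v

/-- `∂_{v_1}^{α_1} ⋯ ∂_{v_n}^{α_n} f` for a multi-index `α` and a family of directions `v`. -/
def multiDeriv {V : Type*} [NormedAddCommGroup V] [NormedSpace ℝ V] {n : ℕ}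
    (v : Fin n → V) (α : Fin n → ℕ) (f : V → ℂ) : V → ℂ :=
  (List.finRange n).foldr (fun j h => (dirDeriv (v j))^[α j] h) f

/-- The length `|α|` of a multi-index. -/
def multiLength {n : ℕ} (α : Fin n → ℕ) : ℕ := ∑ j, α j

/-- The factorial `α!` of a multi-index. -/
def multiFactorial {n : ℕ} (α : Fin n → ℕ) : ℕ := ∏ j, (α j).factorial

/-- The pairs of multi-indices `(β, γ)` with `|β + γ| ≤ N - 1`, that is, `|β + γ| < N`. -/
def multiPairs (n N : ℕ) : Finset ((Fin n → ℕ) × (Fin n → ℕ)) :=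
  ((Finset.Iic fun _ => N) ×ˢ (Finset.Iic fun _ => N)).filter
    fun p => multiLength (p.1 + p.2) < N

theorem mem_multiPairs {n N : ℕ} (p : (Fin n → ℕ) × (Fin n → ℕ)) :
    p ∈ multiPairs n N ↔ multiLength (p.1 + p.2) < N := by
  simp only [multiPairs, Finset.mem_filter, Finset.mem_product, Finset.mem_Iic, Pi.le_def,
    and_iff_right_iff_imp]
  intro h
  have key : ∀ j, p.1 j + p.2 j < N := fun j =>
    lt_of_le_of_lt (Finset.single_le_sum (f := fun j => (p.1 + p.2) j)
      (fun _ _ => Nat.zero_le _) (Finset.mem_univ j)) h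
  exact ⟨fun j => by have := key j; omega, fun j => by have := key j; omega⟩

/-- The amplitude
`a₁(x, y, ξ) = a((1-τ')κ⁻¹x + τ'κ⁻¹y, ᵗκ ξ) |det κ⁻¹| |det ᵗκ|`, as a function of `(x, y, ξ)`. -/
def conjAmplitude {n : ℕ} (τ' : ℝ) (κ : Euc n ≃L[ℝ] Euc n) (a : Phase n → ℂ) :
    Euc n × Euc n × Euc n → ℂ :=
  fun p => a ((1 - τ') • κ.symm p.1 + τ' • κ.symm p.2.1, transposeMap κ p.2.2) *
    ((|(κ.symm : Euc n →L[ℝ] Euc n).det| * |(transposeMap κ).det| : ℝ) : ℂ)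

/-- `∂_ξ^{β+γ} (-D_x)^β D_y^γ a₁ (x, y, ξ)` at `y = x`, where `D = -i∂`, so that
`(-D_x)^β D_y^γ = i^{|β|} (-i)^{|γ|} ∂_x^β ∂_y^γ`. -/
def amplitudeTerm {n : ℕ} (a₁ : Euc n × Euc n × Euc n → ℂ) (β γ : Fin n → ℕ) (X : Phase n) : ℂ :=
  Complex.I ^ multiLength β * (-Complex.I) ^ multiLength γ *
    multiDeriv (fun j => ((0, 0, stdVec j) : Euc n × Euc n × Euc n)) (β + γ)
      (multiDeriv (fun j => ((stdVec j, 0, 0) : Euc n × Euc n × Euc n)) β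
        (multiDeriv (fun j => ((0, stdVec j, 0) : Euc n × Euc n × Euc n)) γ a₁)) (X.1, X.1, X.2)

/-- `∑_{|β+γ| ≤ N-1} (β! γ!)⁻¹ τ^{|β|} (1-τ)^{|γ|} ∂_ξ^{β+γ} (-D_x)^β D_y^γ a₁(x, y, ξ)|_{y=x}`,
where `a₁` is the amplitude belonging to `τ'`, `κ` and `a`. -/
def conjExpansion {n : ℕ} (τ τ' : ℝ) (κ : Euc n ≃L[ℝ] Euc n) (a : Phase n → ℂ) (N : ℕ)
    (X : Phase n) : ℂ :=
  ∑ p ∈ multiPairs n N,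
    ((1 / ((multiFactorial p.1 : ℝ) * multiFactorial p.2) *
      τ ^ multiLength p.1 * (1 - τ) ^ multiLength p.2 : ℝ) : ℂ) *
      amplitudeTerm (conjAmplitude τ' κ a) p.1 p.2 X

/-- `∑_{|β+γ| ≤ N-1} (β! γ!)⁻¹ τ^{|β|} (1-τ)^{|γ|} (τ'-1)^{|β|} τ'^{|γ|} ∂_ξ^{β+γ} D_x^{β+γ} a`,
where `D_x^α = (-i)^{|α|} ∂_x^α`. -/
def changeExpansion {n : ℕ} (τ τ' : ℝ) (a : Phase n → ℂ) (N : ℕ) (X : Phase n) : ℂ :=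
  ∑ p ∈ multiPairs n N,
    ((1 / ((multiFactorial p.1 : ℝ) * multiFactorial p.2) *
      τ ^ multiLength p.1 * (1 - τ) ^ multiLength p.2 *
      (τ' - 1) ^ multiLength p.1 * τ' ^ multiLength p.2 : ℝ) : ℂ) *
      ((-Complex.I) ^ multiLength (p.1 + p.2) *
        multiDeriv (fun j => ((0, stdVec j) : Phase n)) (p.1 + p.2)
          (multiDeriv (fun j => ((stdVec j, 0) : Phase n)) (p.1 + p.2) a) X)

end

/-! Let `J t` be the operator exp(it⟨∂_x,∂_ξ⟩), that is, the Fourier multiplier `jmult t` on phase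
space. For a Schwartz symbol f the kernel of Op^τ(f) is the Fourier transform of f in ξ, taken at
the base point x - τ(x-y) and at the frequency variable x - y; on such partial transforms `J s` acts
as the translation of the base point by s(x-y) (`sndFT_J`). Hence Op^τ(f) = Op^0(J(-τ)f)
(`tauInt_J`), the passage from τ'-symbols to τ-symbols is `J (τ - τ')`, and the asymptotic sum is
the Taylor polynomial of the exponential, sorted by the multinomial theorem (`sum_multiPairs_eq`).
The substitution κ is harmless: (x,ξ) ↦ (κ⁻¹x, ᵗκξ) preserves both the pairing and the volume, so
that conjugation by κ composes the symbol with `liftMap κ` in every quantization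
(`tauInt_comp_liftMap`), and S(g,m) is stable under this composition.

The analytic core is the bound of the Taylor remainder of `J t` from S(g,w) to S(g,w h^N)
(`exists_symBd_jrem`). A Schwartz function is written as the integral over Z of its products with a
partition of unity adapted to g. In coordinates normalized at Z each piece lies in a fixed small
ball with uniformly bounded derivatives, while the time t becomes t h(Z) (`J_comp_affine`). Near the
support the L¹ norm of the Fourier transform suffices. Away from it all Taylor terms vanish, so the
value of `J` is a remainder of arbitrary order and decays like a power of h(Z)/‖W‖, that is, like a
power of (1 + g^σ_Z(X-Z))⁻¹. This beats the temperate growth of the weight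
(`exists_J_localPiece_le`), and integration over Z gives the pointwise bound. Since `J t` commutes
with derivatives and each ⟨∂_x,∂_ξ⟩ gains a factor h, the bounds for derivatives and remainders
follow.

From Schwartz functions to symbols one passes by truncation: truncations converge once the weight is
enlarged by 1+|x|²+|ξ|², and the sharp bounds survive in the limit (`IsSym.exists_jrem`). On the
operator side, integration by parts makes the inner integral decay rapidly in ξ, because a
derivative costs at most |ξ|^δ with δ < 1 (`exists_fourier_decay`). Finally Op^0(c) acts
continuously on Schwartz space (`exists_stdQuant_clm`) and determines c (`eq_of_stdQuant_eq`); since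
`J` is a group, existence and uniqueness carry over to every τ. -/

noncomputable section

open scoped FourierTransform LineDeriv

/-- The admissible range of the exponents. -/
structure Admissible (ρ δ : ℝ) : Prop where
  nonneg : 0 ≤ δ
  lt : δ < ρ
  le_one : ρ ≤ 1

theorem Admissible.pos {ρ δ : ℝ} (hp : Admissible ρ δ) : 0 < ρ := hp.nonneg.trans_lt hp.lt

theorem Admissible.lt_one {ρ δ : ℝ} (hp : Admissible ρ δ) : δ < 1 := hp.lt.trans_le hp.le_one

/-! ### The scale 1+|x|²+|ξ|²: slow variation and temperance. -/

section Scale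

variable {n : ℕ}

/-- `1 + |x|² + |ξ|²`. -/
def lam (X : Phase n) : ℝ := 1 + ‖X.1‖ ^ 2 + ‖X.2‖ ^ 2

theorem one_le_lam (X : Phase n) : 1 ≤ lam X := by
  unfold lam; nlinarith [sq_nonneg ‖X.1‖, sq_nonneg ‖X.2‖]

theorem lam_pos (X : Phase n) : 0 < lam X := one_pos.trans_le (one_le_lam X)

theorem lam_rpow_pos (X : Phase n) (s : ℝ) : 0 < lam X ^ s := Real.rpow_pos_of_pos (lam_pos X) s

theorem one_le_lam_rpow (X : Phase n) {s : ℝ} (hs : 0 ≤ s) : 1 ≤ lam X ^ s :=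
  Real.one_le_rpow (one_le_lam X) hs

theorem lam_rpow_le_one (X : Phase n) {s : ℝ} (hs : s ≤ 0) : lam X ^ s ≤ 1 :=
  Real.rpow_le_one_of_one_le_of_nonpos (one_le_lam X) hs

theorem lam_rpow_le_rpow (X : Phase n) {s t : ℝ} (hs : s ≤ t) : lam X ^ s ≤ lam X ^ t :=
  Real.rpow_le_rpow_of_exponent_le (one_le_lam X) hs

theorem lam_le_sq (X : Phase n) : lam X ≤ 2 * (1 + ‖X‖) ^ 2 := by
  have h1 := norm_fst_le X
  have h2 := norm_snd_le X
  have := norm_nonneg X.1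
  have := norm_nonneg X.2
  have := norm_nonneg X
  unfold lam; nlinarith

theorem norm_sq_le_lam (X : Phase n) : ‖X‖ ^ 2 ≤ lam X := by
  rcases max_choice ‖X.1‖ ‖X.2‖ with h | h <;>
  · rw [Prod.norm_def, h]; unfold lam; nlinarith [sq_nonneg ‖X.1‖, sq_nonneg ‖X.2‖]

theorem contDiff_lam : ContDiff ℝ ∞ (lam : Phase n → ℝ) := by
  unfold lam
  exact (contDiff_const.add (contDiff_fst.norm_sq ℝ)).add (contDiff_snd.norm_sq ℝ)

/-- The map `(y, η) ↦ (r y, s η)`. -/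
def dil (n : ℕ) (r s : ℝ) : Phase n →L[ℝ] Phase n :=
  (r • ContinuousLinearMap.fst ℝ (Euc n) (Euc n)).prod (s • ContinuousLinearMap.snd ℝ (Euc n) (Euc n))

@[simp] theorem dil_apply (r s : ℝ) (W : Phase n) : dil n r s W = (r • W.1, s • W.2) := rfl

theorem norm_dil_apply_le {r s c : ℝ} (hr : |r| ≤ c) (hs : |s| ≤ c) (W : Phase n) :
    ‖dil n r s W‖ ≤ c * ‖W‖ := by
  have hc : 0 ≤ c := (abs_nonneg r).trans hr
  rw [dil_apply, Prod.norm_def]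
  refine max_le ?_ ?_ <;> simp only [norm_smul, Real.norm_eq_abs]
  · exact mul_le_mul hr (norm_fst_le W) (norm_nonneg _) hc
  · exact mul_le_mul hs (norm_snd_le W) (norm_nonneg _) hc

theorem norm_dil_le {r s c : ℝ} (hr : |r| ≤ c) (hs : |s| ≤ c) : ‖dil n r s‖ ≤ c :=
  ContinuousLinearMap.opNorm_le_bound _ ((abs_nonneg r).trans hr) (norm_dil_apply_le hr hs)

/-- The linear map whose image of the unit ball is comparable to the unit ball of `g_X`. -/
def frame (ρ δ : ℝ) (X : Phase n) : Phase n →L[ℝ] Phase n :=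
  dil n (lam X ^ (-δ / 2)) (lam X ^ (ρ / 2))

/-- The inverse of `frame`. -/
def coframe (ρ δ : ℝ) (X : Phase n) : Phase n →L[ℝ] Phase n :=
  dil n (lam X ^ (δ / 2)) (lam X ^ (-ρ / 2))

theorem lam_rpow_mul (X : Phase n) (s t : ℝ) : lam X ^ s * lam X ^ t = lam X ^ (s + t) :=
  (Real.rpow_add (lam_pos X) s t).symm

theorem lam_rpow_pow (X : Phase n) (s : ℝ) (N : ℕ) : (lam X ^ s) ^ N = lam X ^ (s * N) := by
  rw [Real.rpow_mul (lam_pos X).le, Real.rpow_natCast]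

@[simp] theorem frame_coframe (ρ δ : ℝ) (X T : Phase n) : frame ρ δ X (coframe ρ δ X T) = T := by
  ext1 <;> simp only [frame, coframe, dil_apply, smul_smul, lam_rpow_mul] <;>
  · ring_nf; simp

@[simp] theorem coframe_frame (ρ δ : ℝ) (X T : Phase n) : coframe ρ δ X (frame ρ δ X T) = T := by
  ext1 <;> simp only [frame, coframe, dil_apply, smul_smul, lam_rpow_mul] <;>
  · ring_nf; simp

/-- The Planck function `(1 + |x|² + |ξ|²)^{(δ-ρ)/2}`. -/
def planck (ρ δ : ℝ) (X : Phase n) : ℝ := lam X ^ ((δ - ρ) / 2)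

theorem planck_pos (ρ δ : ℝ) (X : Phase n) : 0 < planck ρ δ X := lam_rpow_pos _ _

theorem planck_le_one {ρ δ : ℝ} (hp : Admissible ρ δ) (X : Phase n) : planck ρ δ X ≤ 1 :=
  lam_rpow_le_one _ (by linarith [hp.lt])

/-- The closed form of the dual metric `g^σ`. -/
def dualG (ρ δ : ℝ) (X T : Phase n) : ℝ := lam X ^ ρ * ‖T.1‖ ^ 2 + lam X ^ (-δ) * ‖T.2‖ ^ 2

theorem dualG_nonneg (ρ δ : ℝ) (X T : Phase n) : 0 ≤ dualG ρ δ X T := by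
  have := (lam_rpow_pos X ρ).le
  have := (lam_rpow_pos X (-δ)).le
  unfold dualG; positivity

theorem dualG_neg (ρ δ : ℝ) (X T : Phase n) : dualG ρ δ X (-T) = dualG ρ δ X T := by
  simp [dualG]

/-- The metric is conformal to its dual, g = h² g^σ: both blocks have the same ratio h². Lengths in
g^σ can therefore be read off from `coframe`, up to the factor between the maximum norm and the
Euclidean norm. -/
theorem dualG_eq (ρ δ : ℝ) (X T : Phase n) : dualG ρ δ X T =
    (planck ρ δ X ^ 2)⁻¹ * (‖(coframe ρ δ X T).1‖ ^ 2 + ‖(coframe ρ δ X T).2‖ ^ 2) := by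
  have hx := lam_pos X
  simp only [coframe, dil_apply, norm_smul, Real.norm_eq_abs, abs_of_pos (lam_rpow_pos X _),
    mul_pow, planck, lam_rpow_pow, dualG, mul_add, ← mul_assoc, ← Real.rpow_neg hx.le, lam_rpow_mul]
  congr 3 <;> · push_cast; ring

theorem planck_sq_mul_dualG_le (ρ δ : ℝ) (X T : Phase n) :
    dualG ρ δ X T ≤ 2 * (‖coframe ρ δ X T‖ / planck ρ δ X) ^ 2 := by
  rw [dualG_eq]
  have hq := planck_pos ρ δ X
  generalize planck ρ δ X = q at *
  generalize coframe ρ δ X T = W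
  have h1 : ‖W.1‖ ^ 2 ≤ ‖W‖ ^ 2 := by gcongr; exact norm_fst_le W
  have h2 : ‖W.2‖ ^ 2 ≤ ‖W‖ ^ 2 := by gcongr; exact norm_snd_le W
  rw [div_pow, inv_mul_eq_div, mul_div_assoc']
  gcongr; linarith

theorem le_dualG (ρ δ : ℝ) (X T : Phase n) :
    (‖coframe ρ δ X T‖ / planck ρ δ X) ^ 2 ≤ dualG ρ δ X T := by
  rw [dualG_eq]
  have hq := planck_pos ρ δ X
  generalize planck ρ δ X = q at *
  generalize coframe ρ δ X T = W
  have h1 : ‖W‖ ^ 2 ≤ ‖W.1‖ ^ 2 + ‖W.2‖ ^ 2 := by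
    rcases max_choice ‖W.1‖ ‖W.2‖ with h | h <;>
    · rw [Prod.norm_def, h]; nlinarith [sq_nonneg ‖W.1‖, sq_nonneg ‖W.2‖]
  rw [div_pow, inv_mul_eq_div]
  gcongr

theorem lam_le_add (X Z : Phase n) :
    lam X ≤ 2 * lam Z + 2 * (‖(X - Z).1‖ ^ 2 + ‖(X - Z).2‖ ^ 2) := by
  have h1 : ‖X.1‖ ≤ ‖Z.1‖ + ‖(X - Z).1‖ := by
    simpa using norm_add_le Z.1 (X - Z).1
  have h2 : ‖X.2‖ ≤ ‖Z.2‖ + ‖(X - Z).2‖ := by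
    simpa using norm_add_le Z.2 (X - Z).2
  have := norm_nonneg X.1
  have := norm_nonneg X.2
  unfold lam
  nlinarith [sq_nonneg (‖Z.1‖ - ‖(X - Z).1‖), sq_nonneg (‖Z.2‖ - ‖(X - Z).2‖)]

/-- After multiplication by λ^δ the coefficients of g^σ are λ^(δ+ρ) ≥ 1 and 1. The loss of λ^δ, with
δ < 1, is what makes the temperance of `lam` possible. -/
theorem sq_le_dualG {ρ δ : ℝ} (hp : Admissible ρ δ) (X T : Phase n) :
    ‖T.1‖ ^ 2 + ‖T.2‖ ^ 2 ≤ lam X ^ δ * dualG ρ δ X T := by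
  unfold dualG
  rw [mul_add, ← mul_assoc, ← mul_assoc, lam_rpow_mul, lam_rpow_mul]
  have h1 := one_le_lam_rpow X (s := δ + ρ) (by linarith [hp.nonneg, hp.pos])
  simp only [add_neg_cancel, Real.rpow_zero, one_mul]
  nlinarith [sq_nonneg ‖T.1‖]

theorem lam_le_mul_dualG {ρ δ : ℝ} (hp : Admissible ρ δ) (X Z : Phase n) :
    lam X ≤ 4 * lam Z * (1 + dualG ρ δ Z (X - Z)) := by
  have h1 := lam_le_add X Z
  have h2 := sq_le_dualG hp Z (X - Z)
  have h3 : lam Z ^ δ ≤ lam Z := by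
    simpa using lam_rpow_le_rpow Z hp.lt_one.le
  have h4 := dualG_nonneg ρ δ Z (X - Z)
  have h5 := lam_pos Z
  nlinarith [mul_le_mul_of_nonneg_right h3 h4, mul_nonneg h5.le h4]

/-- With G = g^σ_Z(X-Z) one has λ(Z) ≤ 2λ(X) + 2λ(Z)^δ G. Either the last term is absorbed by the
left side, or λ(Z)^(1-δ) is bounded by a multiple of 1+G; the second case produces the exponent
1/(1-δ). -/
theorem exists_lam_le_mul_dualG_pow {ρ δ : ℝ} (hp : Admissible ρ δ) :
    ∃ K : ℕ, ∀ X Z : Phase n, lam Z ≤ 8 ^ K * lam X * (1 + dualG ρ δ Z (X - Z)) ^ K := by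
  obtain ⟨K, hK⟩ := exists_nat_ge (1 / (1 - δ))
  have hd : 0 < 1 - δ := by linarith [hp.lt_one]
  have hK1 : (1 : ℝ) ≤ K := by
    refine le_trans ?_ hK
    rw [le_div_iff₀ hd]; linarith [hp.nonneg]
  refine ⟨K, fun X Z => ?_⟩
  have h1 := lam_le_add Z X
  have h2 := sq_le_dualG hp Z (Z - X)
  rw [← neg_sub X Z, dualG_neg] at h2
  rw [← neg_sub X Z] at h1
  have h4 := dualG_nonneg ρ δ Z (X - Z)
  set G := dualG ρ δ Z (X - Z)
  have hZ := lam_pos Z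
  have hX := lam_pos X
  have hpow : (1 : ℝ) ≤ (1 + G) ^ K := one_le_pow₀ (by linarith)
  have h8 : (8 : ℝ) ≤ 8 ^ K := by
    simpa using pow_le_pow_right₀ (show (1:ℝ) ≤ 8 by norm_num) (show 1 ≤ K by exact_mod_cast hK1)
  by_cases hc : 2 * lam Z ^ δ * G ≤ lam Z / 2
  · have : lam Z ≤ 8 * lam X := by nlinarith
    calc lam Z ≤ 8 * lam X := this
      _ ≤ 8 ^ K * lam X * 1 := by rw [mul_one]; gcongr
      _ ≤ _ := by gcongr
  · push Not at hc
    have h5 : lam Z ^ (1 - δ) ≤ 8 * (1 + G) := by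
      rw [Real.rpow_sub hZ, Real.rpow_one, div_le_iff₀ (lam_rpow_pos Z δ)]
      nlinarith [lam_rpow_pos Z δ]
    have h6 : lam Z ≤ (8 * (1 + G)) ^ (1 / (1 - δ)) := by
      calc lam Z = (lam Z ^ (1 - δ)) ^ (1 / (1 - δ)) := by
            rw [← Real.rpow_mul hZ.le, mul_one_div_cancel hd.ne', Real.rpow_one]
        _ ≤ _ := by gcongr
    calc lam Z ≤ (8 * (1 + G)) ^ (1 / (1 - δ)) := h6
      _ ≤ (8 * (1 + G)) ^ (K : ℝ) := by
        apply Real.rpow_le_rpow_of_exponent_le _ hK; linarith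
      _ = 8 ^ K * 1 * (1 + G) ^ K := by rw [Real.rpow_natCast, mul_pow, mul_one]
      _ ≤ _ := by gcongr; exact one_le_lam X

/-- Both entries of `frame` are at most λ^(1/2), because δ ≥ 0 and ρ ≤ 1. A displacement that is
small in the frame is thus small compared with λ^(1/2). -/
theorem lam_slow {ρ δ : ℝ} (hp : Admissible ρ δ) {X Y : Phase n}
    (h : ‖coframe ρ δ X (Y - X)‖ ≤ 1 / 100) : lam Y ≤ 2 * lam X ∧ lam X ≤ 2 * lam Y := by
  set W := coframe ρ δ X (Y - X)
  have hW : Y - X = frame ρ δ X W := (frame_coframe ρ δ X _).symm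
  have a1 : ‖(Y - X).1‖ ^ 2 ≤ lam X / 10000 := by
    rw [hW]
    simp only [frame, dil_apply, norm_smul, Real.norm_eq_abs, abs_of_pos (lam_rpow_pos X _)]
    have e1 := lam_rpow_le_one X (s := -δ / 2) (by linarith [hp.nonneg])
    have e2 := (norm_fst_le W).trans h
    have e3 : lam X ^ (-δ / 2) * ‖W.1‖ ≤ 1 * (1 / 100) := by gcongr
    have e4 := (lam_rpow_pos X (-δ/2)).le
    have : (lam X ^ (-δ / 2) * ‖W.1‖) ^ 2 ≤ (1 * (1 / 100)) ^ 2 := by gcongr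
    linarith [one_le_lam X]
  have a2 : ‖(Y - X).2‖ ^ 2 ≤ lam X / 10000 := by
    rw [hW]
    simp only [frame, dil_apply, norm_smul, Real.norm_eq_abs, abs_of_pos (lam_rpow_pos X _)]
    have e1 : (lam X ^ (ρ / 2)) ^ 2 ≤ lam X := by
      rw [lam_rpow_pow]
      calc _ ≤ lam X ^ (1 : ℝ) := lam_rpow_le_rpow X (by push_cast; linarith [hp.le_one])
        _ = _ := Real.rpow_one _
    have e2 := (norm_snd_le W).trans h
    have e3 : ‖W.2‖ ^ 2 ≤ (1 / 100) ^ 2 := by gcongr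
    rw [mul_pow]
    calc _ ≤ lam X * (1 / 100) ^ 2 := by gcongr; exact (lam_pos X).le
      _ = _ := by ring
  have b1 : ‖Y.1‖ ≤ ‖X.1‖ + ‖(Y - X).1‖ := by simpa using norm_add_le X.1 (Y - X).1
  have b2 : ‖Y.2‖ ≤ ‖X.2‖ + ‖(Y - X).2‖ := by simpa using norm_add_le X.2 (Y - X).2
  have b3 : ‖X.1‖ ≤ ‖Y.1‖ + ‖(Y - X).1‖ := by simpa using norm_sub_le Y.1 (Y - X).1
  have b4 : ‖X.2‖ ≤ ‖Y.2‖ + ‖(Y - X).2‖ := by simpa using norm_sub_le Y.2 (Y - X).2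
  have hX := one_le_lam X
  -- The factor 3/2 leaves room below 2 for the error terms, which amount to 6λ(X)/10000.
  have key : ∀ a b t : ℝ, 0 ≤ a → a ≤ b + t → a ^ 2 ≤ 3 / 2 * b ^ 2 + 3 * t ^ 2 := by
    intro a b t ha hab
    have : a ^ 2 ≤ (b + t) ^ 2 := by gcongr
    nlinarith [sq_nonneg (b - 2 * t)]
  have c1 := key _ _ _ (norm_nonneg _) b1
  have c2 := key _ _ _ (norm_nonneg _) b2
  have c3 := key _ _ _ (norm_nonneg _) b3
  have c4 := key _ _ _ (norm_nonneg _) b4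
  unfold lam at *
  constructor <;> linarith

theorem rpow_le_of_comparable {a b c : ℝ} (ha : 0 < a) (hb : 0 < b) (hc : 1 ≤ c)
    (h1 : a ≤ c * b) (h2 : b ≤ c * a) (s : ℝ) : a ^ s ≤ c ^ |s| * b ^ s := by
  have hc0 : 0 < c := one_pos.trans_le hc
  rcases le_total 0 s with hs | hs
  · rw [abs_of_nonneg hs, ← Real.mul_rpow hc0.le hb.le]
    gcongr
  · rw [abs_of_nonpos hs, Real.rpow_neg hc0.le, inv_mul_eq_div, le_div_iff₀ (by positivity),
      ← Real.mul_rpow ha.le hc0.le, mul_comm]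
    exact Real.rpow_le_rpow_of_nonpos hb h2 hs

end Scale

/-! ### Temperate weights, normalized by means of `coframe`. -/

/-- Weights that vary slowly and temperately with respect to the metric. -/
structure TW {n : ℕ} (ρ δ : ℝ) (w : Phase n → ℝ) : Prop where
  pos : ∀ X, 0 < w X
  slow : ∃ c > 0, ∃ C > 0, ∀ X Y : Phase n, ‖coframe ρ δ X (Y - X)‖ ≤ c →
    w X ≤ C * w Y ∧ w Y ≤ C * w X
  temperate : ∃ C > 0, ∃ N : ℕ, ∀ X Y : Phase n, w X ≤ C * w Y * (1 + dualG ρ δ Y (X - Y)) ^ N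

section Weights

variable {n : ℕ} {ρ δ : ℝ}

theorem TW.mul {w v : Phase n → ℝ} (hw : TW ρ δ w) (hv : TW ρ δ v) :
    TW ρ δ (fun X => w X * v X) := by
  obtain ⟨c, hc, C, hC, h⟩ := hw.slow
  obtain ⟨c', hc', C', hC', h'⟩ := hv.slow
  obtain ⟨D, hD, N, hN⟩ := hw.temperate
  obtain ⟨D', hD', N', hN'⟩ := hv.temperate
  refine ⟨fun X => mul_pos (hw.pos X) (hv.pos X), ⟨min c c', lt_min hc hc', C * C', mul_pos hC hC',
    fun X Y hXY => ?_⟩, D * D', mul_pos hD hD', N + N', fun X Y => ?_⟩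
  · have h1 := h X Y (hXY.trans (min_le_left _ _))
    have h2 := h' X Y (hXY.trans (min_le_right _ _))
    have := hw.pos X; have := hw.pos Y; have := hv.pos X; have := hv.pos Y
    constructor
    · calc w X * v X ≤ (C * w Y) * (C' * v Y) := by gcongr; exacts [h1.1, h2.1]
        _ = _ := by ring
    · calc w Y * v Y ≤ (C * w X) * (C' * v X) := by gcongr; exacts [h1.2, h2.2]
        _ = _ := by ring
  · have := hw.pos X; have := hw.pos Y; have := hv.pos X; have := hv.pos Y
    have := dualG_nonneg ρ δ Y (X - Y)
    calc w X * v X ≤ (D * w Y * (1 + dualG ρ δ Y (X - Y)) ^ N) *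
          (D' * v Y * (1 + dualG ρ δ Y (X - Y)) ^ N') := by gcongr; exacts [hN X Y, hN' X Y]
      _ = _ := by ring

/-- The sign of s is arbitrary, so temperance of `lam` is needed in both directions. The common
factor 8^(K+1) (1+G)^(K+1) makes the two comparisons symmetric. -/
theorem TW.lam_rpow (hp : Admissible ρ δ) (s : ℝ) : TW ρ δ (fun X : Phase n => lam X ^ s) := by
  refine ⟨fun X => lam_rpow_pos X s, ⟨1 / 100, by norm_num, 2 ^ |s|, by positivity,
    fun X Y h => ?_⟩, ?_⟩
  · have := lam_slow hp h
    exact ⟨rpow_le_of_comparable (lam_pos X) (lam_pos Y) one_le_two this.2 this.1 s,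
      rpow_le_of_comparable (lam_pos Y) (lam_pos X) one_le_two this.1 this.2 s⟩
  · obtain ⟨K, hK⟩ := exists_lam_le_mul_dualG_pow (n := n) hp
    obtain ⟨M, hM⟩ := exists_nat_ge |s|
    refine ⟨(8 ^ (K + 1)) ^ |s|, by positivity, (K + 1) * M, fun X Y => ?_⟩
    have hG := dualG_nonneg ρ δ Y (X - Y)
    set G := dualG ρ δ Y (X - Y)
    have hX := lam_pos X
    have hY := lam_pos Y
    have h1G : 1 ≤ 1 + G := by linarith
    have h1 := lam_le_mul_dualG hp X Y
    have h2 := hK X Y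
    have key := rpow_le_of_comparable (c := 8 ^ (K + 1) * (1 + G) ^ (K + 1)) hX hY
      (one_le_mul_of_one_le_of_one_le (one_le_pow₀ (by norm_num)) (one_le_pow₀ h1G))
      (h1.trans ?_) (h2.trans ?_) s
    · refine key.trans ?_
      rw [Real.mul_rpow (by positivity) (by positivity)]
      have : ((1 + G) ^ (K + 1)) ^ |s| ≤ (1 + G) ^ ((K + 1) * M) := by
        rw [pow_mul, ← Real.rpow_natCast _ M]
        exact Real.rpow_le_rpow_of_exponent_le (one_le_pow₀ h1G) hM
      calc _ ≤ (8 ^ (K + 1)) ^ |s| * (1 + G) ^ ((K + 1) * M) * lam Y ^ s := by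
            gcongr
        _ = _ := by ring
    · calc 4 * lam Y * (1 + G) ≤ 8 ^ (K + 1) * lam Y * (1 + G) ^ (K + 1) := by
            have a1 : (4 : ℝ) ≤ 8 ^ (K + 1) := by
              have : (1 : ℝ) ≤ 8 ^ K := one_le_pow₀ (by norm_num)
              rw [pow_succ]; linarith
            have a2 : 1 + G ≤ (1 + G) ^ (K + 1) := le_self_pow₀ h1G (by omega)
            gcongr
        _ = _ := by ring
    · calc 8 ^ K * lam X * (1 + G) ^ K ≤ 8 ^ (K + 1) * lam X * (1 + G) ^ (K + 1) := by
            gcongr <;> norm_num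
        _ = _ := by ring

theorem TW.planck_pow (hp : Admissible ρ δ) (N : ℕ) :
    TW ρ δ (fun X : Phase n => planck ρ δ X ^ N) := by
  simpa only [planck, lam_rpow_pow] using TW.lam_rpow (n := n) hp ((δ - ρ) / 2 * N)

/-- Temperance with base point 0: there g^σ is Euclidean, so that 1 + g^σ_0(X) is exactly λ(X). -/
theorem TW.exists_le_lam_pow {w : Phase n → ℝ} (hw : TW ρ δ w) :
    ∃ C > 0, ∃ N : ℕ, ∀ X, w X ≤ C * lam X ^ N := by
  obtain ⟨C, hC, N, h⟩ := hw.temperate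
  refine ⟨C * w 0, mul_pos hC (hw.pos 0), N, fun X => ?_⟩
  convert h X 0 using 2
  simp [dualG, lam, add_assoc]

theorem stdMetric_frame (ρ δ : ℝ) (X W : Phase n) :
    stdMetric n ρ δ X (frame ρ δ X W) = ‖W.1‖ ^ 2 + ‖W.2‖ ^ 2 := by
  change lam X ^ δ * _ + lam X ^ (-ρ) * _ = _
  simp only [frame, dil_apply, norm_smul, Real.norm_eq_abs, abs_of_pos (lam_rpow_pos X _), mul_pow,
    lam_rpow_pow, ← mul_assoc, lam_rpow_mul]
  have e1 : δ + -δ / 2 * (2 : ℕ) = 0 := by push_cast; ring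
  have e2 : -ρ + ρ / 2 * (2 : ℕ) = 0 := by push_cast; ring
  simp only [e1, e2, Real.rpow_zero, one_mul]

theorem stdMetric_le (ρ δ : ℝ) (X T : Phase n) :
    stdMetric n ρ δ X T ≤ 2 * ‖coframe ρ δ X T‖ ^ 2 := by
  conv_lhs => rw [← frame_coframe ρ δ X T, stdMetric_frame]
  generalize coframe ρ δ X T = W
  have h1 : ‖W.1‖ ^ 2 ≤ ‖W‖ ^ 2 := by gcongr; exact norm_fst_le W
  have h2 : ‖W.2‖ ^ 2 ≤ ‖W‖ ^ 2 := by gcongr; exact norm_snd_le W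
  linarith

theorem le_stdMetric (ρ δ : ℝ) (X T : Phase n) :
    ‖coframe ρ δ X T‖ ^ 2 ≤ stdMetric n ρ δ X T := by
  conv_rhs => rw [← frame_coframe ρ δ X T, stdMetric_frame]
  generalize coframe ρ δ X T = W
  rcases max_choice ‖W.1‖ ‖W.2‖ with h | h <;>
  · rw [Prod.norm_def, h]; nlinarith [sq_nonneg ‖W.1‖, sq_nonneg ‖W.2‖]

theorem IsTemperateWeight.tw {m : Phase n → ℝ} (hm : IsTemperateWeight (stdMetric n ρ δ) m) :
    TW ρ δ m := by
  refine ⟨hm.pos, ?_, ?_⟩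
  · obtain ⟨c, hc, C, hC, h⟩ := hm.metricContinuous
    -- The factor 1/2 accounts for `stdMetric_le`: the phase space carries the maximum norm of the
    -- two components.
    refine ⟨Real.sqrt (c / 2), by positivity, C, hC, fun X Y hXY => ?_⟩
    have : ‖coframe ρ δ X (Y - X)‖ ^ 2 ≤ c / 2 := by
      rw [← Real.sq_sqrt (show 0 ≤ c / 2 by positivity)]; gcongr
    have h1 := h X Y ((stdMetric_le ρ δ X _).trans (by linarith))
    exact ⟨by rw [mul_comm]; exact (div_le_iff₀ hC).1 h1.1, h1.2⟩
  · obtain ⟨C, hC, N, h⟩ := hm.temperate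
    refine ⟨C, hC, N, fun X Y => ?_⟩
    have := h X Y
    rw [dualMetric_stdMetric] at this
    exact this

end Weights
-- Symbol seminorms measured in the frame of g.
section SymbolNorm

variable {n : ℕ} {ρ δ : ℝ}

theorem norm_frame_le (hp : Admissible ρ δ) (X : Phase n) :
    ‖frame ρ δ X‖ ≤ lam X ^ (1 / 2 : ℝ) := by
  have h0 := hp.nonneg
  have h1 := hp.le_one
  refine norm_dil_le ?_ ?_ <;> rw [abs_of_pos (lam_rpow_pos X _)] <;>
    apply lam_rpow_le_rpow <;> linarith

theorem norm_coframe_le (hp : Admissible ρ δ) (X : Phase n) :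
    ‖coframe ρ δ X‖ ≤ lam X ^ (1 / 2 : ℝ) := by
  have h0 := hp.lt_one
  have h1 := hp.pos
  refine norm_dil_le ?_ ?_ <;> rw [abs_of_pos (lam_rpow_pos X _)] <;>
    apply lam_rpow_le_rpow <;> linarith

/-- The norm of the `j`-th derivative at `X` measured with `g_X`. -/
def symNorm (ρ δ : ℝ) (j : ℕ) (f : Phase n → ℂ) (X : Phase n) : ℝ :=
  ‖(iteratedFDeriv ℝ j f X).compContinuousLinearMap (fun _ => frame ρ δ X)‖

theorem symNorm_nonneg (j : ℕ) (f : Phase n → ℂ) (X : Phase n) : 0 ≤ symNorm ρ δ j f X :=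
  norm_nonneg _

theorem symNorm_zero (f : Phase n → ℂ) (X : Phase n) : symNorm ρ δ 0 f X = ‖f X‖ := by
  apply le_antisymm
  · refine ContinuousMultilinearMap.opNorm_le_bound (norm_nonneg _) fun m => ?_
    simp
  · have := ((iteratedFDeriv ℝ 0 f X).compContinuousLinearMap
      (fun _ => frame ρ δ X)).le_opNorm (fun _ => 0)
    simpa [symNorm] using this

theorem symNorm_le (hp : Admissible ρ δ) (j : ℕ) (f : Phase n → ℂ) (X : Phase n) :
    symNorm ρ δ j f X ≤ (lam X ^ (1 / 2 : ℝ)) ^ j * ‖iteratedFDeriv ℝ j f X‖ := by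
  refine (ContinuousMultilinearMap.norm_compContinuousLinearMap_le _ _).trans ?_
  rw [mul_comm]
  gcongr
  simp only [Finset.prod_const, Finset.card_univ, Fintype.card_fin]
  gcongr
  exact norm_frame_le hp X

theorem norm_iteratedFDeriv_apply_le (j : ℕ) (f : Phase n → ℂ) (X : Phase n) (t : Fin j → Phase n) :
    ‖iteratedFDeriv ℝ j f X t‖ ≤ symNorm ρ δ j f X * ∏ i, ‖coframe ρ δ X (t i)‖ := by
  have := ((iteratedFDeriv ℝ j f X).compContinuousLinearMap
      (fun _ => frame ρ δ X)).le_opNorm (fun i => coframe ρ δ X (t i))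
  simp only [ContinuousMultilinearMap.compContinuousLinearMap_apply, frame_coframe] at this
  exact this

theorem norm_iteratedFDeriv_le_symNorm (hp : Admissible ρ δ) (j : ℕ) (f : Phase n → ℂ)
    (X : Phase n) :
    ‖iteratedFDeriv ℝ j f X‖ ≤ (lam X ^ (1 / 2 : ℝ)) ^ j * symNorm ρ δ j f X := by
  have h0 := (lam_rpow_pos X (1 / 2)).le
  refine ContinuousMultilinearMap.opNorm_le_bound
    (mul_nonneg (by positivity) (symNorm_nonneg _ _ _)) fun t => ?_
  refine (norm_iteratedFDeriv_apply_le (ρ := ρ) (δ := δ) j f X t).trans ?_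
  have : ∏ i, ‖coframe ρ δ X (t i)‖ ≤ ∏ i, (lam X ^ (1 / 2 : ℝ) * ‖t i‖) := by
    gcongr with i
    exact (coframe ρ δ X).le_of_opNorm_le (norm_coframe_le hp X) _
  rw [Finset.prod_mul_distrib] at this
  simp only [Finset.prod_const, Finset.card_univ, Fintype.card_fin] at this
  calc _ ≤ _ := mul_le_mul_of_nonneg_left this (symNorm_nonneg _ _ _)
    _ = _ := by ring

/-- Seen this way the g-norm is the ordinary norm of a derivative at the origin of a rescaled
function, so that the usual Leibniz inequality applies to it. -/
theorem symNorm_eq_comp {f : Phase n → ℂ} (hf : ContDiff ℝ ∞ f) (j : ℕ) (X : Phase n) :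
    symNorm ρ δ j f X = ‖iteratedFDeriv ℝ j (fun W => f (X + frame ρ δ X W)) 0‖ := by
  have h1 : ContDiff ℝ ∞ (fun Y => f (X + Y)) := hf.comp (contDiff_const.add contDiff_id)
  have := (frame ρ δ X).iteratedFDeriv_comp_right (f := fun Y => f (X + Y)) h1 0
    (i := j) (by exact_mod_cast le_top)
  rw [Function.comp_def] at this
  rw [this, iteratedFDeriv_comp_add_left]
  simp [symNorm]

/-- `f` satisfies the estimates of order at most `k` of `S(g, w)` with the constant `C`. -/
def SymBd (ρ δ : ℝ) (w : Phase n → ℝ) (k : ℕ) (C : ℝ) (f : Phase n → ℂ) : Prop :=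
  ∀ j ≤ k, ∀ X, symNorm ρ δ j f X ≤ C * w X

theorem SymBd.mono {w w' : Phase n → ℝ} {k k' : ℕ} {C C' : ℝ} {f : Phase n → ℂ}
    (h : SymBd ρ δ w k C f) (hk : k' ≤ k) (hC : ∀ X, C * w X ≤ C' * w' X) :
    SymBd ρ δ w' k' C' f :=
  fun j hj X => (h j (hj.trans hk) X).trans (hC X)

theorem SymBd.norm_le {w : Phase n → ℝ} {k : ℕ} {C : ℝ} {f : Phase n → ℂ}
    (h : SymBd ρ δ w k C f) (X : Phase n) : ‖f X‖ ≤ C * w X := by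
  simpa [symNorm_zero] using h 0 (Nat.zero_le _) X

theorem symNorm_add_le {f g : Phase n → ℂ} (hf : ContDiff ℝ ∞ f) (hg : ContDiff ℝ ∞ g) (j : ℕ)
    (X : Phase n) : symNorm ρ δ j (fun Y => f Y + g Y) X ≤ symNorm ρ δ j f X + symNorm ρ δ j g X := by
  unfold symNorm
  rw [show (fun Y => f Y + g Y) = f + g from rfl,
    iteratedFDeriv_add_apply (hf.of_le (by exact_mod_cast le_top)).contDiffAt (hg.of_le (by exact_mod_cast le_top)).contDiffAt]
  exact norm_add_le ((iteratedFDeriv ℝ j f X).compContinuousLinearMap (fun _ => frame ρ δ X))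
    ((iteratedFDeriv ℝ j g X).compContinuousLinearMap (fun _ => frame ρ δ X))

theorem symNorm_sub_le {f g : Phase n → ℂ} (hf : ContDiff ℝ ∞ f) (hg : ContDiff ℝ ∞ g) (j : ℕ)
    (X : Phase n) : symNorm ρ δ j (fun Y => f Y - g Y) X ≤ symNorm ρ δ j f X + symNorm ρ δ j g X := by
  unfold symNorm
  rw [show (fun Y => f Y - g Y) = f - g from rfl,
    iteratedFDeriv_sub_apply (hf.of_le (by exact_mod_cast le_top)).contDiffAt (hg.of_le (by exact_mod_cast le_top)).contDiffAt]
  exact norm_sub_le ((iteratedFDeriv ℝ j f X).compContinuousLinearMap (fun _ => frame ρ δ X))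
    ((iteratedFDeriv ℝ j g X).compContinuousLinearMap (fun _ => frame ρ δ X))

theorem symNorm_mul_le {f g : Phase n → ℂ} (hf : ContDiff ℝ ∞ f) (hg : ContDiff ℝ ∞ g) (j : ℕ)
    (X : Phase n) : symNorm ρ δ j (fun Y => f Y * g Y) X ≤
      ∑ i ∈ Finset.range (j + 1), (j.choose i : ℝ) * symNorm ρ δ i f X * symNorm ρ δ (j - i) g X := by
  have hA : ContDiff ℝ ∞ (fun W => X + frame ρ δ X W) :=
    contDiff_const.add (frame ρ δ X).contDiff
  simp only [symNorm_eq_comp (hf.mul hg), symNorm_eq_comp hf, symNorm_eq_comp hg]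
  exact norm_iteratedFDeriv_mul_le (hf.comp hA) (hg.comp hA) 0 (by exact_mod_cast le_top)

theorem SymBd.mul {w v : Phase n → ℝ} {k : ℕ} {C D : ℝ} {f g : Phase n → ℂ}
    (hf : ContDiff ℝ ∞ f) (hg : ContDiff ℝ ∞ g) (h : SymBd ρ δ w k C f) (h' : SymBd ρ δ v k D g) :
    SymBd ρ δ (fun X => w X * v X) k (2 ^ k * (C * D)) (fun X => f X * g X) := by
  intro j hj X
  refine (symNorm_mul_le hf hg j X).trans ?_
  have hC : 0 ≤ C * w X := (norm_nonneg _).trans (h.norm_le X)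
  have hD : 0 ≤ D * v X := (norm_nonneg _).trans (h'.norm_le X)
  calc _ ≤ ∑ i ∈ Finset.range (j + 1), (j.choose i : ℝ) * (C * w X) * (D * v X) := by
        refine Finset.sum_le_sum fun i hi => ?_
        have hi' : i ≤ j := by simpa [Nat.lt_succ_iff] using hi
        gcongr
        · exact symNorm_nonneg _ _ _
        · exact h i (hi'.trans hj) X
        · exact h' (j - i) ((Nat.sub_le _ _).trans hj) X
    _ = 2 ^ j * ((C * w X) * (D * v X)) := by
        simp_rw [mul_assoc]
        rw [← Finset.sum_mul]
        congr 1
        exact_mod_cast Nat.sum_range_choose j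
    _ ≤ 2 ^ k * ((C * w X) * (D * v X)) := by
        gcongr; norm_num
    _ = _ := by ring

/-- The standard basis of the phase space. -/
def pvec : Fin n ⊕ Fin n → Phase n
  | .inl j => (stdVec j, 0)
  | .inr j => (0, stdVec j)

/-- The `g`-length of the basis vectors. -/
def pwt (ρ δ : ℝ) : Fin n ⊕ Fin n → Phase n → ℝ
  | .inl _, X => lam X ^ (δ / 2)
  | .inr _, X => lam X ^ (-ρ / 2)

theorem pwt_pos (i : Fin n ⊕ Fin n) (X : Phase n) : 0 < pwt ρ δ i X := by
  cases i <;> exact lam_rpow_pos _ _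

theorem TW.pwt (hp : Admissible ρ δ) (i : Fin n ⊕ Fin n) : TW ρ δ (pwt (n := n) ρ δ i) := by
  cases i
  · exact TW.lam_rpow hp _
  · exact TW.lam_rpow hp _

theorem norm_stdVec (j : Fin n) : ‖(stdVec j : Euc n)‖ = 1 := by simp [stdVec]

theorem norm_pvec (i : Fin n ⊕ Fin n) : ‖(pvec i : Phase n)‖ = 1 := by
  cases i <;> simp [pvec, norm_stdVec, Prod.norm_def]

theorem coframe_pvec (i : Fin n ⊕ Fin n) (X : Phase n) :
    coframe ρ δ X (pvec i) = pwt ρ δ i X • pvec i := by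
  cases i <;> simp [coframe, pvec, pwt]

theorem norm_coframe_pvec (i : Fin n ⊕ Fin n) (X : Phase n) :
    ‖coframe ρ δ X (pvec i)‖ = pwt ρ δ i X := by
  rw [coframe_pvec, norm_smul, norm_pvec, mul_one, Real.norm_eq_abs, abs_of_pos (pwt_pos i X)]

theorem frame_pvec (i : Fin n ⊕ Fin n) (X : Phase n) :
    frame ρ δ X (pvec i) = (pwt ρ δ i X)⁻¹ • pvec i := by
  rw [eq_inv_smul_iff₀ (pwt_pos i X).ne', ← map_smul, ← coframe_pvec, frame_coframe]

/-- The coordinates on the phase space. -/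
def pcoord : Fin n ⊕ Fin n → Phase n → ℝ
  | .inl j, X => X.1 j
  | .inr j, X => X.2 j

theorem abs_pcoord_le (i : Fin n ⊕ Fin n) (X : Phase n) : |pcoord i X| ≤ ‖X‖ := by
  cases i with
  | inl j => exact (PiLp.norm_apply_le X.1 j).trans (norm_fst_le X)
  | inr j => exact (PiLp.norm_apply_le X.2 j).trans (norm_snd_le X)

theorem euc_sum_stdVec (x : Euc n) : ∑ j, x j • (stdVec j : Euc n) = x := by
  ext i
  simp [stdVec, Pi.single_apply]

theorem sum_pcoord (X : Phase n) : ∑ i, pcoord i X • pvec i = X := by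
  rw [Fintype.sum_sum_type]
  simp only [pcoord, pvec]
  ext1
  · simp [Prod.fst_sum, euc_sum_stdVec]
  · simp [Prod.snd_sum, euc_sum_stdVec]

/-- The derivative of a function in the direction of a basis vector. -/
theorem SymBd.pderiv {w : Phase n → ℝ} {k : ℕ} {C : ℝ} {f : Phase n → ℂ}
    (hf : ContDiff ℝ ∞ f) (h : SymBd ρ δ w (k + 1) C f) (i : Fin n ⊕ Fin n) :
    SymBd ρ δ (fun X => w X * pwt ρ δ i X) k C (fun X => fderiv ℝ f X (pvec i)) := by
  intro j hj X
  have hCw : 0 ≤ C * w X := (norm_nonneg _).trans (h.norm_le X)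
  refine ContinuousMultilinearMap.opNorm_le_bound
    (by rw [← mul_assoc]; exact mul_nonneg hCw (pwt_pos i X).le) fun t => ?_
  have hfd : ContDiff ℝ ∞ (fderiv ℝ f) := hf.fderiv_right (by simp)
  have e1 : (fun X => fderiv ℝ f X (pvec i)) =
      (ContinuousLinearMap.apply ℝ ℂ (pvec i : Phase n)) ∘ fderiv ℝ f := rfl
  rw [e1, ContinuousLinearMap.iteratedFDeriv_comp_left _ hfd.contDiffAt (by exact_mod_cast le_top)]
  -- The fixed direction occupies the last slot, where it contributes its own g-length `pwt` to the
  -- product of norms.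
  have e2 := iteratedFDeriv_succ_apply_right (𝕜 := ℝ) (f := f) (x := X) (n := j)
    (Fin.snoc (fun l => frame ρ δ X (t l)) (pvec i))
  simp only [Fin.init_snoc, Fin.snoc_last] at e2
  change ‖(iteratedFDeriv ℝ j (fderiv ℝ f) X (fun l => frame ρ δ X (t l))) (pvec i)‖ ≤ _
  rw [← e2]
  refine (norm_iteratedFDeriv_apply_le (ρ := ρ) (δ := δ) _ f X _).trans ?_
  rw [Fin.prod_univ_castSucc]
  simp only [Fin.snoc_castSucc, Fin.snoc_last, coframe_frame, norm_coframe_pvec]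
  calc _ ≤ (C * w X) * ((∏ l, ‖t l‖) * pwt ρ δ i X) := by
        gcongr
        · exact mul_nonneg (Finset.prod_nonneg fun _ _ => norm_nonneg _) (pwt_pos i X).le
        · exact h (j + 1) (by omega) X
    _ = _ := by ring

/-- The image of the unit ball under `frame` agrees with the unit ball of g up to the factor √2
between the maximum norm and the Euclidean norm; each of the j slots costs this factor once. -/
theorem mem_symbolClass_iff {w : Phase n → ℝ} (hw : ∀ X, 0 ≤ w X) {a : Phase n → ℂ} :
    a ∈ symbolClass (stdMetric n ρ δ) w ↔ ContDiff ℝ ∞ a ∧ ∀ k, ∃ C, 0 ≤ C ∧ SymBd ρ δ w k C a := by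
  refine and_congr_right fun ha => ⟨fun h k => ?_, fun h k => ?_⟩
  · choose C hC using h
    refine ⟨∑ j ∈ Finset.range (k + 1), |C j| * Real.sqrt 2 ^ j,
      Finset.sum_nonneg fun _ _ => by positivity, fun j hj X => ?_⟩
    have h1 : symNorm ρ δ j a X ≤ |C j| * Real.sqrt 2 ^ j * w X := by
      refine ContinuousMultilinearMap.opNorm_le_bound (mul_nonneg (by positivity) (hw X))
        fun t => ?_
      rw [ContinuousMultilinearMap.compContinuousLinearMap_apply]
      refine (hC j X _).trans ?_
      have : ∏ i, Real.sqrt (stdMetric n ρ δ X (frame ρ δ X (t i))) ≤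
          ∏ i : Fin j, (Real.sqrt 2 * ‖t i‖) := by
        refine Finset.prod_le_prod (fun _ _ => Real.sqrt_nonneg _) fun i _ => ?_
        apply Real.sqrt_le_iff.2 ⟨by positivity, ?_⟩
        rw [mul_pow, Real.sq_sqrt (by norm_num)]
        simpa using stdMetric_le ρ δ X (frame ρ δ X (t i))
      rw [Finset.prod_mul_distrib] at this
      simp only [Finset.prod_const, Finset.card_univ, Fintype.card_fin] at this
      have h0 := hw X
      calc _ ≤ |C j| * ((∏ i, Real.sqrt (stdMetric n ρ δ X (frame ρ δ X (t i)))) * w X) := by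
            refine mul_le_mul_of_nonneg_right (le_abs_self _) ?_
            exact mul_nonneg (Finset.prod_nonneg fun _ _ => Real.sqrt_nonneg _) h0
        _ ≤ |C j| * ((Real.sqrt 2 ^ j * ∏ i, ‖t i‖) * w X) := by gcongr
        _ = _ := by ring
    refine h1.trans ?_
    gcongr
    · exact hw X
    · exact Finset.single_le_sum (f := fun j => |C j| * Real.sqrt 2 ^ j)
        (fun _ _ => by positivity) (by simpa [Nat.lt_succ_iff] using hj)
  · obtain ⟨C, hC0, hC⟩ := h k
    refine ⟨C, fun X t => ?_⟩
    refine (norm_iteratedFDeriv_apply_le (ρ := ρ) (δ := δ) k a X t).trans ?_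
    have h1 : ∏ i, ‖coframe ρ δ X (t i)‖ ≤ ∏ i, Real.sqrt (stdMetric n ρ δ X (t i)) := by
      gcongr with i
      exact Real.le_sqrt_of_sq_le (le_stdMetric ρ δ X (t i))
    have h0 := hw X
    calc _ ≤ C * w X * ∏ i, Real.sqrt (stdMetric n ρ δ X (t i)) := by
          gcongr
          exact hC k le_rfl X
      _ = _ := by ring

end SymbolNorm
-- The Fourier transform on phase space (transported from the ℓ² product, since the product itself
-- carries the maximum norm) and the group `J t`.
section PhaseFourier

variable {n : ℕ}

/-- The phase space with its Euclidean structure. -/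
abbrev PhaseL (n : ℕ) : Type := WithLp 2 (Euc n × Euc n)

/-- The phase space as a Euclidean space. -/
def toPhaseL (n : ℕ) : Phase n ≃L[ℝ] PhaseL n :=
  (WithLp.prodContinuousLinearEquiv 2 ℝ (Euc n) (Euc n)).symm

/-- The duality pairing of the phase space with itself. -/
def ppair (X Y : Phase n) : ℝ := inner ℝ X.1 Y.1 + inner ℝ X.2 Y.2

theorem inner_toPhaseL (X Y : Phase n) : inner ℝ (toPhaseL n X) (toPhaseL n Y) = ppair X Y := by
  simp [toPhaseL, ppair, WithLp.prod_inner_apply]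

theorem ppair_comm (X Y : Phase n) : ppair X Y = ppair Y X := by
  simp [ppair, real_inner_comm]

theorem ppair_temperate (v : Phase n) :
    Function.HasTemperateGrowth (fun X : Phase n => (ppair X v : ℂ)) := by
  have : (fun X : Phase n => (ppair X v : ℂ)) = Complex.ofRealCLM ∘
      ((((innerSL ℝ).flip v.1).comp (ContinuousLinearMap.fst ℝ (Euc n) (Euc n))) +
      (((innerSL ℝ).flip v.2).comp (ContinuousLinearMap.snd ℝ (Euc n) (Euc n))) :
      Phase n →L[ℝ] ℝ) := by
    ext X
    simp [ppair, innerSL_apply_apply ℝ, real_inner_comm X.1 v.1, real_inner_comm X.2 v.2]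
  rw [this]
  exact (Complex.ofRealCLM.hasTemperateGrowth).comp (ContinuousLinearMap.hasTemperateGrowth _)

/-- The Fourier transform on the phase space. -/
def phaseFT (n : ℕ) : 𝓢(Phase n, ℂ) →L[ℂ] 𝓢(Phase n, ℂ) :=
  (compCLMOfContinuousLinearEquiv ℂ (toPhaseL n)).comp
    ((FourierTransform.fourierCLM ℂ 𝓢(PhaseL n, ℂ)).comp
      (compCLMOfContinuousLinearEquiv ℂ (toPhaseL n).symm))

/-- The inverse Fourier transform on the phase space. -/
def phaseIFT (n : ℕ) : 𝓢(Phase n, ℂ) →L[ℂ] 𝓢(Phase n, ℂ) :=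
  (compCLMOfContinuousLinearEquiv ℂ (toPhaseL n)).comp
    ((FourierTransform.fourierInvCLM ℂ 𝓢(PhaseL n, ℂ)).comp
      (compCLMOfContinuousLinearEquiv ℂ (toPhaseL n).symm))

theorem phaseFT_eq (f : 𝓢(Phase n, ℂ)) : phaseFT n f =
    compCLMOfContinuousLinearEquiv ℂ (toPhaseL n)
      (𝓕 (compCLMOfContinuousLinearEquiv ℂ (toPhaseL n).symm f)) := rfl

theorem phaseIFT_eq (f : 𝓢(Phase n, ℂ)) : phaseIFT n f =
    compCLMOfContinuousLinearEquiv ℂ (toPhaseL n)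
      (𝓕⁻ (compCLMOfContinuousLinearEquiv ℂ (toPhaseL n).symm f)) := rfl

theorem comp_toPhaseL_symm (f : 𝓢(PhaseL n, ℂ)) :
    compCLMOfContinuousLinearEquiv ℂ (toPhaseL n).symm
      (compCLMOfContinuousLinearEquiv ℂ (toPhaseL n) f) = f := by
  ext x; simp

theorem comp_symm_toPhaseL (f : 𝓢(Phase n, ℂ)) :
    compCLMOfContinuousLinearEquiv ℂ (toPhaseL n)
      (compCLMOfContinuousLinearEquiv ℂ (toPhaseL n).symm f) = f := by
  ext x; simp

theorem phaseIFT_phaseFT (f : 𝓢(Phase n, ℂ)) : phaseIFT n (phaseFT n f) = f := by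
  rw [phaseIFT_eq, phaseFT_eq, comp_toPhaseL_symm, FourierTransform.fourierInv_fourier_eq,
    comp_symm_toPhaseL]

theorem phaseFT_phaseIFT (f : 𝓢(Phase n, ℂ)) : phaseFT n (phaseIFT n f) = f := by
  rw [phaseIFT_eq, phaseFT_eq, comp_toPhaseL_symm, FourierTransform.fourier_fourierInv_eq,
    comp_symm_toPhaseL]

theorem integral_comp_toPhaseL (f : PhaseL n → ℂ) : ∫ X : Phase n, f (toPhaseL n X) = ∫ Y, f Y := by
  have := (WithLp.volume_preserving_toLp (Euc n) (Euc n)).integral_comp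
    (MeasurableEquiv.toLp 2 (Euc n × Euc n)).measurableEmbedding f
  exact this

/-- The character `e^{2πi⟨X, Ω⟩}`. -/
def pchar (X Ω : Phase n) : ℂ := Complex.exp ((2 * Real.pi * ppair X Ω : ℝ) * Complex.I)

theorem norm_pchar (X Ω : Phase n) : ‖pchar X Ω‖ = 1 := Complex.norm_exp_ofReal_mul_I _

theorem pchar_add (X Y Ω : Phase n) : pchar (X + Y) Ω = pchar X Ω * pchar Y Ω := by
  unfold pchar
  rw [← Complex.exp_add]
  congr 1
  simp only [ppair, Prod.fst_add, Prod.snd_add, inner_add_left]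
  push_cast; ring

theorem continuous_ppair : Continuous (fun p : Phase n × Phase n => ppair p.1 p.2) := by
  unfold ppair; fun_prop

theorem continuous_pchar : Continuous (fun p : Phase n × Phase n => pchar p.1 p.2) := by
  unfold pchar
  have := continuous_ppair (n := n)
  fun_prop

theorem phaseFT_apply (f : 𝓢(Phase n, ℂ)) (Ω : Phase n) :
    phaseFT n f Ω = ∫ Y, pchar (-Y) Ω * f Y := by
  rw [phaseFT_eq]
  simp only [compCLMOfContinuousLinearEquiv_apply, Function.comp_apply, fourier_coe]
  rw [Real.fourier_eq', ← integral_comp_toPhaseL]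
  congr 1 with Y
  rw [inner_toPhaseL]
  simp [pchar, ppair]
  left; ring_nf

theorem phaseIFT_apply (f : 𝓢(Phase n, ℂ)) (X : Phase n) :
    phaseIFT n f X = ∫ Ω, pchar X Ω * f Ω := by
  rw [phaseIFT_eq]
  simp only [compCLMOfContinuousLinearEquiv_apply, Function.comp_apply, fourierInv_coe]
  rw [Real.fourierInv_eq', ← integral_comp_toPhaseL]
  congr 1 with Y
  rw [inner_toPhaseL, ppair_comm]
  simp [pchar]

theorem comp_smulLeft_ppair (f : 𝓢(PhaseL n, ℂ)) (v : Phase n) :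
    compCLMOfContinuousLinearEquiv ℂ (toPhaseL n)
      (smulLeftCLM ℂ (inner ℝ · (toPhaseL n v)) f) =
    smulLeftCLM ℂ (fun X => (ppair X v : ℂ))
      (compCLMOfContinuousLinearEquiv ℂ (toPhaseL n) f) := by
  ext X
  rw [compCLMOfContinuousLinearEquiv_apply, Function.comp_apply,
    smulLeftCLM_apply_apply (by fun_prop), smulLeftCLM_apply_apply (ppair_temperate v),
    inner_toPhaseL]
  simp

theorem comp_symm_smulLeft_ppair (f : 𝓢(Phase n, ℂ)) (v : Phase n) :
    compCLMOfContinuousLinearEquiv ℂ (toPhaseL n).symm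
      (smulLeftCLM ℂ (fun X => (ppair X v : ℂ)) f) =
    smulLeftCLM ℂ (inner ℝ · (toPhaseL n v))
      (compCLMOfContinuousLinearEquiv ℂ (toPhaseL n).symm f) := by
  ext X
  rw [compCLMOfContinuousLinearEquiv_apply, Function.comp_apply,
    smulLeftCLM_apply_apply (ppair_temperate v), smulLeftCLM_apply_apply (by fun_prop),
    ← inner_toPhaseL]
  simp

/-- Multiplication by a linear function. -/
def mulPair (v : Phase n) : 𝓢(Phase n, ℂ) →L[ℂ] 𝓢(Phase n, ℂ) :=
  smulLeftCLM ℂ (fun X => (ppair X v : ℂ))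

@[simp] theorem mulPair_apply (v : Phase n) (f : 𝓢(Phase n, ℂ)) (X : Phase n) :
    mulPair v f X = ppair X v * f X := by
  rw [mulPair, smulLeftCLM_apply_apply (ppair_temperate v), smul_eq_mul]

theorem phaseFT_lineDeriv (f : 𝓢(Phase n, ℂ)) (v : Phase n) :
    phaseFT n (∂_{v} f) = (2 * Real.pi * Complex.I) • mulPair v (phaseFT n f) := by
  have h : compCLMOfContinuousLinearEquiv ℂ (toPhaseL n).symm (∂_{v} f) =
      ∂_{toPhaseL n v} (compCLMOfContinuousLinearEquiv ℂ (toPhaseL n).symm f) := by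
    rw [lineDerivOp_compCLMOfContinuousLinearEquiv]; simp
  rw [phaseFT_eq, h, fourier_lineDerivOp_eq, map_smul, comp_smulLeft_ppair]
  rfl

theorem lineDeriv_phaseFT (f : 𝓢(Phase n, ℂ)) (v : Phase n) :
    ∂_{v} (phaseFT n f) = -(2 * Real.pi * Complex.I) • phaseFT n (mulPair v f) := by
  rw [phaseFT_eq, lineDerivOp_compCLMOfContinuousLinearEquiv, lineDerivOp_fourier_eq,
    ← comp_symm_smulLeft_ppair, FourierTransform.fourier_smul, map_smul]
  rfl

theorem phaseIFT_lineDeriv (f : 𝓢(Phase n, ℂ)) (v : Phase n) :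
    phaseIFT n (∂_{v} f) = -(2 * Real.pi * Complex.I) • mulPair v (phaseIFT n f) := by
  have h : compCLMOfContinuousLinearEquiv ℂ (toPhaseL n).symm (∂_{v} f) =
      ∂_{toPhaseL n v} (compCLMOfContinuousLinearEquiv ℂ (toPhaseL n).symm f) := by
    rw [lineDerivOp_compCLMOfContinuousLinearEquiv]; simp
  rw [phaseIFT_eq, h, fourierInv_lineDerivOp_eq, map_smul, comp_smulLeft_ppair]
  rfl

theorem lineDeriv_phaseIFT (f : 𝓢(Phase n, ℂ)) (v : Phase n) :
    ∂_{v} (phaseIFT n f) = (2 * Real.pi * Complex.I) • phaseIFT n (mulPair v f) := by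
  rw [phaseIFT_eq, lineDerivOp_compCLMOfContinuousLinearEquiv, lineDerivOp_fourierInv_eq,
    ← comp_symm_smulLeft_ppair, FourierTransform.fourierInv_smul, map_smul]
  rfl

theorem hasTemperateGrowth_exp_mul_I :
    Function.HasTemperateGrowth (fun x : ℝ => Complex.exp (x * Complex.I)) := by
  have hder : ∀ k, iteratedDeriv k (fun x : ℝ => Complex.exp (x * Complex.I)) =
      fun x : ℝ => Complex.I ^ k * Complex.exp (x * Complex.I) := by
    intro k
    induction k with
    | zero => simp
    | succ k ih =>
      rw [iteratedDeriv_succ, ih]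
      ext x
      have h1 : HasDerivAt (fun x : ℝ => (x : ℂ) * Complex.I) Complex.I x := by
        simpa using (Complex.ofRealCLM.hasDerivAt (x := x)).mul_const Complex.I
      have := (h1.cexp).const_mul (Complex.I ^ k)
      rw [this.deriv]; ring
  refine ⟨?_, fun k => ⟨0, 1, fun x => ?_⟩⟩
  · have : ContDiff ℝ ∞ (fun x : ℝ => (x : ℂ) * Complex.I) :=
      Complex.ofRealCLM.contDiff.mul contDiff_const
    exact this.cexp
  · rw [norm_iteratedFDeriv_eq_norm_iteratedDeriv, hder]
    simp [Complex.norm_exp_ofReal_mul_I]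

/-- The multiplier `e^{-4π²it⟨p, q⟩}`. -/
def jmult (t : ℝ) (Ω : Phase n) : ℂ :=
  Complex.exp ((-(4 * Real.pi ^ 2 * t * inner ℝ Ω.1 Ω.2) : ℝ) * Complex.I)

theorem norm_jmult (t : ℝ) (Ω : Phase n) : ‖jmult t Ω‖ = 1 := Complex.norm_exp_ofReal_mul_I _

theorem jmult_temperate (t : ℝ) : Function.HasTemperateGrowth (jmult t : Phase n → ℂ) := by
  have h1 : Function.HasTemperateGrowth (fun Ω : Phase n => (inner ℝ Ω.1 Ω.2 : ℝ)) :=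
    (innerSL ℝ (E := Euc n)).bilinear_hasTemperateGrowth (𝕜 := ℝ)
      (ContinuousLinearMap.fst ℝ (Euc n) (Euc n)).hasTemperateGrowth
      (ContinuousLinearMap.snd ℝ (Euc n) (Euc n)).hasTemperateGrowth
  have h2 : Function.HasTemperateGrowth
      (fun Ω : Phase n => (-(4 * Real.pi ^ 2 * t * inner ℝ Ω.1 Ω.2) : ℝ)) := by
    have := (Function.HasTemperateGrowth.const (E := Phase n) (-(4 * Real.pi ^ 2 * t))).mul h1
    have e : (fun Ω : Phase n => (-(4 * Real.pi ^ 2 * t * inner ℝ Ω.1 Ω.2) : ℝ)) =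
        (fun _ => -(4 * Real.pi ^ 2 * t)) * fun Ω => inner ℝ Ω.1 Ω.2 := by
      ext Ω; simp
    rw [e]
    exact this
  exact hasTemperateGrowth_exp_mul_I.comp h2

theorem jmult_mul (s t : ℝ) : (jmult s * jmult t : Phase n → ℂ) = jmult (s + t) := by
  ext Ω
  simp only [Pi.mul_apply, jmult, ← Complex.exp_add]
  congr 1; push_cast; ring

theorem jmult_zero : (jmult 0 : Phase n → ℂ) = fun _ => 1 := by
  ext Ω; simp [jmult]

/-- The operator `e^{it⟨∂_x, ∂_ξ⟩}` on Schwartz functions. -/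
def J (t : ℝ) : 𝓢(Phase n, ℂ) →L[ℂ] 𝓢(Phase n, ℂ) :=
  (phaseIFT n).comp ((smulLeftCLM ℂ (jmult t)).comp (phaseFT n))

theorem J_eq (t : ℝ) (f : 𝓢(Phase n, ℂ)) :
    J t f = phaseIFT n (smulLeftCLM ℂ (jmult t) (phaseFT n f)) := rfl

theorem J_zero (f : 𝓢(Phase n, ℂ)) : J 0 f = f := by
  rw [J_eq, jmult_zero, smulLeftCLM_const]
  simp [phaseIFT_phaseFT]

theorem J_J (s t : ℝ) (f : 𝓢(Phase n, ℂ)) : J s (J t f) = J (s + t) f := by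
  rw [J_eq, J_eq t, phaseFT_phaseIFT, smulLeftCLM_smulLeftCLM_apply (jmult_temperate s)
    (jmult_temperate t), jmult_mul]
  rfl

theorem J_apply (t : ℝ) (f : 𝓢(Phase n, ℂ)) (X : Phase n) :
    J t f X = ∫ Ω, pchar X Ω * (jmult t Ω * phaseFT n f Ω) := by
  rw [J_eq, phaseIFT_apply]
  simp only [smulLeftCLM_apply_apply (jmult_temperate t), smul_eq_mul]

theorem mulPair_smulLeft_jmult (t : ℝ) (v : Phase n) (f : 𝓢(Phase n, ℂ)) :
    mulPair v (smulLeftCLM ℂ (jmult t) f) = smulLeftCLM ℂ (jmult t) (mulPair v f) := by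
  ext X
  simp only [mulPair_apply, smulLeftCLM_apply_apply (jmult_temperate t), smul_eq_mul]
  ring

theorem lineDeriv_J (t : ℝ) (v : Phase n) (f : 𝓢(Phase n, ℂ)) : ∂_{v} (J t f) = J t (∂_{v} f) := by
  rw [J_eq, lineDeriv_phaseIFT, J_eq, phaseFT_lineDeriv, mulPair_smulLeft_jmult, map_smul, map_smul]

theorem hasFDerivAt_jmult (t : ℝ) (v Ω : Phase n) :
    fderiv ℝ (jmult t) Ω v =
      -(4 * Real.pi ^ 2 * t * ppair Ω v.swap : ℝ) * Complex.I * jmult t Ω := by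
  have h1 : HasFDerivAt (fun Ω : Phase n => (inner ℝ Ω.1 Ω.2 : ℝ)) _ Ω :=
    (hasFDerivAt_fst (𝕜 := ℝ) (p := Ω)).inner ℝ (hasFDerivAt_snd (𝕜 := ℝ) (p := Ω))
  have h2 := (Complex.ofRealCLM.hasFDerivAt (x := _)).comp Ω (h1.const_mul (-(4 * Real.pi ^ 2 * t)))
  have h3 := (h2.mul_const Complex.I).cexp
  have h4 : jmult t = fun Ω : Phase n => Complex.exp
      ((Complex.ofRealCLM ∘ fun y : Phase n => -(4 * Real.pi ^ 2 * t) * inner ℝ y.1 y.2) Ω *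
        Complex.I) := by
    ext Ω; simp [jmult]
  rw [← h4] at h3
  rw [h3.fderiv]
  simp [ppair, fderivInnerCLM_apply, jmult, real_inner_comm]
  ring

/-- On the Fourier side multiplication by a linear form is a derivative. When it falls on `jmult` it
brings down the gradient of ⟨p,q⟩, which exchanges the two components; this is the commutator term.
The identity turns bounds for `J t` into decay of `J t f`. -/
theorem mulPair_J (t : ℝ) (v : Phase n) (f : 𝓢(Phase n, ℂ)) :
    mulPair v (J t f) = J t (mulPair v f) - (Complex.I * t) • J t (∂_{v.swap} f) := by
  have hpi : (2 * Real.pi * Complex.I : ℂ) ≠ 0 := by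
    simp [Real.pi_ne_zero]
  have h1 : ∂_{v} (smulLeftCLM ℂ (jmult t) (phaseFT n f)) =
      smulLeftCLM ℂ (jmult t) (∂_{v} (phaseFT n f)) -
        (4 * Real.pi ^ 2 * t * Complex.I) • smulLeftCLM ℂ (jmult t) (mulPair v.swap (phaseFT n f)) := by
    ext X
    rw [lineDerivOp_apply_eq_fderiv, smulLeftCLM_apply (jmult_temperate t)]
    rw [fderiv_fun_smul ((jmult_temperate t).1.differentiable (by simp) X)
      (phaseFT n f).differentiableAt]
    simp only [sub_apply, smul_apply,
      smulLeftCLM_apply_apply (jmult_temperate t), lineDerivOp_apply_eq_fderiv, smul_eq_mul,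
      add_apply,
      ContinuousLinearMap.smulRight_apply, hasFDerivAt_jmult, mulPair_apply]
    push_cast; ring
  have h2 := phaseIFT_lineDeriv (smulLeftCLM ℂ (jmult t) (phaseFT n f)) v
  rw [← J_eq, h1, lineDeriv_phaseFT, map_sub, map_smul, map_smul, map_smul, ← J_eq] at h2
  rw [J_eq t (∂_{v.swap} f), phaseFT_lineDeriv, map_smul, map_smul]
  generalize phaseIFT n (smulLeftCLM ℂ (jmult t) (mulPair v.swap (phaseFT n f))) = g at *
  have h3 : mulPair v (J t f) = (-(2 * Real.pi * Complex.I : ℂ))⁻¹ •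
      (-(2 * Real.pi * Complex.I : ℂ)) • mulPair v (J t f) := by
    rw [inv_smul_smul₀ (neg_ne_zero.2 hpi)]
  rw [h3, ← h2, smul_sub, inv_smul_smul₀ (neg_ne_zero.2 hpi), smul_smul, smul_smul]
  congr 2
  field_simp
  ring_nf
  simp

end PhaseFourier
-- Taylor remainders of `J t`, rapid decay, and behaviour under affine rescaling.
section PhaseFourier

variable {n : ℕ}

instance : (volume : Measure (Phase n)).IsAddHaarMeasure :=
  inferInstanceAs (((volume : Measure (Euc n)).prod (volume : Measure (Euc n))).IsAddHaarMeasure)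

/-- The operator `⟨∂_x, ∂_ξ⟩` on Schwartz functions. -/
def crossLap (n : ℕ) : 𝓢(Phase n, ℂ) →L[ℂ] 𝓢(Phase n, ℂ) :=
  ∑ j : Fin n, (LineDeriv.lineDerivOpCLM ℂ 𝓢(Phase n, ℂ) (pvec (.inl j) : Phase n)).comp
    (LineDeriv.lineDerivOpCLM ℂ 𝓢(Phase n, ℂ) (pvec (.inr j) : Phase n))

theorem crossLap_eq (f : 𝓢(Phase n, ℂ)) :
    crossLap n f = ∑ j : Fin n, ∂_{(pvec (.inl j) : Phase n)} (∂_{(pvec (.inr j) : Phase n)} f) := by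
  simp [crossLap]

theorem lineDeriv_comm (f : 𝓢(Phase n, ℂ)) (u v : Phase n) : ∂_{u} (∂_{v} f) = ∂_{v} (∂_{u} f) := by
  rw [← phaseIFT_phaseFT (∂_{u} (∂_{v} f)), ← phaseIFT_phaseFT (∂_{v} (∂_{u} f))]
  congr 1
  simp only [phaseFT_lineDeriv, map_smul]
  ext X
  simp only [smul_apply, mulPair_apply, smul_eq_mul]
  ring

theorem lineDeriv_crossLap (f : 𝓢(Phase n, ℂ)) (v : Phase n) :
    ∂_{v} (crossLap n f) = crossLap n (∂_{v} f) := by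
  rw [crossLap_eq, crossLap_eq, ← LineDeriv.lineDerivOpCLM_apply (R := ℂ), map_sum]
  refine Finset.sum_congr rfl fun j _ => ?_
  rw [LineDeriv.lineDerivOpCLM_apply, lineDeriv_comm _ v, lineDeriv_comm _ v]

theorem lineDeriv_crossLap_pow (k : ℕ) (f : 𝓢(Phase n, ℂ)) (v : Phase n) :
    ∂_{v} ((crossLap n ^ k) f) = (crossLap n ^ k) (∂_{v} f) := by
  induction k generalizing f with
  | zero => rfl
  | succ k ih =>
    rw [pow_succ, mul_apply_eq_comp, ih, lineDeriv_crossLap, mul_apply_eq_comp]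

theorem ppair_pvec_inl (X : Phase n) (j : Fin n) : ppair X (pvec (.inl j)) = X.1 j := by
  simp [ppair, pvec, stdVec, EuclideanSpace.inner_single_right]

theorem ppair_pvec_inr (X : Phase n) (j : Fin n) : ppair X (pvec (.inr j)) = X.2 j := by
  simp [ppair, pvec, stdVec, EuclideanSpace.inner_single_right]

theorem phaseFT_crossLap (f : 𝓢(Phase n, ℂ)) (Ω : Phase n) :
    phaseFT n (crossLap n f) Ω = (-(4 * Real.pi ^ 2 * inner ℝ Ω.1 Ω.2) : ℝ) * phaseFT n f Ω := by
  rw [crossLap_eq, map_sum, sum_apply]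
  simp only [phaseFT_lineDeriv, map_smul, smul_apply, mulPair_apply, smul_eq_mul, ppair_pvec_inl,
    ppair_pvec_inr, PiLp.inner_apply, RCLike.inner_apply, conj_trivial]
  push_cast
  rw [Finset.mul_sum, ← Finset.sum_neg_distrib, Finset.sum_mul]
  refine Finset.sum_congr rfl fun j _ => ?_
  ring_nf
  simp

/-- Differentiation under the Fourier integral: since `pchar` and `jmult` have modulus one, the
transform of `crossLap n f` dominates the derivative for all times. -/
theorem hasDerivAt_J (f : 𝓢(Phase n, ℂ)) (X : Phase n) (t : ℝ) :
    HasDerivAt (fun s => J s f X) (Complex.I * J t (crossLap n f) X) t := by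
  have hder : ∀ Ω : Phase n, ∀ s : ℝ, HasDerivAt (fun s => pchar X Ω * (jmult s Ω * phaseFT n f Ω))
      (Complex.I * (pchar X Ω * (jmult s Ω * phaseFT n (crossLap n f) Ω))) s := by
    intro Ω s
    have h1 : HasDerivAt (fun s : ℝ => ((-(4 * Real.pi ^ 2 * s * inner ℝ Ω.1 Ω.2) : ℝ) : ℂ) *
        Complex.I) ((-(4 * Real.pi ^ 2 * inner ℝ Ω.1 Ω.2) : ℝ) * Complex.I) s := by
      have := ((Complex.ofRealCLM.hasDerivAt (x := s)).mul_const
        (((-(4 * Real.pi ^ 2 * inner ℝ Ω.1 Ω.2) : ℝ) : ℂ) * Complex.I))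
      simp only [Complex.ofRealCLM_apply, Complex.ofReal_one, one_mul] at this
      convert! this using 1
      ext s; push_cast; ring
    have h2 := ((h1.cexp).mul_const (phaseFT n f Ω)).const_mul (pchar X Ω)
    refine h2.congr_deriv ?_
    rw [phaseFT_crossLap]
    simp only [jmult]
    ring
  simp only [J_apply]
  rw [← integral_const_mul]
  refine (hasDerivAt_integral_of_dominated_loc_of_deriv_le (μ := volume)
    (F := fun s Ω => pchar X Ω * (jmult s Ω * phaseFT n f Ω))
    (F' := fun s Ω => Complex.I * (pchar X Ω * (jmult s Ω * phaseFT n (crossLap n f) Ω)))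
    (bound := fun Ω => ‖phaseFT n (crossLap n f) Ω‖) (s := Set.univ) Filter.univ_mem
    ?_ ?_ ?_ ?_ ?_ ?_).2
  · refine Filter.Eventually.of_forall fun s => Continuous.aestronglyMeasurable ?_
    have := (jmult_temperate (n := n) s).1.continuous
    have := (continuous_pchar (n := n)).comp (Continuous.prodMk_right X)
    exact this.mul ((jmult_temperate (n := n) s).1.continuous.mul (phaseFT n f).continuous)
  · refine (phaseFT n f).integrable.norm.mono' (Continuous.aestronglyMeasurable ?_)
      (Filter.Eventually.of_forall fun Ω => ?_)
    · have := (continuous_pchar (n := n)).comp (Continuous.prodMk_right X)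
      exact this.mul ((jmult_temperate (n := n) t).1.continuous.mul (phaseFT n f).continuous)
    · simp [norm_pchar, norm_jmult]
  · refine Continuous.aestronglyMeasurable ?_
    have := (continuous_pchar (n := n)).comp (Continuous.prodMk_right X)
    exact continuous_const.mul
      (this.mul ((jmult_temperate (n := n) t).1.continuous.mul (phaseFT n _).continuous))
  · refine Filter.Eventually.of_forall fun Ω s _ => ?_
    simp [norm_pchar, norm_jmult]
  · exact (phaseFT n (crossLap n f)).integrable.norm
  · exact Filter.Eventually.of_forall fun Ω s _ => hder Ω s

/-- The Taylor remainder `e^{it⟨∂_x, ∂_ξ⟩} - ∑_{k<N} (it⟨∂_x, ∂_ξ⟩)^k / k!`. -/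
def jrem (N : ℕ) (t : ℝ) : 𝓢(Phase n, ℂ) →L[ℂ] 𝓢(Phase n, ℂ) :=
  J t - ∑ k ∈ Finset.range N, ((Complex.I * t) ^ k / k.factorial) • crossLap n ^ k

theorem jrem_apply (N : ℕ) (t : ℝ) (f : 𝓢(Phase n, ℂ)) (X : Phase n) :
    jrem N t f X = J t f X -
      ∑ k ∈ Finset.range N, ((Complex.I * t) ^ k / k.factorial) * (crossLap n ^ k) f X := by
  simp only [jrem, sub_apply, sum_apply, smul_apply, smul_eq_mul]

theorem lineDeriv_jrem (N : ℕ) (t : ℝ) (v : Phase n) (f : 𝓢(Phase n, ℂ)) :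
    ∂_{v} (jrem N t f) = jrem N t (∂_{v} f) := by
  simp only [jrem, sub_apply, sum_apply, smul_apply, ← lineDeriv_crossLap_pow, ← lineDeriv_J]
  simp only [← LineDeriv.lineDerivOpCLM_apply (R := ℂ), map_sub, map_sum, map_smul]

theorem hasDerivAt_jrem (N : ℕ) (f : 𝓢(Phase n, ℂ)) (X : Phase n) (t : ℝ) :
    HasDerivAt (fun s => jrem (N + 1) s f X) (Complex.I * jrem N t (crossLap n f) X) t := by
  simp only [jrem_apply]
  have hk : ∀ k ∈ Finset.range (N + 1), HasDerivAt
      (fun s : ℝ => ((Complex.I * s) ^ k / k.factorial) * (crossLap n ^ k) f X)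
      ((k * (Complex.I * t) ^ (k - 1) * Complex.I / k.factorial) * (crossLap n ^ k) f X) t := by
    intro k _
    have h1 : HasDerivAt (fun s : ℝ => Complex.I * (s : ℂ)) Complex.I t := by
      simpa using (Complex.ofRealCLM.hasDerivAt (x := t)).const_mul Complex.I
    exact ((h1.pow k).div_const _).mul_const _
  have hs := (hasDerivAt_J f X t).sub (HasDerivAt.fun_sum hk)
  refine hs.congr_deriv ?_
  rw [Finset.sum_range_succ']
  simp only [CharP.cast_eq_zero, zero_mul, zero_div, add_zero, mul_sub, Finset.mul_sum]
  congr 1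
  refine Finset.sum_congr rfl fun k _ => ?_
  rw [pow_succ (crossLap n), mul_apply_eq_comp, Nat.factorial_succ]
  have : ((k : ℂ) + 1) ≠ 0 := by exact_mod_cast Nat.succ_ne_zero k
  have : (k.factorial : ℂ) ≠ 0 := by exact_mod_cast Nat.factorial_ne_zero k
  push_cast
  field_simp

/-- The t-derivative of the remainder of order N+1 is i times the remainder of order N applied to
⟨∂_x,∂_ξ⟩f, and the remainder vanishes at t = 0. The mean value inequality gives the induction step;
the point X stays fixed throughout, so the bound is local in X. -/
theorem norm_jrem_le (N : ℕ) (t : ℝ) (f : 𝓢(Phase n, ℂ)) (X : Phase n) {B : ℝ}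
    (hB : ∀ s : ℝ, |s| ≤ |t| → ‖J s ((crossLap n ^ N) f) X‖ ≤ B) :
    ‖jrem N t f X‖ ≤ |t| ^ N * B := by
  induction N generalizing t f with
  | zero => simpa [jrem] using hB t le_rfl
  | succ N ih =>
    have hB0 : 0 ≤ B := (norm_nonneg _).trans (hB t le_rfl)
    have h0 : jrem (N + 1) 0 f X = 0 := by
      rw [jrem_apply, J_zero, Finset.sum_range_succ']
      simp
    have hder : ∀ s ∈ Set.Icc (-|t|) |t|, ‖Complex.I * jrem N s (crossLap n f) X‖ ≤ |t| ^ N * B := by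
      intro s hs
      have hs' : |s| ≤ |t| := abs_le.2 hs
      rw [norm_mul, Complex.norm_I, one_mul]
      refine (ih s (crossLap n f) fun s' h' => ?_).trans ?_
      · have := hB s' (h'.trans hs')
        rwa [pow_succ, mul_apply_eq_comp] at this
      · gcongr
    have := (convex_Icc (-|t|) |t|).norm_image_sub_le_of_norm_hasDerivWithin_le
      (f := fun s => jrem (N + 1) s f X)
      (fun s _ => (hasDerivAt_jrem N f X s).hasDerivWithinAt) hder
      (x := 0) (y := t) (by simp) (abs_le.1 le_rfl)
    rw [h0, sub_zero, sub_zero, Real.norm_eq_abs] at this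
    calc _ ≤ _ := this
      _ = _ := by ring

/-- The `L¹` norm of the Fourier transform. -/
def ftNorm (n : ℕ) : Seminorm ℂ 𝓢(Phase n, ℂ) :=
  (normSeminorm ℂ (Lp ℂ 1 (volume : Measure (Phase n)))).comp
    ((toLpCLM ℂ ℂ 1 (volume : Measure (Phase n))).comp (phaseFT n)).toLinearMap

theorem ftNorm_apply (f : 𝓢(Phase n, ℂ)) : ftNorm n f = ∫ Ω, ‖phaseFT n f Ω‖ := by
  simp only [ftNorm, Seminorm.comp_apply, coe_normSeminorm]
  exact norm_toLp_one

theorem continuous_ftNorm : Continuous (ftNorm n) := by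
  have := ((toLpCLM ℂ ℂ 1 (volume : Measure (Phase n))).comp (phaseFT n)).continuous
  exact continuous_norm.comp this

theorem norm_J_le (t : ℝ) (f : 𝓢(Phase n, ℂ)) (X : Phase n) : ‖J t f X‖ ≤ ftNorm n f := by
  rw [J_apply, ftNorm_apply]
  refine (norm_integral_le_integral_norm _).trans (le_of_eq ?_)
  simp [norm_pchar, norm_jmult]

theorem norm_le_sum_pcoord (X : Phase n) : ‖X‖ ≤ ∑ i, |pcoord i X| := by
  conv_lhs => rw [← sum_pcoord X]
  refine (norm_sum_le _ _).trans (le_of_eq ?_)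
  simp [norm_smul, norm_pvec]

theorem pcoord_eq_ppair (i : Fin n ⊕ Fin n) (X : Phase n) : pcoord i X = ppair X (pvec i) := by
  cases i
  · exact (ppair_pvec_inl _ _).symm
  · exact (ppair_pvec_inr _ _).symm

/-- Each power of ‖X‖ is bounded by the sum of the coordinates, and `mulPair_J` moves a coordinate
inside `J t` at the price of a derivative with factor t. Boundedness of t keeps the seminorm
uniform. -/
theorem exists_seminorm_J_decay (M : ℕ) (T : NNReal) :
    ∃ p : Seminorm ℂ 𝓢(Phase n, ℂ), Continuous p ∧
      ∀ t : ℝ, |t| ≤ T → ∀ f X, ‖X‖ ^ M * ‖J t f X‖ ≤ p f := by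
  induction M with
  | zero => exact ⟨ftNorm n, continuous_ftNorm, fun t _ f X => by simpa using norm_J_le t f X⟩
  | succ M ih =>
    obtain ⟨p, hp, h⟩ := ih
    refine ⟨∑ i : Fin n ⊕ Fin n, (p.comp (mulPair (pvec i)).toLinearMap +
      T • p.comp (LineDeriv.lineDerivOpCLM ℂ 𝓢(Phase n, ℂ) (pvec i).swap).toLinearMap),
      ?_, fun t ht f X => ?_⟩
    · have : (fun f => (∑ i : Fin n ⊕ Fin n, (p.comp (mulPair (pvec i)).toLinearMap +
        T • p.comp (LineDeriv.lineDerivOpCLM ℂ 𝓢(Phase n, ℂ) (pvec i).swap).toLinearMap)) f) =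
          fun f => ∑ i : Fin n ⊕ Fin n, (p (mulPair (pvec i) f) +
            T * p (LineDeriv.lineDerivOpCLM ℂ 𝓢(Phase n, ℂ) (pvec i : Phase n).swap f)) := by
        ext f
        rw [_root_.sum_apply]
        rfl
      refine (continuous_congr (congrFun this)).2 ?_
      refine continuous_finsetSum _ fun i _ => ?_
      exact (hp.comp (mulPair _).continuous).add (continuous_const.mul
        (hp.comp (LineDeriv.lineDerivOpCLM ℂ 𝓢(Phase n, ℂ) (pvec i : Phase n).swap).continuous))
    · rw [_root_.sum_apply]
      calc ‖X‖ ^ (M + 1) * ‖J t f X‖ = ‖X‖ ^ M * (‖X‖ * ‖J t f X‖) := by ring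
        _ ≤ ‖X‖ ^ M * ((∑ i, |pcoord i X|) * ‖J t f X‖) := by
          gcongr; exact norm_le_sum_pcoord X
        _ = ∑ i, ‖X‖ ^ M * ‖mulPair (pvec i) (J t f) X‖ := by
          rw [Finset.sum_mul, Finset.mul_sum]
          refine Finset.sum_congr rfl fun i _ => ?_
          rw [mulPair_apply, norm_mul, pcoord_eq_ppair, Complex.norm_real, Real.norm_eq_abs]
        _ ≤ _ := by
          refine Finset.sum_le_sum fun i _ => ?_
          rw [mulPair_J, sub_apply, smul_apply, smul_eq_mul]
          have h1 := h t ht (mulPair (pvec i) f) X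
          have h2 := h t ht (∂_{(pvec i).swap} f) X
          calc _ ≤ ‖X‖ ^ M * (‖J t (mulPair (pvec i) f) X‖ +
                ‖Complex.I * t * J t (∂_{(pvec i).swap} f) X‖) := by
                gcongr; exact norm_sub_le _ _
            _ = ‖X‖ ^ M * ‖J t (mulPair (pvec i) f) X‖ +
                |t| * (‖X‖ ^ M * ‖J t (∂_{(pvec i).swap} f) X‖) := by
                rw [norm_mul, norm_mul, Complex.norm_I, Complex.norm_real, Real.norm_eq_abs]; ring
            _ ≤ p (mulPair (pvec i) f) + T * p (∂_{(pvec i).swap} f) := by gcongr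

/-- The dilation as an equivalence. -/
def dilEquiv (n : ℕ) {r s : ℝ} (hr : r ≠ 0) (hs : s ≠ 0) : Phase n ≃L[ℝ] Phase n :=
  ContinuousLinearEquiv.equivOfInverse (dil n r s) (dil n r⁻¹ s⁻¹)
    (fun X => by simp [smul_smul, hr, hs]) (fun X => by simp [smul_smul, hr, hs])

theorem integral_dil (f : Phase n → ℂ) {r s : ℝ} (hr : 0 < r) (hs : 0 < s) :
    ∫ X, f (dil n r s X) = (((r * s) ^ n)⁻¹ : ℝ) * ∫ X, f X := by
  have hdet : LinearMap.det ((dil n r s : Phase n →L[ℝ] Phase n) : Phase n →ₗ[ℝ] Phase n) =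
      (r * s) ^ n := by
    have : ((dil n r s : Phase n →L[ℝ] Phase n) : Phase n →ₗ[ℝ] Phase n) =
        LinearMap.prodMap (r • LinearMap.id) (s • LinearMap.id) := by
      ext X <;> simp
    rw [this, LinearMap.det_prodMap, LinearMap.det_smul, LinearMap.det_smul]
    simp [mul_pow]
  have hmap := Measure.map_linearMap_addHaar_eq_smul_addHaar (μ := (volume : Measure (Phase n)))
    (f := ((dil n r s : Phase n →L[ℝ] Phase n) : Phase n →ₗ[ℝ] Phase n))
    (by rw [hdet]; positivity)
  have he : MeasurableEmbedding (dil n r s) :=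
    (dilEquiv n hr.ne' hs.ne').toHomeomorph.measurableEmbedding
  have := he.integral_map (μ := volume) f
  rw [← this]
  change ∫ y, f y ∂(Measure.map ((dil n r s : Phase n →L[ℝ] Phase n) : Phase n →ₗ[ℝ] Phase n) _) = _
  rw [hmap, integral_smul_measure, hdet, abs_of_pos (by positivity),
    ENNReal.toReal_ofReal (by positivity), Complex.real_smul]

theorem ppair_dil (r s : ℝ) (X Y : Phase n) : ppair (dil n r s X) Y = ppair X (dil n r s Y) := by
  simp [ppair, inner_smul_left, inner_smul_right]

theorem phaseFT_comp_affine {f g : 𝓢(Phase n, ℂ)} {Z : Phase n} {r s : ℝ} (hr : 0 < r) (hs : 0 < s)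
    (h : ∀ W, g W = f (Z + dil n r s W)) (Ω : Phase n) :
    phaseFT n f Ω = ((r * s) ^ n : ℝ) * (pchar (-Z) Ω * phaseFT n g (dil n r s Ω)) := by
  rw [phaseFT_apply, phaseFT_apply, ← integral_add_left_eq_self _ Z]
  have h1 := integral_dil (fun Y => pchar (-(Z + Y)) Ω * f (Z + Y)) hr hs
  have h2 : ((r * s) ^ n : ℝ) ≠ 0 := by positivity
  have h3 : ∀ a b : ℂ, a = (((r * s) ^ n)⁻¹ : ℝ) * b → b = ((r * s) ^ n : ℝ) * a := by
    intro a b e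
    rw [e, ← mul_assoc, ← Complex.ofReal_mul, mul_inv_cancel₀ h2]; simp
  rw [h3 _ _ h1]
  congr 1
  rw [← integral_const_mul]
  refine integral_congr_ae (.of_forall fun W => ?_)
  change pchar (-(Z + dil n r s W)) Ω * f (Z + dil n r s W) = pchar (-Z) Ω *
    (pchar (-W) (dil n r s Ω) * g W)
  rw [h, neg_add, pchar_add, mul_assoc]
  congr 2
  simp only [pchar]
  rw [← map_neg, ppair_dil]

/-- Affine invariance of this norm is the reason for bounding `J` by the L¹ norm of the Fourier
transform: pieces may be estimated in coordinates normalized at their centre. -/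
theorem ftNorm_comp_affine {f g : 𝓢(Phase n, ℂ)} {Z : Phase n} {r s : ℝ} (hr : 0 < r) (hs : 0 < s)
    (h : ∀ W, g W = f (Z + dil n r s W)) : ftNorm n f = ftNorm n g := by
  rw [ftNorm_apply, ftNorm_apply]
  have h1 := integral_dil (fun Ω => ((‖phaseFT n g Ω‖ : ℝ) : ℂ)) hr hs
  rw [integral_complex_ofReal, integral_complex_ofReal] at h1
  have h2 : ((r * s) ^ n : ℝ) ≠ 0 := by positivity
  norm_cast at h1
  simp only [phaseFT_comp_affine hr hs h, norm_mul, norm_pchar, one_mul, Complex.norm_real,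
    Real.norm_eq_abs, abs_of_pos (show 0 < (r * s) ^ n by positivity)]
  rw [integral_const_mul, h1, mul_inv_cancel_left₀ h2]

/-- The operator ⟨∂_x,∂_ξ⟩ is homogeneous of degree one in each of the two scales. For `frame` at Z
the product of the scales is 1/h(Z), so that t turns into t h(Z). -/
theorem J_comp_affine {f g : 𝓢(Phase n, ℂ)} {Z : Phase n} {r s : ℝ} (hr : 0 < r) (hs : 0 < s)
    (h : ∀ W, g W = f (Z + dil n r s W)) (t : ℝ) (X : Phase n) :
    J t f X = J (t / (r * s)) g (dil n r⁻¹ s⁻¹ (X - Z)) := by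
  rw [J_apply, J_apply]
  simp only [phaseFT_comp_affine hr hs h]
  have h1 := integral_dil (fun Ω => pchar X Ω * (jmult t Ω * (((r * s) ^ n : ℝ) *
    (pchar (-Z) Ω * phaseFT n g (dil n r s Ω))))) (inv_pos.2 hr) (inv_pos.2 hs)
  have h2 : ((r * s) ^ n : ℝ) ≠ 0 := by positivity
  have h4 : ((((r⁻¹ * s⁻¹) ^ n)⁻¹ : ℝ) : ℂ) = ((r * s) ^ n : ℝ) := by
    congr 1; rw [← mul_inv, inv_pow, inv_inv]
  rw [h4] at h1
  have h5 : (((r * s) ^ n : ℝ) : ℂ) ≠ 0 := by exact_mod_cast h2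
  apply mul_left_cancel₀ h5
  rw [← h1, ← integral_const_mul]
  congr 1
  ext Ω
  have e1 : dil n r s (dil n r⁻¹ s⁻¹ Ω) = Ω := by simp [smul_smul, hr.ne', hs.ne']
  have e2 : jmult t (dil n r⁻¹ s⁻¹ Ω) = jmult (t / (r * s)) Ω := by
    simp only [jmult, dil_apply, inner_smul_left, inner_smul_right, conj_trivial]
    congr 3
    field_simp
  have e3 : pchar (dil n r⁻¹ s⁻¹ (X - Z)) Ω =
      pchar X (dil n r⁻¹ s⁻¹ Ω) * pchar (-Z) (dil n r⁻¹ s⁻¹ Ω) := by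
    rw [← pchar_add, ← sub_eq_add_neg]
    simp only [pchar, ppair_dil]
  rw [e1, e2, e3]
  ring

end PhaseFourier
-- Uniform bounds for `J s` on functions supported in a ball.
section Seminorms

variable {n : ℕ}

/-- A continuous seminorm is dominated by finitely many Schwartz seminorms, and on the unit ball
their polynomial weights are at most one. The order K is the largest number of derivatives that
occurs. -/
theorem exists_bound_of_support_unitBall (p : Seminorm ℂ 𝓢(Phase n, ℂ)) (hp : Continuous p) :
    ∃ K : ℕ, ∃ C : ℝ, 0 ≤ C ∧ ∀ (F : 𝓢(Phase n, ℂ)) (B : ℝ), (∀ W, 1 < ‖W‖ → F W = 0) →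
      (∀ j ≤ K, ∀ W, ‖iteratedFDeriv ℝ j F W‖ ≤ B) → p F ≤ C * B := by
  obtain ⟨s, C, -, hC⟩ := Seminorm.bound_of_continuous (schwartz_withSeminorms ℂ (Phase n) ℂ) p hp
  refine ⟨s.sup Prod.snd, C, C.2, fun F B hF hB => ?_⟩
  refine (hC F).trans ?_
  have hB0 : 0 ≤ B := (norm_nonneg _).trans (hB 0 (Nat.zero_le _) 0)
  change (C : ℝ) * _ ≤ _
  gcongr
  refine Seminorm.finset_sup_apply_le hB0 fun i hi => ?_
  refine SchwartzMap.seminorm_le_bound ℂ i.1 i.2 F hB0 fun W => ?_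
  have hj : i.2 ≤ s.sup Prod.snd := Finset.le_sup (f := Prod.snd) hi
  rcases le_or_gt ‖W‖ 1 with h | h
  · calc _ ≤ 1 ^ i.1 * B := by gcongr; exact hB _ hj W
      _ = B := by simp
  · have : iteratedFDeriv ℝ i.2 F W = 0 := by
      have he : (F : Phase n → ℂ) =ᶠ[nhds W] fun _ => 0 := by
        filter_upwards [(isOpen_lt continuous_const continuous_norm).mem_nhds h] with V hV
        exact hF V hV
      rw [(he.iteratedFDeriv ℝ _).eq_of_nhds]
      simp
    rw [this]; simpa using hB0

theorem crossLap_pow_eq_zero {F : 𝓢(Phase n, ℂ)} {U : Set (Phase n)} (hU : IsOpen U)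
    (hF : ∀ W ∈ U, F W = 0) (k : ℕ) : ∀ W ∈ U, (crossLap n ^ k) F W = 0 := by
  have hd : ∀ (v : Phase n) (G : 𝓢(Phase n, ℂ)), (∀ W ∈ U, G W = 0) → ∀ W ∈ U, ∂_{v} G W = 0 := by
    intro v G hG W hW
    have he : (G : Phase n → ℂ) =ᶠ[nhds W] fun _ => 0 := by
      filter_upwards [hU.mem_nhds hW] with V hV
      exact hG V hV
    rw [lineDerivOp_apply_eq_fderiv, he.fderiv_eq]
    simp
  induction k generalizing F with
  | zero => exact hF
  | succ k ih =>
    rw [pow_succ, mul_apply_eq_comp]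
    refine ih fun W hW => ?_
    rw [crossLap_eq, sum_apply]
    exact Finset.sum_eq_zero fun j _ => hd _ _ (hd _ _ hF) W hW

/-- Outside the support all Taylor terms vanish, as differential operators are local. There `J s F`
equals its own remainder of order N, which supplies |s|^N, while the decay seminorm of `crossLap ^
N` applied to F supplies ‖W‖^(-N). -/
theorem exists_J_bound (N : ℕ) (T : NNReal) :
    ∃ K : ℕ, ∃ C : ℝ, 0 ≤ C ∧ ∀ (F : 𝓢(Phase n, ℂ)) (B r : ℝ), r ≤ 1 → (∀ W, r < ‖W‖ → F W = 0) →
      (∀ j ≤ K, ∀ W, ‖iteratedFDeriv ℝ j F W‖ ≤ B) → ∀ s : ℝ, |s| ≤ T →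
        ∀ W, ‖J s F W‖ ≤ C * B ∧ (r < ‖W‖ → ‖W‖ ^ N * ‖J s F W‖ ≤ |s| ^ N * (C * B)) := by
  obtain ⟨p, hp, h⟩ := exists_seminorm_J_decay (n := n) N T
  obtain ⟨K₁, C₁, hC₁, h₁⟩ := exists_bound_of_support_unitBall (ftNorm n) continuous_ftNorm
  obtain ⟨K₂, C₂, hC₂, h₂⟩ := exists_bound_of_support_unitBall
    (p.comp (crossLap n ^ N).toLinearMap) (hp.comp (crossLap n ^ N).continuous)
  refine ⟨max K₁ K₂, max C₁ C₂, hC₁.trans (le_max_left _ _), fun F B r hr hF hB s hs W => ?_⟩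
  have hB0 : 0 ≤ B := (norm_nonneg _).trans (hB 0 (Nat.zero_le _) 0)
  have hF' : ∀ W, 1 < ‖W‖ → F W = 0 := fun W hW => hF W (hr.trans_lt hW)
  refine ⟨?_, fun hW => ?_⟩
  · calc ‖J s F W‖ ≤ ftNorm n F := norm_J_le s F W
      _ ≤ C₁ * B := h₁ F B hF' fun j hj => hB j (hj.trans (le_max_left _ _))
      _ ≤ _ := by gcongr; exact le_max_left _ _
  · have e : J s F W = jrem N s F W := by
      rw [jrem_apply, Finset.sum_eq_zero, sub_zero]
      intro k _
      rw [crossLap_pow_eq_zero (isOpen_lt continuous_const continuous_norm) hF k W hW, mul_zero]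
    have h3 : p ((crossLap n ^ N) F) ≤ max C₁ C₂ * B := by
      calc _ ≤ C₂ * B := h₂ F B hF' fun j hj => hB j (hj.trans (le_max_right _ _))
        _ ≤ _ := by gcongr; exact le_max_right _ _
    -- The value ‖W‖ = 0 can occur here only for negative r.
    rcases (norm_nonneg W).eq_or_lt with h0 | h0
    · rcases Nat.eq_zero_or_pos N with hN | hN
      · subst hN
        have := h s hs ((crossLap n ^ 0) F) W
        simp only [pow_zero, one_mul] at this h3 ⊢
        exact this.trans h3
      · rw [← h0, zero_pow hN.ne', zero_mul]
        have : 0 ≤ max C₁ C₂ * B := mul_nonneg (hC₁.trans (le_max_left _ _)) hB0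
        positivity
    · have hk := norm_jrem_le N s F W (B := (‖W‖ ^ N)⁻¹ * (max C₁ C₂ * B)) fun s' hs' => by
        rw [le_inv_mul_iff₀ (by positivity)]
        exact (h s' (hs'.trans hs) _ W).trans h3
      rw [e]
      calc _ ≤ ‖W‖ ^ N * (|s| ^ N * ((‖W‖ ^ N)⁻¹ * (max C₁ C₂ * B))) := by gcongr
        _ = _ := by field_simp

end Seminorms

/-! ### A continuous partition of unity with bounds uniform in its centre. -/

section Localization

variable {n : ℕ} {ρ δ : ℝ}

/-- A smooth bump function with small support and integral one. -/
def bump (n : ℕ) (ε : ℝ) (hε : 0 < ε) : ContDiffBump (0 : Phase n) :=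
  ⟨ε / 2, ε, by positivity, by linarith⟩

/-- The normalized bump function as a complex function. -/
def chi (n : ℕ) (ε : ℝ) (hε : 0 < ε) (W : Phase n) : ℂ := ((bump n ε hε).normed volume W : ℝ)

theorem contDiff_chi (ε : ℝ) (hε : 0 < ε) : ContDiff ℝ ∞ (chi n ε hε) :=
  Complex.ofRealCLM.contDiff.comp (bump n ε hε).contDiff_normed

theorem chi_eq_zero {ε : ℝ} (hε : 0 < ε) {W : Phase n} (hW : ε ≤ ‖W‖) : chi n ε hε W = 0 := by
  have : W ∉ Function.support ((bump n ε hε).normed volume) := by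
    rw [(bump n ε hε).support_normed_eq]
    simpa [bump] using hW
  rw [chi, Function.notMem_support.1 this]; simp

theorem norm_chi {ε : ℝ} (hε : 0 < ε) (W : Phase n) :
    ‖chi n ε hε W‖ = (bump n ε hε).normed volume W := by
  rw [chi, Complex.norm_real, Real.norm_eq_abs, abs_of_nonneg ((bump n ε hε).nonneg_normed W)]

theorem integral_chi {ε : ℝ} (hε : 0 < ε) : ∫ W, chi n ε hε W = 1 := by
  unfold chi
  rw [integral_complex_ofReal, (bump n ε hε).integral_normed]; simp

/-- A continuous partition of unity adapted to the metric. -/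
def phi (ρ δ ε : ℝ) (hε : 0 < ε) (Z Y : Phase n) : ℂ :=
  (planck ρ δ Y ^ n : ℝ) * chi n ε hε (coframe ρ δ Y (Z - Y))

theorem integral_coframe (f : Phase n → ℂ) (Y : Phase n) :
    (planck ρ δ Y ^ n : ℝ) * ∫ Z, f (coframe ρ δ Y Z) = ∫ W, f W := by
  have h1 := integral_dil f (lam_rpow_pos Y (δ / 2)) (lam_rpow_pos Y (-ρ / 2))
  have h2 : lam Y ^ (δ / 2) * lam Y ^ (-ρ / 2) = planck ρ δ Y := by
    rw [lam_rpow_mul, planck]; congr 1; ring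
  rw [h2] at h1
  have h3 : (planck ρ δ Y ^ n : ℝ) ≠ 0 := (pow_pos (planck_pos ρ δ Y) n).ne'
  rw [coframe, h1, ← mul_assoc, ← Complex.ofReal_mul, mul_inv_cancel₀ h3]
  simp

/-- The frame in `phi` is taken at Y and not at Z, so that integration over Z is a linear change of
variables. Its Jacobian is compensated by the factor h(Y)^n, and the integral is exactly one. -/
theorem integral_phi {ε : ℝ} (hε : 0 < ε) (Y : Phase n) : ∫ Z, phi ρ δ ε hε Z Y = 1 := by
  unfold phi
  rw [integral_const_mul, integral_sub_right_eq_self (fun Z => chi n ε hε (coframe ρ δ Y Z)) Y,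
    integral_coframe, integral_chi]

/-- The quotient `lam (Z + frame Z W) / lam Z` as a polynomial in `W` with bounded coefficients. -/
def lamRatio (q : (Phase n × ℝ × ℝ) × Phase n) : ℝ :=
  1 + 2 * inner ℝ q.1.1.1 q.2.1 + 2 * inner ℝ q.1.1.2 q.2.2 + q.1.2.1 * ‖q.2.1‖ ^ 2 +
    q.1.2.2 * ‖q.2.2‖ ^ 2

/-- The coefficients of `lamRatio` belonging to `Z`. -/
def lamCoef (ρ δ : ℝ) (Z : Phase n) : Phase n × ℝ × ℝ :=
  ((lam Z ^ (-1 - δ / 2) • Z.1, lam Z ^ (ρ / 2 - 1) • Z.2), lam Z ^ (-1 - δ), lam Z ^ (ρ - 1))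

/-- All dependence on Z is pushed into coefficients from a compact set (`norm_lamCoef_le`).
Uniformity in Z of the bounds for derivatives of the partition can then be obtained from
compactness. -/
theorem lam_add_frame (Z W : Phase n) :
    lam (Z + frame ρ δ Z W) = lam Z * lamRatio (lamCoef ρ δ Z, W) := by
  have e1 : lam Z ^ (-1 - δ / 2) = (lam Z)⁻¹ * lam Z ^ (-δ / 2) := by
    rw [← Real.rpow_neg_one, lam_rpow_mul]; ring_nf
  have e2 : lam Z ^ (ρ / 2 - 1) = (lam Z)⁻¹ * lam Z ^ (ρ / 2) := by
    rw [← Real.rpow_neg_one, lam_rpow_mul]; ring_nf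
  have e3 : lam Z ^ (-1 - δ) = (lam Z)⁻¹ * (lam Z ^ (-δ / 2)) ^ 2 := by
    rw [← Real.rpow_neg_one, lam_rpow_pow, lam_rpow_mul]; push_cast; ring_nf
  have e4 : lam Z ^ (ρ - 1) = (lam Z)⁻¹ * (lam Z ^ (ρ / 2)) ^ 2 := by
    rw [← Real.rpow_neg_one, lam_rpow_pow, lam_rpow_mul]; push_cast; ring_nf
  have hl := (lam_pos Z).ne'
  have a1 := norm_add_sq_real Z.1 (lam Z ^ (-δ / 2) • W.1)
  have a2 := norm_add_sq_real Z.2 (lam Z ^ (ρ / 2) • W.2)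
  rw [inner_smul_right, norm_smul, Real.norm_eq_abs, mul_pow, sq_abs] at a1 a2
  have e0 : lam (Z + frame ρ δ Z W) = 1 + ‖Z.1 + lam Z ^ (-δ / 2) • W.1‖ ^ 2 +
      ‖Z.2 + lam Z ^ (ρ / 2) • W.2‖ ^ 2 := rfl
  rw [e0, a1, a2]
  simp only [lamRatio, lamCoef, e1, e2, e3, e4, inner_smul_left, conj_trivial]
  generalize lam Z ^ (-δ / 2) = r
  generalize lam Z ^ (ρ / 2) = s
  field_simp
  unfold lam
  ring

/-- Since ‖Z‖ ≤ λ^(1/2), every entry is at most a power of λ with exponent ≤ 0; this uses δ ≥ 0 and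
ρ ≤ 1. -/
theorem norm_lamCoef_le (hp : Admissible ρ δ) (Z : Phase n) : ‖lamCoef ρ δ Z‖ ≤ 1 := by
  have h0 := hp.nonneg
  have h1 := hp.le_one
  have hz : ‖Z‖ ≤ lam Z ^ (1 / 2 : ℝ) := by
    rw [← Real.sqrt_eq_rpow]
    exact Real.le_sqrt_of_sq_le (norm_sq_le_lam Z)
  have h1z := (norm_fst_le Z).trans hz
  have h2z := (norm_snd_le Z).trans hz
  simp only [lamCoef, Prod.norm_def, norm_smul, Real.norm_eq_abs, abs_of_pos (lam_rpow_pos Z _)]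
  refine max_le (max_le ?_ ?_) (max_le ?_ ?_)
  · calc _ ≤ lam Z ^ (-1 - δ / 2) * lam Z ^ (1 / 2 : ℝ) := by
          gcongr; exact (lam_rpow_pos Z _).le
      _ ≤ 1 := by rw [lam_rpow_mul]; exact lam_rpow_le_one Z (by linarith)
  · calc _ ≤ lam Z ^ (ρ / 2 - 1) * lam Z ^ (1 / 2 : ℝ) := by
          gcongr; exact (lam_rpow_pos Z _).le
      _ ≤ 1 := by rw [lam_rpow_mul]; exact lam_rpow_le_one Z (by linarith)
  · exact lam_rpow_le_one Z (by linarith)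
  · exact lam_rpow_le_one Z (by linarith)

/-- The four perturbing terms are at most 2/10, 2/10, 1/100 and 1/100 in modulus. Positivity makes
the real powers in `psiAux` smooth on this compact set of parameters. -/
theorem lamRatio_pos {q : (Phase n × ℝ × ℝ) × Phase n} (h1 : ‖q.1‖ ≤ 1) (h2 : ‖q.2‖ ≤ 1 / 10) :
    0 < lamRatio q := by
  obtain ⟨⟨⟨α, β⟩, s, r⟩, w, η⟩ := q
  simp only [Prod.norm_def, max_le_iff, Real.norm_eq_abs] at h1 h2
  obtain ⟨⟨ha, hb⟩, hs, hr⟩ := h1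
  obtain ⟨hw, hη⟩ := h2
  have b1 : |inner ℝ α w| ≤ 1 * (1 / 10) := (abs_real_inner_le_norm α w).trans (by gcongr)
  have b2 : |inner ℝ β η| ≤ 1 * (1 / 10) := (abs_real_inner_le_norm β η).trans (by gcongr)
  have b3 : |s * ‖w‖ ^ 2| ≤ 1 * (1 / 10) ^ 2 := by
    rw [abs_mul, abs_of_nonneg (sq_nonneg ‖w‖)]; gcongr
  have b4 : |r * ‖η‖ ^ 2| ≤ 1 * (1 / 10) ^ 2 := by
    rw [abs_mul, abs_of_nonneg (sq_nonneg ‖η‖)]; gcongr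
  simp only [lamRatio]
  linarith [(abs_le.1 b1).1, (abs_le.1 b2).1, (abs_le.1 b3).1, (abs_le.1 b4).1]

theorem contDiff_lamRatio : ContDiff ℝ ∞ (lamRatio : (Phase n × ℝ × ℝ) × Phase n → ℝ) := by
  unfold lamRatio
  have h11 : ContDiff ℝ ∞ fun q : (Phase n × ℝ × ℝ) × Phase n => q.1.1.1 := by fun_prop
  have h12 : ContDiff ℝ ∞ fun q : (Phase n × ℝ × ℝ) × Phase n => q.1.1.2 := by fun_prop
  have h21 : ContDiff ℝ ∞ fun q : (Phase n × ℝ × ℝ) × Phase n => q.2.1 := by fun_prop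
  have h22 : ContDiff ℝ ∞ fun q : (Phase n × ℝ × ℝ) × Phase n => q.2.2 := by fun_prop
  have h3 : ContDiff ℝ ∞ fun q : (Phase n × ℝ × ℝ) × Phase n => q.1.2.1 := by fun_prop
  have h4 : ContDiff ℝ ∞ fun q : (Phase n × ℝ × ℝ) × Phase n => q.1.2.2 := by fun_prop
  exact (((contDiff_const.add (contDiff_const.mul (h11.inner ℝ h21))).add
    (contDiff_const.mul (h12.inner ℝ h22))).add (h3.mul (h21.norm_sq ℝ))).add
    (h4.mul (h22.norm_sq ℝ))

/-- The partition function `phi` in normalized coordinates. -/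
def psiAux (ρ δ ε : ℝ) (hε : 0 < ε) (q : (Phase n × ℝ × ℝ) × Phase n) : ℂ :=
  ((lamRatio q ^ ((δ - ρ) / 2 * n) : ℝ) : ℂ) *
    chi n ε hε (lamRatio q ^ (δ / 2) • (-q.2.1), lamRatio q ^ (-ρ / 2) • (-q.2.2))

theorem contDiffAt_psiAux {ε : ℝ} (hε : 0 < ε) {q : (Phase n × ℝ × ℝ) × Phase n}
    (hq : 0 < lamRatio q) : ContDiffAt ℝ ∞ (psiAux ρ δ ε hε) q := by
  have h : ∀ s : ℝ, ContDiffAt ℝ ∞ (fun q => lamRatio (n := n) q ^ s) q := fun s =>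
    contDiff_lamRatio.contDiffAt.rpow_const_of_ne hq.ne'
  refine (Complex.ofRealCLM.contDiff.contDiffAt.comp q (h _)).mul
    ((contDiff_chi ε hε).contDiffAt.comp q (ContDiffAt.prodMk ?_ ?_))
  · exact (h _).smul (by fun_prop)
  · exact (h _).smul (by fun_prop)

/-- The partition function `phi` around `Z` in normalized coordinates. -/
def psi (ρ δ ε : ℝ) (hε : 0 < ε) (Z W : Phase n) : ℂ := psiAux ρ δ ε hε (lamCoef ρ δ Z, W)

/-- For coefficients that come from a point Z the polynomial is a quotient of two values of `lam`,
hence positive without any restriction on W. -/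
theorem lamRatio_lamCoef_pos (Z W : Phase n) : 0 < lamRatio (lamCoef ρ δ Z, W) := by
  have h := lam_add_frame (ρ := ρ) (δ := δ) Z W
  have h1 := lam_pos (Z + frame ρ δ Z W)
  rw [h] at h1
  exact pos_of_mul_pos_right h1 (lam_pos Z).le

theorem contDiff_psi {ε : ℝ} (hε : 0 < ε) (Z : Phase n) : ContDiff ℝ ∞ (psi ρ δ ε hε Z) := by
  rw [contDiff_iff_contDiffAt]
  intro W
  exact (contDiffAt_psiAux hε (lamRatio_lamCoef_pos Z W)).comp W
    (contDiffAt_const.prodMk contDiffAt_id)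

theorem planck_add_frame (Z W : Phase n) : planck ρ δ (Z + frame ρ δ Z W) =
    planck ρ δ Z * lamRatio (lamCoef ρ δ Z, W) ^ ((δ - ρ) / 2) := by
  rw [planck, lam_add_frame, Real.mul_rpow (lam_pos Z).le (lamRatio_lamCoef_pos Z W).le, planck]

theorem coframe_add_frame (Z W V : Phase n) : coframe ρ δ (Z + frame ρ δ Z W) (frame ρ δ Z V) =
    (lamRatio (lamCoef ρ δ Z, W) ^ (δ / 2) • V.1, lamRatio (lamCoef ρ δ Z, W) ^ (-ρ / 2) • V.2) := by
  have hq := lamRatio_lamCoef_pos (ρ := ρ) (δ := δ) Z W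
  change (lam (Z + frame ρ δ Z W) ^ (δ / 2) • lam Z ^ (-δ / 2) • V.1,
    lam (Z + frame ρ δ Z W) ^ (-ρ / 2) • lam Z ^ (ρ / 2) • V.2) = _
  rw [lam_add_frame]
  rw [Real.mul_rpow (lam_pos Z).le hq.le, Real.mul_rpow (lam_pos Z).le hq.le, smul_smul, smul_smul]
  congr 2
  · rw [mul_right_comm, lam_rpow_mul]; ring_nf; simp
  · rw [mul_right_comm, lam_rpow_mul]; ring_nf; simp

theorem phi_add_frame {ε : ℝ} (hε : 0 < ε) (Z W : Phase n) :
    phi ρ δ ε hε Z (Z + frame ρ δ Z W) = (planck ρ δ Z ^ n : ℝ) * psi ρ δ ε hε Z W := by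
  have hq := lamRatio_lamCoef_pos (ρ := ρ) (δ := δ) Z W
  have e : Z - (Z + frame ρ δ Z W) = frame ρ δ Z (-W) := by simp
  rw [phi, e, coframe_add_frame, planck_add_frame, psi, psiAux, mul_pow, Complex.ofReal_mul,
    mul_assoc]
  congr 3
  rw [Real.rpow_mul hq.le, Real.rpow_natCast]

theorem norm_coframe_le_of_comparable (hp : Admissible ρ δ) {X Y : Phase n}
    (h1 : lam X ≤ 2 * lam Y) (h2 : lam Y ≤ 2 * lam X) (V : Phase n) :
    ‖coframe ρ δ X V‖ ≤ 2 * ‖coframe ρ δ Y V‖ := by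
  have h0 := hp.nonneg
  have h3 := hp.le_one
  have h4 := hp.lt
  have key : ∀ s : ℝ, |s| ≤ 1 → lam X ^ s ≤ 2 * lam Y ^ s := fun s hs => by
    refine (rpow_le_of_comparable (lam_pos X) (lam_pos Y) one_le_two h1 h2 s).trans ?_
    gcongr
    · exact (lam_rpow_pos Y s).le
    · calc (2 : ℝ) ^ |s| ≤ 2 ^ (1 : ℝ) := Real.rpow_le_rpow_of_exponent_le one_le_two hs
        _ = 2 := Real.rpow_one 2
  have k1 := key (δ / 2) (by rw [abs_of_nonneg (by linarith)]; linarith)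
  have k2 := key (-ρ / 2) (by rw [abs_of_nonpos (by linarith)]; linarith)
  simp only [coframe, dil_apply, Prod.norm_def, norm_smul, Real.norm_eq_abs,
    abs_of_pos (lam_rpow_pos _ _)]
  refine max_le ?_ ?_
  · calc _ ≤ 2 * lam Y ^ (δ / 2) * ‖V.1‖ := by gcongr
      _ = 2 * (lam Y ^ (δ / 2) * ‖V.1‖) := by ring
      _ ≤ _ := by gcongr; exact le_max_left _ _
  · calc _ ≤ 2 * lam Y ^ (-ρ / 2) * ‖V.2‖ := by gcongr
      _ = 2 * (lam Y ^ (-ρ / 2) * ‖V.2‖) := by ring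
      _ ≤ _ := by gcongr; exact le_max_right _ _

/-- The bump function is cut off in the frame at Y = Z + frame W, whereas W is measured in the frame
at Z. Slow variation compares the two frames, which doubles the radius. -/
theorem psi_eq_zero (hp : Admissible ρ δ) {ε : ℝ} (hε : 0 < ε) (hε1 : ε ≤ 1 / 100) {Z W : Phase n}
    (hW : 2 * ε < ‖W‖) : psi ρ δ ε hε Z W = 0 := by
  set Y := Z + frame ρ δ Z W with hY
  have e : Z - Y = frame ρ δ Z (-W) := by simp [hY]
  have h : ε ≤ ‖coframe ρ δ Y (Z - Y)‖ := by
    by_contra! hc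
    have hs := lam_slow hp (hc.le.trans hε1)
    have := norm_coframe_le_of_comparable hp hs.1 hs.2 (Z - Y)
    rw [e, coframe_frame, norm_neg, ← e] at this
    linarith
  have h0 : phi ρ δ ε hε Z Y = 0 := by rw [phi, chi_eq_zero hε h, mul_zero]
  rw [phi_add_frame] at h0
  refine (mul_eq_zero.1 h0).resolve_left ?_
  exact_mod_cast (pow_pos (planck_pos ρ δ Z) n).ne'

/-- Joint regularity in the coefficients and in W of the derivatives taken in W alone; the
compactness argument needs continuity in both. -/
theorem contDiffAt_iteratedFDeriv_psiAux {ε : ℝ} (hε : 0 < ε) (k : ℕ)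
    {q : (Phase n × ℝ × ℝ) × Phase n} (hq : 0 < lamRatio q) :
    ContDiffAt ℝ ∞ (fun q : (Phase n × ℝ × ℝ) × Phase n =>
      iteratedFDeriv ℝ k (fun W => psiAux ρ δ ε hε (q.1, W)) q.2) q := by
  induction k generalizing q with
  | zero =>
    have := contDiffAt_psiAux (ρ := ρ) (δ := δ) hε hq
    exact (continuousMultilinearCurryFin0 ℝ (Phase n) ℂ).symm.contDiff.contDiffAt.comp q this
  | succ k ih =>
    have h1 : ContDiffAt ℝ ∞ (fun q : (Phase n × ℝ × ℝ) × Phase n =>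
        fderiv ℝ (fun V => iteratedFDeriv ℝ k (fun W => psiAux ρ δ ε hε (q.1, W)) V) q.2) q := by
      refine ContDiffAt.fderiv (n := ∞) (f := fun (q : (Phase n × ℝ × ℝ) × Phase n) V =>
        iteratedFDeriv ℝ k (fun W => psiAux ρ δ ε hε (q.1, W)) V) (g := fun q => q.2) ?_
        contDiffAt_snd (by simp)
      exact (ih hq).comp (q, q.2) (f := fun z : ((Phase n × ℝ × ℝ) × Phase n) × Phase n =>
        (z.1.1, z.2)) (by fun_prop)
    have h2 := (continuousMultilinearCurryLeftEquiv ℝ (fun _ : Fin (k + 1) => Phase n)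
      ℂ).symm.contDiff (n := ∞) |>.contDiffAt.comp q h1
    exact h2

/-- For ‖W‖ ≤ 1/10 the pair (`lamCoef` of Z, W) lies in a compact set on which the derivatives are
jointly continuous; for larger W the function vanishes near W. -/
theorem exists_psi_bound (hp : Admissible ρ δ) {ε : ℝ} (hε : 0 < ε) (hε1 : ε ≤ 1 / 100) (k : ℕ) :
    ∃ C : ℝ, 0 ≤ C ∧ ∀ j ≤ k, ∀ Z W : Phase n, ‖iteratedFDeriv ℝ j (psi ρ δ ε hε Z) W‖ ≤ C := by
  have h1 : ∀ j, ∃ C : ℝ, ∀ Z W : Phase n, ‖iteratedFDeriv ℝ j (psi ρ δ ε hε Z) W‖ ≤ C := by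
    intro j
    have hK : IsCompact (Metric.closedBall (0 : Phase n × ℝ × ℝ) 1 ×ˢ
        Metric.closedBall (0 : Phase n) (1 / 10)) :=
      (isCompact_closedBall _ _).prod (isCompact_closedBall _ _)
    obtain ⟨C, hC⟩ := hK.exists_bound_of_continuousOn
      (f := fun q => iteratedFDeriv ℝ j (fun W => psiAux ρ δ ε hε (q.1, W)) q.2) fun q hq => by
        refine (contDiffAt_iteratedFDeriv_psiAux hε j ?_).continuousAt.continuousWithinAt
        exact lamRatio_pos (by simpa using hq.1) (by simpa using hq.2)
    refine ⟨max C 0, fun Z W => ?_⟩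
    rcases le_or_gt ‖W‖ (1 / 10) with h | h
    · refine le_trans ?_ (le_max_left _ _)
      exact hC (lamCoef ρ δ Z, W) ⟨by simpa using norm_lamCoef_le hp Z, by simpa using h⟩
    · refine le_trans (le_of_eq ?_) (le_max_right _ _)
      have he : psi ρ δ ε hε Z =ᶠ[nhds W] fun _ => 0 := by
        filter_upwards [(isOpen_lt continuous_const continuous_norm).mem_nhds h] with V hV
        exact psi_eq_zero hp hε hε1 (lt_of_le_of_lt (by linarith) hV)
      rw [(he.iteratedFDeriv ℝ _).eq_of_nhds]
      simp
  choose C hC using h1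
  refine ⟨∑ j ∈ Finset.range (k + 1), |C j|, Finset.sum_nonneg fun _ _ => abs_nonneg _,
    fun j hj Z W => (hC j Z W).trans ((le_abs_self _).trans ?_)⟩
  exact Finset.single_le_sum (f := fun j => |C j|) (fun _ _ => abs_nonneg _)
    (by simpa [Nat.lt_succ_iff] using hj)

theorem hasCompactSupport_psi_mul (hp : Admissible ρ δ) {ε : ℝ} (hε : 0 < ε) (hε1 : ε ≤ 1 / 100)
    (Z : Phase n) (f : Phase n → ℂ) : HasCompactSupport (fun W =>
      (planck ρ δ Z ^ n : ℝ) * psi ρ δ ε hε Z W * f (Z + frame ρ δ Z W)) := by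
  refine HasCompactSupport.of_support_subset_isCompact (isCompact_closedBall (0 : Phase n) (2 * ε))
    fun W hW => ?_
  by_contra h
  apply hW
  beta_reduce
  rw [psi_eq_zero hp hε hε1 (by simpa using h)]
  simp

/-- The localization of `f` at `Z` in normalized coordinates. -/
def localPiece (hp : Admissible ρ δ) {ε : ℝ} (hε : 0 < ε) (hε1 : ε ≤ 1 / 100) (f : 𝓢(Phase n, ℂ))
    (Z : Phase n) : 𝓢(Phase n, ℂ) :=
  (hasCompactSupport_psi_mul hp hε hε1 Z f).toSchwartzMap
    ((contDiff_const.mul (contDiff_psi hε Z)).mul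
      (f.smooth'.comp (contDiff_const.add (frame ρ δ Z).contDiff)))

theorem localPiece_apply (hp : Admissible ρ δ) {ε : ℝ} (hε : 0 < ε) (hε1 : ε ≤ 1 / 100)
    (f : 𝓢(Phase n, ℂ)) (Z W : Phase n) : localPiece hp hε hε1 f Z W =
      (planck ρ δ Z ^ n : ℝ) * psi ρ δ ε hε Z W * f (Z + frame ρ δ Z W) := rfl

theorem localPiece_eq_zero (hp : Admissible ρ δ) {ε : ℝ} (hε : 0 < ε) (hε1 : ε ≤ 1 / 100)
    (f : 𝓢(Phase n, ℂ)) {Z W : Phase n} (hW : 2 * ε < ‖W‖) : localPiece hp hε hε1 f Z W = 0 := by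
  rw [localPiece_apply, psi_eq_zero hp hε hε1 hW]; simp

theorem norm_iteratedFDeriv_comp_frame_le (hp : Admissible ρ δ) (f : 𝓢(Phase n, ℂ))
    {Z W : Phase n} (hW : ‖W‖ ≤ 1 / 100) (j : ℕ) :
    ‖iteratedFDeriv ℝ j (fun V => f (Z + frame ρ δ Z V)) W‖ ≤
      2 ^ j * symNorm ρ δ j f (Z + frame ρ δ Z W) := by
  have h1 : ContDiff ℝ ∞ (fun Y => f (Z + Y)) := f.smooth'.comp (contDiff_const.add contDiff_id)
  have := (frame ρ δ Z).iteratedFDeriv_comp_right (f := fun Y => f (Z + Y)) h1 W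
    (i := j) (by exact_mod_cast le_top)
  rw [Function.comp_def] at this
  rw [this, iteratedFDeriv_comp_add_left]
  refine ContinuousMultilinearMap.opNorm_le_bound
    (mul_nonneg (by positivity) (symNorm_nonneg _ _ _)) fun t => ?_
  rw [ContinuousMultilinearMap.compContinuousLinearMap_apply]
  refine (norm_iteratedFDeriv_apply_le (ρ := ρ) (δ := δ) j f _ _).trans ?_
  have hs := lam_slow hp (X := Z) (Y := Z + frame ρ δ Z W) (by simpa using hW)
  have h2 : ∏ i, ‖coframe ρ δ (Z + frame ρ δ Z W) (frame ρ δ Z (t i))‖ ≤ ∏ i, (2 * ‖t i‖) := by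
    gcongr with i
    simpa using norm_coframe_le_of_comparable hp hs.1 hs.2 (frame ρ δ Z (t i))
  rw [Finset.prod_mul_distrib] at h2
  simp only [Finset.prod_const, Finset.card_univ, Fintype.card_fin] at h2
  calc _ ≤ _ := mul_le_mul_of_nonneg_left h2 (symNorm_nonneg _ _ _)
    _ = _ := by ring

/-- By the Leibniz rule: the partition has uniformly bounded derivatives, changing from the frame at
the nearby point to the frame at Z costs 2 per derivative of f, and hypothesis `hw` moves the weight
to Z. -/
theorem exists_localPiece_bound (hp : Admissible ρ δ) {ε : ℝ} (hε : 0 < ε) (hε1 : ε ≤ 1 / 200)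
    {w : Phase n → ℝ} {D : ℝ} (hw0 : ∀ X, 0 ≤ w X) (hD : 0 ≤ D)
    (hw : ∀ X Y : Phase n, ‖coframe ρ δ X (Y - X)‖ ≤ 2 * ε → w Y ≤ D * w X) (k : ℕ) :
    ∃ C' : ℝ, 0 ≤ C' ∧ ∀ (f : 𝓢(Phase n, ℂ)) (C : ℝ), 0 ≤ C → SymBd ρ δ w k C f → ∀ Z, ∀ j ≤ k, ∀ W,
      ‖iteratedFDeriv ℝ j (localPiece hp hε (hε1.trans (by norm_num)) f Z) W‖ ≤
        C' * (C * (planck ρ δ Z ^ n * w Z)) := by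
  obtain ⟨A, hA, hpsi⟩ := exists_psi_bound (n := n) hp hε (hε1.trans (by norm_num)) k
  refine ⟨2 ^ k * (A * (2 ^ k * D)), by positivity, fun f C hC hf Z j hj W => ?_⟩
  have hq := (pow_pos (planck_pos ρ δ Z) n).le
  have hw0Z := hw0 Z
  rcases le_or_gt ‖W‖ (2 * ε) with h | h
  · have e : (localPiece hp hε (hε1.trans (by norm_num)) f Z : Phase n → ℂ) = fun W =>
        ((planck ρ δ Z ^ n : ℝ) : ℂ) • (psi ρ δ ε hε Z W * f (Z + frame ρ δ Z W)) := by
      ext W; rw [localPiece_apply, smul_eq_mul, mul_assoc]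
    have hs2 : ContDiff ℝ ∞ (fun W => f (Z + frame ρ δ Z W)) :=
      f.smooth'.comp (contDiff_const.add (frame ρ δ Z).contDiff)
    have hs := (contDiff_psi (ρ := ρ) (δ := δ) hε Z).mul hs2
    rw [e, iteratedFDeriv_const_smul_apply' (hs.contDiffAt.of_le (by exact_mod_cast le_top)),
      norm_smul, Complex.norm_real, Real.norm_eq_abs, abs_of_nonneg hq]
    have h2 := norm_iteratedFDeriv_mul_le (𝕜 := ℝ) (contDiff_psi (ρ := ρ) (δ := δ) hε Z) hs2 W
      (n := j) (by exact_mod_cast le_top)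
    have hwY : w (Z + frame ρ δ Z W) ≤ D * w Z := hw Z _ (by simpa using h)
    have h3 : ∀ i ∈ Finset.range (j + 1), (j.choose i : ℝ) *
        ‖iteratedFDeriv ℝ i (psi ρ δ ε hε Z) W‖ *
        ‖iteratedFDeriv ℝ (j - i) (fun W => f (Z + frame ρ δ Z W)) W‖ ≤
        (j.choose i : ℝ) * (A * (2 ^ k * (C * (D * w Z)))) := by
      intro i hi
      have hi' : i ≤ j := by simpa [Nat.lt_succ_iff] using hi
      rw [mul_assoc]
      gcongr
      · exact hpsi i (hi'.trans hj) Z W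
      · refine (norm_iteratedFDeriv_comp_frame_le hp f (h.trans (by linarith)) (j - i)).trans ?_
        have : symNorm ρ δ (j - i) f (Z + frame ρ δ Z W) ≤ C * (D * w Z) :=
          (hf (j - i) ((Nat.sub_le _ _).trans hj) _).trans (by gcongr)
        gcongr
        · exact symNorm_nonneg _ _ _
        · norm_num
        · omega
    calc _ ≤ planck ρ δ Z ^ n * ∑ i ∈ Finset.range (j + 1),
          (j.choose i : ℝ) * (A * (2 ^ k * (C * (D * w Z)))) := by
          gcongr; exact h2.trans (Finset.sum_le_sum h3)
      _ = planck ρ δ Z ^ n * (2 ^ j * (A * (2 ^ k * (C * (D * w Z))))) := by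
          rw [← Finset.sum_mul]
          congr 2
          exact_mod_cast Nat.sum_range_choose j
      _ ≤ planck ρ δ Z ^ n * (2 ^ k * (A * (2 ^ k * (C * (D * w Z))))) := by
          gcongr; norm_num
      _ = _ := by ring
  · have he : (localPiece hp hε (hε1.trans (by norm_num)) f Z : Phase n → ℂ) =ᶠ[nhds W]
        fun _ => 0 := by
      filter_upwards [(isOpen_lt continuous_const continuous_norm).mem_nhds h] with V hV
      exact localPiece_eq_zero hp hε _ f hV
    rw [(he.iteratedFDeriv ℝ _).eq_of_nhds]
    simp only [iteratedFDeriv_fun_zero, Pi.zero_apply, norm_zero]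
    positivity

end Localization
-- Recovering `J t f` as an integral over the localized pieces.
section Superposition

variable {n : ℕ} {ρ δ : ℝ}

theorem one_add_norm_sq_le_lam (X : Phase n) : (1 + ‖X‖) ^ 2 ≤ 4 * lam X := by
  have h1 := norm_sq_le_lam X
  have h2 := one_le_lam X
  nlinarith [sq_nonneg (1 - ‖X‖)]

theorem finrank_phase : Module.finrank ℝ (Phase n) = 2 * n := by
  rw [Module.finrank_prod, finrank_euclideanSpace_fin]; ring

theorem integrable_one_add_norm_inv :
    Integrable (fun X : Phase n => ((1 + ‖X‖) ^ (2 * n + 2))⁻¹) := by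
  have h := integrable_one_add_norm (E := Phase n) (μ := volume) (r := (2 * n + 2 : ℕ))
    (by rw [finrank_phase]; push_cast; linarith)
  refine h.congr (.of_forall fun X => ?_)
  beta_reduce
  rw [Real.rpow_neg (by positivity), Real.rpow_natCast]

theorem continuous_lam_rpow (s : ℝ) : Continuous (fun X : Phase n => lam X ^ s) :=
  contDiff_lam.continuous.rpow_const fun X => .inl (lam_pos X).ne'

theorem integrable_lam_rpow : Integrable (fun X : Phase n => lam X ^ (-(n + 1 : ℝ))) := by
  refine (integrable_one_add_norm_inv.const_mul (4 ^ (n + 1))).mono'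
    (continuous_lam_rpow _).aestronglyMeasurable (.of_forall fun X => ?_)
  have h : (1 + ‖X‖) ^ (2 * n + 2) ≤ 4 ^ (n + 1) * lam X ^ (n + 1) := by
    rw [← mul_pow, show 2 * n + 2 = 2 * (n + 1) by ring, pow_mul]
    gcongr; exact one_add_norm_sq_le_lam X
  have hl := lam_pos X
  rw [Real.norm_of_nonneg (lam_rpow_pos X _).le, Real.rpow_neg hl.le,
    show (n + 1 : ℝ) = ((n + 1 : ℕ) : ℝ) by push_cast; rfl, Real.rpow_natCast]
  rw [← div_eq_mul_inv, le_div_iff₀ (by positivity), inv_mul_le_iff₀ (by positivity)]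
  linarith

/-- A Schwartz function lies in the symbol class of every negative power of `lam`. This is used only
qualitatively, to make the integrals over Z absolutely convergent. -/
theorem exists_symBd_schwartz (hp : Admissible ρ δ) (f : 𝓢(Phase n, ℂ)) (k D : ℕ) :
    ∃ C : ℝ, 0 ≤ C ∧ SymBd ρ δ (fun X => lam X ^ (-(D : ℝ))) k C f := by
  set S := (Finset.Iic (2 * D + k, k)).sup (fun m => SchwartzMap.seminorm ℝ m.1 m.2) f
  have hS : 0 ≤ S := apply_nonneg _ _
  refine ⟨2 ^ (D + k) * (2 ^ (2 * D + k) * S), by positivity, fun j hj X => ?_⟩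
  refine (symNorm_le hp j f X).trans ?_
  have h1 := SchwartzMap.one_add_le_sup_seminorm_apply (𝕜 := ℝ) (m := (2 * D + k, k)) le_rfl hj f X
  have hl := lam_pos X
  have h2 : lam X ^ (1 / 2 : ℝ) ≤ 2 * (1 + ‖X‖) := by
    rw [← Real.sqrt_eq_rpow]
    refine Real.sqrt_le_iff.2 ⟨by positivity, (lam_le_sq X).trans ?_⟩
    nlinarith [norm_nonneg X]
  have h3 : (lam X ^ (1 / 2 : ℝ)) ^ j ≤ 2 ^ k * (1 + ‖X‖) ^ k := by
    rw [← mul_pow]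
    refine (pow_le_pow_left₀ (lam_rpow_pos X _).le h2 j).trans ?_
    exact pow_le_pow_right₀ (by linarith [norm_nonneg X]) hj
  have h4 : lam X ^ D ≤ 2 ^ D * (1 + ‖X‖) ^ (2 * D) := by
    rw [pow_mul, ← mul_pow]
    exact pow_le_pow_left₀ hl.le (lam_le_sq X) D
  beta_reduce
  rw [Real.rpow_neg hl.le, Real.rpow_natCast, ← div_eq_mul_inv, le_div_iff₀ (by positivity)]
  calc (lam X ^ (1 / 2 : ℝ)) ^ j * ‖iteratedFDeriv ℝ j f X‖ * lam X ^ D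
      ≤ (2 ^ k * (1 + ‖X‖) ^ k) * ‖iteratedFDeriv ℝ j f X‖ * (2 ^ D * (1 + ‖X‖) ^ (2 * D)) := by gcongr
    _ = 2 ^ (D + k) * ((1 + ‖X‖) ^ (2 * D + k) * ‖iteratedFDeriv ℝ j f X‖) := by ring
    _ ≤ _ := by gcongr

theorem frame_scale (Z : Phase n) :
    lam Z ^ (-δ / 2) * lam Z ^ (ρ / 2) = (planck ρ δ Z)⁻¹ := by
  rw [lam_rpow_mul, planck, ← Real.rpow_neg (lam_pos Z).le]; ring_nf

theorem coframe_eq_inv (Z : Phase n) :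
    coframe ρ δ Z = dil n (lam Z ^ (-δ / 2))⁻¹ (lam Z ^ (ρ / 2))⁻¹ := by
  rw [coframe, ← Real.rpow_neg (lam_pos Z).le, ← Real.rpow_neg (lam_pos Z).le]; ring_nf

/-- The product of `f` with a partition function. -/
def phiPiece (hp : Admissible ρ δ) {ε : ℝ} (hε : 0 < ε) (hε1 : ε ≤ 1 / 100) (f : 𝓢(Phase n, ℂ))
    (Z : Phase n) : 𝓢(Phase n, ℂ) :=
  compSubConstCLM ℂ Z (compCLMOfContinuousLinearEquiv ℂ
    (dilEquiv n (lam_rpow_pos Z (-δ / 2)).ne' (lam_rpow_pos Z (ρ / 2)).ne').symm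
    (localPiece hp hε hε1 f Z))

variable (hp : Admissible ρ δ) {ε : ℝ} (hε : 0 < ε) (hε1 : ε ≤ 1 / 100)

theorem phiPiece_eq_localPiece (f : 𝓢(Phase n, ℂ)) (Z Y : Phase n) :
    phiPiece hp hε hε1 f Z Y = localPiece hp hε hε1 f Z (coframe ρ δ Z (Y - Z)) := by
  rw [coframe_eq_inv]; rfl

theorem localPiece_eq_phiPiece (f : 𝓢(Phase n, ℂ)) (Z W : Phase n) :
    localPiece hp hε hε1 f Z W = phiPiece hp hε hε1 f Z (Z + frame ρ δ Z W) := by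
  rw [phiPiece_eq_localPiece]; simp

theorem phiPiece_apply (f : 𝓢(Phase n, ℂ)) (Z Y : Phase n) :
    phiPiece hp hε hε1 f Z Y = phi ρ δ ε hε Z Y * f Y := by
  have e : Z + frame ρ δ Z (coframe ρ δ Z (Y - Z)) = Y := by simp
  rw [phiPiece_eq_localPiece, localPiece_apply, ← phi_add_frame, e]

theorem ftNorm_phiPiece (f : 𝓢(Phase n, ℂ)) (Z : Phase n) :
    ftNorm n (phiPiece hp hε hε1 f Z) = ftNorm n (localPiece hp hε hε1 f Z) :=
  ftNorm_comp_affine (lam_rpow_pos Z _) (lam_rpow_pos Z _)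
    fun W => localPiece_eq_phiPiece hp hε hε1 f Z W

theorem J_phiPiece (f : 𝓢(Phase n, ℂ)) (t : ℝ) (Z X : Phase n) :
    J t (phiPiece hp hε hε1 f Z) X =
      J (t * planck ρ δ Z) (localPiece hp hε hε1 f Z) (coframe ρ δ Z (X - Z)) := by
  rw [J_comp_affine (lam_rpow_pos Z _) (lam_rpow_pos Z _)
    (fun W => localPiece_eq_phiPiece hp hε hε1 f Z W) t X, frame_scale, coframe_eq_inv,
    div_inv_eq_mul]

theorem continuous_planck : Continuous (fun X : Phase n => planck ρ δ X) := continuous_lam_rpow _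

theorem continuous_phi : Continuous (fun q : Phase n × Phase n => phi ρ δ ε hε q.1 q.2) := by
  unfold phi
  refine (Complex.continuous_ofReal.comp ((continuous_planck.comp continuous_snd).pow n)).mul
    ((contDiff_chi ε hε).continuous.comp ?_)
  simp only [coframe, dil_apply]
  refine Continuous.prodMk ?_ ?_
  · exact ((continuous_lam_rpow _).comp continuous_snd).smul (by fun_prop)
  · exact ((continuous_lam_rpow _).comp continuous_snd).smul (by fun_prop)

/-- The Bochner integral of a non-integrable function is zero by convention, so the value one
already implies integrability. -/
theorem integrable_of_integral_phi (Y : Phase n) : Integrable (fun Z => phi ρ δ ε hε Z Y) :=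
  .of_integral_ne_zero (by rw [integral_phi]; exact one_ne_zero)

theorem integral_norm_phi (Y : Phase n) : ∫ Z, ‖phi ρ δ ε hε Z Y‖ = 1 := by
  have h : ∀ Z, ((‖phi ρ δ ε hε Z Y‖ : ℝ) : ℂ) = phi ρ δ ε hε Z Y := fun Z => by
    rw [phi, norm_mul, norm_chi, Complex.norm_real, Real.norm_of_nonneg
      (pow_pos (planck_pos ρ δ Y) n).le, Complex.ofReal_mul]
    rfl
  have := (integral_congr_ae (.of_forall h)).trans (integral_phi (ρ := ρ) (δ := δ) hε Y)
  rw [integral_complex_ofReal] at this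
  exact_mod_cast this

theorem integral_phaseFT_phiPiece (f : 𝓢(Phase n, ℂ)) (Ω : Phase n) :
    ∫ Z, phaseFT n (phiPiece hp hε hε1 f Z) Ω = phaseFT n f Ω := by
  simp_rw [phaseFT_apply, phiPiece_apply]
  have hc : Continuous (fun q : Phase n × Phase n =>
      pchar (-q.2) Ω * (phi ρ δ ε hε q.1 q.2 * f q.2)) :=
    (continuous_pchar.comp (continuous_snd.neg.prodMk continuous_const)).mul
      ((continuous_phi hε).mul (f.continuous.comp continuous_snd))
  rw [integral_integral_swap]
  · refine integral_congr_ae (.of_forall fun Y => ?_)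
    beta_reduce
    rw [integral_const_mul, integral_mul_const, integral_phi, one_mul]
  · refine (integrable_prod_iff' hc.aestronglyMeasurable).2 ⟨.of_forall fun Y => ?_, ?_⟩
    · exact ((integrable_of_integral_phi (ρ := ρ) (δ := δ) hε Y).mul_const (f Y)).const_mul
        (pchar (-Y) Ω)
    · refine f.integrable.norm.congr (.of_forall fun Y => ?_)
      simp only [norm_mul, norm_pchar, one_mul]
      rw [integral_mul_const, integral_norm_phi, one_mul]

/-- The constant depends on f in an uncontrolled way; only integrability in Z is wanted, and it
holds since 2(n+1) exceeds the dimension 2n. -/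
theorem exists_ftNorm_localPiece_le (hε2 : ε ≤ 1 / 200) (f : 𝓢(Phase n, ℂ)) :
    ∃ C : ℝ, ∀ Z, ftNorm n (localPiece hp hε hε1 f Z) ≤ C * lam Z ^ (-(n + 1 : ℝ)) := by
  obtain ⟨K, C₁, hC₁, h₁⟩ := exists_bound_of_support_unitBall (ftNorm n) continuous_ftNorm
  obtain ⟨C, hC, hf⟩ := exists_symBd_schwartz hp f K (n + 1)
  have ht := TW.lam_rpow (n := n) hp (-((n + 1 : ℕ) : ℝ))
  obtain ⟨C', hC', h'⟩ := exists_localPiece_bound (n := n) hp hε hε2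
    (w := fun X => lam X ^ (-((n + 1 : ℕ) : ℝ))) (D := 2 ^ |(-((n + 1 : ℕ) : ℝ))|)
    (fun X => (lam_rpow_pos X _).le) (by positivity) (fun X Y h => by
      have := lam_slow hp (h.trans (by linarith))
      exact rpow_le_of_comparable (lam_pos Y) (lam_pos X) one_le_two this.1 this.2 _) K
  refine ⟨C₁ * (C' * C), fun Z => ?_⟩
  refine (h₁ (localPiece hp hε hε1 f Z) _ (fun W hW => localPiece_eq_zero hp hε hε1 f
    (by linarith)) (fun j hj W => h' f C hC hf Z j hj W)).trans ?_
  have h1 : planck ρ δ Z ^ n ≤ 1 := pow_le_one₀ (planck_pos ρ δ Z).le (planck_le_one hp Z)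
  have h2 := (lam_rpow_pos Z (-((n + 1 : ℕ) : ℝ))).le
  calc _ ≤ C₁ * (C' * (C * (1 * lam Z ^ (-((n + 1 : ℕ) : ℝ))))) := by gcongr
    _ = _ := by push_cast; ring

theorem stronglyMeasurable_phaseFT_phiPiece (f : 𝓢(Phase n, ℂ)) :
    StronglyMeasurable (fun q : Phase n × Phase n =>
      phaseFT n (phiPiece hp hε hε1 f q.1) q.2) := by
  have e : (fun q : Phase n × Phase n => phaseFT n (phiPiece hp hε hε1 f q.1) q.2) =
      fun q => ∫ Y, pchar (-Y) q.2 * (phi ρ δ ε hε q.1 Y * f Y) := by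
    ext q
    rw [phaseFT_apply]
    exact integral_congr_ae (.of_forall fun Y => by beta_reduce; rw [phiPiece_apply])
  have hc : Continuous (fun q : (Phase n × Phase n) × Phase n =>
      pchar (-q.2) q.1.2 * (phi ρ δ ε hε q.1.1 q.2 * f q.2)) := by
    have h1 : Continuous (fun q : (Phase n × Phase n) × Phase n => (-q.2, q.1.2)) := by fun_prop
    have h2 : Continuous (fun q : (Phase n × Phase n) × Phase n => (q.1.1, q.2)) := by fun_prop
    have h3 : Continuous (fun q : (Phase n × Phase n) × Phase n => f q.2) :=
      f.continuous.comp continuous_snd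
    exact (continuous_pchar.comp h1).mul (((continuous_phi (ρ := ρ) (δ := δ) hε).comp h2).mul h3)
  rw [e]
  exact StronglyMeasurable.integral_prod_right' (f := fun q : (Phase n × Phase n) × Phase n =>
      pchar (-q.2) q.1.2 * (phi ρ δ ε hε q.1.1 q.2 * f q.2)) hc.stronglyMeasurable

theorem integrable_prod_of_norm_le {F : Phase n × Phase n → ℂ} (Φ : Phase n → 𝓢(Phase n, ℂ))
    (hF : AEStronglyMeasurable F (volume.prod volume)) (h : ∀ Z Ω, ‖F (Z, Ω)‖ = ‖Φ Z Ω‖)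
    (hF1 : ∀ Z, Continuous fun Ω => F (Z, Ω)) {b : Phase n → ℝ} (hb : Integrable b)
    (hΦ : ∀ Z, ∫ Ω, ‖Φ Z Ω‖ ≤ b Z) : Integrable F (volume.prod volume) := by
  refine (integrable_prod_iff hF).2 ⟨.of_forall fun Z => ?_, ?_⟩
  · exact (Φ Z).integrable.norm.mono' (hF1 Z).aestronglyMeasurable (.of_forall fun Ω => (h Z Ω).le)
  · refine hb.mono' hF.norm.integral_prod_right' (.of_forall fun Z => ?_)
    rw [Real.norm_of_nonneg (integral_nonneg fun _ => norm_nonneg _)]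
    simpa only [h] using hΦ Z

theorem continuous_pchar_right (X : Phase n) : Continuous (fun Ω : Phase n => pchar X Ω) := by
  have : Continuous (fun Ω : Phase n => ppair X Ω) := by unfold ppair; fun_prop
  unfold pchar
  fun_prop

theorem integrable_J_integrand (hε2 : ε ≤ 1 / 200) (f : 𝓢(Phase n, ℂ)) (t : ℝ) (X : Phase n) :
    Integrable (fun q : Phase n × Phase n =>
      pchar X q.2 * (jmult t q.2 * phaseFT n (phiPiece hp hε hε1 f q.1) q.2))
      (volume.prod volume) := by
  have hm := stronglyMeasurable_phaseFT_phiPiece hp hε hε1 f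
  have hc1 := continuous_pchar_right X
  have hj1 : Continuous (fun Ω : Phase n => jmult t Ω) := (jmult_temperate t).1.continuous
  have hmeas : AEStronglyMeasurable (fun q : Phase n × Phase n =>
      pchar X q.2 * (jmult t q.2 * phaseFT n (phiPiece hp hε hε1 f q.1) q.2))
      (volume.prod volume) :=
    ((hc1.comp continuous_snd).stronglyMeasurable.mul
      ((hj1.comp continuous_snd).stronglyMeasurable.mul hm)).aestronglyMeasurable
  obtain ⟨C, hC⟩ := exists_ftNorm_localPiece_le hp hε hε1 hε2 f
  refine integrable_prod_of_norm_le (fun Z => phaseFT n (phiPiece hp hε hε1 f Z)) hmeas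
    (fun Z Ω => ?_) (fun Z => ?_) (integrable_lam_rpow.const_mul C) (fun Z => ?_)
  · rw [norm_mul, norm_mul, norm_pchar, norm_jmult, one_mul, one_mul]
  · exact hc1.mul (hj1.mul (phaseFT n (phiPiece hp hε hε1 f Z)).continuous)
  · rw [← ftNorm_apply, ftNorm_phiPiece]
    exact hC Z

/-- Fubini's theorem in (Z,Ω): the transforms of the pieces integrate in Z to the transform of f. -/
theorem J_eq_integral_phiPiece (hε2 : ε ≤ 1 / 200) (f : 𝓢(Phase n, ℂ)) (t : ℝ) (X : Phase n) :
    J t f X = ∫ Z, J t (phiPiece hp hε hε1 f Z) X := by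
  have h1 := integral_integral_swap (f := fun Z Ω : Phase n =>
    pchar X Ω * (jmult t Ω * phaseFT n (phiPiece hp hε hε1 f Z) Ω))
    (integrable_J_integrand hp hε hε1 hε2 f t X)
  have h2 : ∀ Ω, ∫ Z, pchar X Ω * (jmult t Ω * phaseFT n (phiPiece hp hε hε1 f Z) Ω) =
      pchar X Ω * (jmult t Ω * phaseFT n f Ω) := fun Ω => by
    rw [integral_const_mul, integral_const_mul, integral_phaseFT_phiPiece]
  rw [integral_congr_ae (.of_forall h2)] at h1
  rw [J_apply, ← h1]
  exact integral_congr_ae (.of_forall fun Z => (J_apply _ _ _).symm)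

end Superposition
-- The pointwise bound for `J t` on symbols.
section Estimate

variable {n : ℕ} {ρ δ : ℝ}

/-- The two coefficients of g^σ are powers of `lam`, hence themselves temperate. So the distance
measured at X is bounded by a power of the distance measured at Z. -/
theorem exists_one_add_dualG_le (hp : Admissible ρ δ) : ∃ C > 0, ∃ K : ℕ, ∀ X Z : Phase n,
    1 + dualG ρ δ X (X - Z) ≤ C * (1 + dualG ρ δ Z (X - Z)) ^ K := by
  obtain ⟨C₁, hC₁, K₁, h₁⟩ := (TW.lam_rpow (n := n) hp ρ).temperate
  obtain ⟨C₂, hC₂, K₂, h₂⟩ := (TW.lam_rpow (n := n) hp (-δ)).temperate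
  refine ⟨1 + C₁ + C₂, by positivity, K₁ + K₂ + 1, fun X Z => ?_⟩
  specialize h₁ X Z
  specialize h₂ X Z
  have hG := dualG_nonneg ρ δ Z (X - Z)
  set G := dualG ρ δ Z (X - Z) with hGdef
  have hl1 := (lam_rpow_pos Z ρ).le
  have hl2 := (lam_rpow_pos Z (-δ)).le
  have p1 : (1 + G) ^ K₁ ≤ (1 + G) ^ (K₁ + K₂) := pow_le_pow_right₀ (by linarith) (by omega)
  have p2 : (1 + G) ^ K₂ ≤ (1 + G) ^ (K₁ + K₂) := pow_le_pow_right₀ (by linarith) (by omega)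
  have p3 : 1 ≤ (1 + G) ^ (K₁ + K₂) := one_le_pow₀ (by linarith)
  set P := (1 + G) ^ (K₁ + K₂)
  have e1 : dualG ρ δ X (X - Z) ≤ (C₁ + C₂) * P * G := by
    rw [hGdef]
    unfold dualG
    set a := ‖(X - Z).1‖ ^ 2
    set b := ‖(X - Z).2‖ ^ 2
    have ha : 0 ≤ a := by positivity
    have hb : 0 ≤ b := by positivity
    have q1 : lam X ^ ρ ≤ C₁ * lam Z ^ ρ * P := h₁.trans (by gcongr)
    have q2 : lam X ^ (-δ) ≤ C₂ * lam Z ^ (-δ) * P := h₂.trans (by gcongr)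
    calc lam X ^ ρ * a + lam X ^ (-δ) * b
        ≤ C₁ * lam Z ^ ρ * P * a + C₂ * lam Z ^ (-δ) * P * b := by gcongr
      _ ≤ (C₁ * lam Z ^ ρ * P * a + C₂ * lam Z ^ (-δ) * P * b) +
          (C₂ * lam Z ^ ρ * P * a + C₁ * lam Z ^ (-δ) * P * b) :=
          le_add_of_nonneg_right (by positivity)
      _ = _ := by ring
  rw [pow_succ]
  calc 1 + dualG ρ δ X (X - Z) ≤ P * (1 + G) + (C₁ + C₂) * P * (1 + G) := by
        refine add_le_add (one_le_mul_of_one_le_of_one_le p3 (by linarith)) (e1.trans ?_)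
        gcongr; linarith
    _ = _ := by ring

/-- Moving the weight from Z to X, and creating a factor that is integrable in Z, costs only powers
of 1 + g^σ_Z(X-Z). This is the quantity that the decay off the support controls. -/
theorem TW.exists_mul_coframe_le (hp : Admissible ρ δ) {v : Phase n → ℝ} (hv : TW ρ δ v) (D : ℕ) :
    ∃ C > 0, ∃ K : ℕ, ∀ X Z : Phase n,
      v Z * (1 + ‖coframe ρ δ X (X - Z)‖) ^ D ≤ C * v X * (1 + dualG ρ δ Z (X - Z)) ^ K := by
  obtain ⟨C₁, hC₁, K₁, h₁⟩ := exists_one_add_dualG_le (n := n) hp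
  obtain ⟨C₂, hC₂, K₂, h₂⟩ := hv.temperate
  refine ⟨C₂ * 2 ^ D * C₁ ^ (K₂ + D), by positivity, K₁ * (K₂ + D), fun X Z => ?_⟩
  specialize h₂ Z X
  specialize h₁ X Z
  rw [← neg_sub, dualG_neg] at h₂
  have hvX := hv.pos X
  have hH := dualG_nonneg ρ δ X (X - Z)
  set H := dualG ρ δ X (X - Z)
  have hc : 1 + ‖coframe ρ δ X (X - Z)‖ ≤ 2 * (1 + H) := by
    have h3 := le_dualG ρ δ X (X - Z)
    have h4 : ‖coframe ρ δ X (X - Z)‖ ≤ ‖coframe ρ δ X (X - Z)‖ / planck ρ δ X :=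
      le_div_self (norm_nonneg _) (planck_pos ρ δ X) (planck_le_one hp X)
    nlinarith [sq_nonneg (‖coframe ρ δ X (X - Z)‖ / planck ρ δ X - 1)]
  calc _ ≤ C₂ * v X * (1 + H) ^ K₂ * (2 * (1 + H)) ^ D := by gcongr
    _ = C₂ * 2 ^ D * v X * (1 + H) ^ (K₂ + D) := by rw [mul_pow]; ring
    _ ≤ C₂ * 2 ^ D * v X * (C₁ * (1 + dualG ρ δ Z (X - Z)) ^ K₁) ^ (K₂ + D) := by gcongr
    _ = _ := by rw [mul_pow, ← pow_mul]; ring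

/-- Away from the support the constant 1 is dominated by (‖W‖/h)², since ‖W‖ > 2ε and h ≤ 1. Decay
in ‖W‖/h is therefore decay in 1 + g^σ_Z. -/
theorem one_add_dualG_le_of_far (hp : Admissible ρ δ) {ε : ℝ} (hε : 0 < ε) {X Z : Phase n}
    (h : 2 * ε < ‖coframe ρ δ Z (X - Z)‖) : 1 + dualG ρ δ Z (X - Z) ≤
      (1 / (2 * ε) ^ 2 + 2) * (‖coframe ρ δ Z (X - Z)‖ / planck ρ δ Z) ^ 2 := by
  have h1 := planck_sq_mul_dualG_le ρ δ Z (X - Z)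
  have h2 : 2 * ε ≤ ‖coframe ρ δ Z (X - Z)‖ / planck ρ δ Z :=
    h.le.trans (le_div_self (norm_nonneg _) (planck_pos ρ δ Z) (planck_le_one hp Z))
  have h3 : 1 ≤ 1 / (2 * ε) ^ 2 * (‖coframe ρ δ Z (X - Z)‖ / planck ρ δ Z) ^ 2 := by
    rw [one_div, le_inv_mul_iff₀ (by positivity), mul_one]
    gcongr
  linarith

/-- The kernel estimate. Near the support X and Z are g-close and slow variation exchanges them. Far
away the bound (h/‖W‖)^(2M), with h = h(Z), is at most a constant times (1 + g^σ_Z(X-Z))^(-M), which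
pays for moving the weight. -/
theorem exists_J_localPiece_le (hp : Admissible ρ δ) {w : Phase n → ℝ} (hw : TW ρ δ w)
    (T : NNReal) : ∃ ε : ℝ, ∃ hε : 0 < ε, ∃ hε2 : ε ≤ 1 / 200, ∃ K : ℕ, ∃ C₀ : ℝ, 0 ≤ C₀ ∧
      ∀ (f : 𝓢(Phase n, ℂ)) (C : ℝ), 0 ≤ C → SymBd ρ δ w K C f → ∀ t : ℝ, |t| ≤ T → ∀ X Z,
        ‖J (t * planck ρ δ Z) (localPiece hp hε (hε2.trans (by norm_num)) f Z)
          (coframe ρ δ Z (X - Z))‖ ≤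
        C₀ * C * (w X * planck ρ δ X ^ n) * ((1 + ‖coframe ρ δ X (X - Z)‖) ^ (2 * n + 2))⁻¹ := by
  obtain ⟨c₁, hc₁, D₁, hD₁, s₁⟩ := hw.slow
  have hv := hw.mul (TW.planck_pow (n := n) hp n)
  obtain ⟨c₂, hc₂, D₂, hD₂, s₂⟩ := hv.slow
  obtain ⟨C₂, hC₂, M, hM⟩ := hv.exists_mul_coframe_le hp (2 * n + 2)
  obtain ⟨ε, hε, hε1, hε2, hε3⟩ : ∃ ε > 0, ε ≤ 1 / 200 ∧ 2 * ε ≤ c₁ ∧ 2 * ε ≤ c₂ :=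
    ⟨min (1 / 200) (min (c₁ / 2) (c₂ / 2)), by positivity, min_le_left _ _,
      by linarith [(min_le_right (1 / 200) (min (c₁ / 2) (c₂ / 2))).trans (min_le_left _ _)],
      by linarith [(min_le_right (1 / 200) (min (c₁ / 2) (c₂ / 2))).trans (min_le_right _ _)]⟩
  -- The order is 2M because g^σ is quadratic in ‖W‖/h.
  obtain ⟨K, C₃, hC₃, hJ⟩ := exists_J_bound (n := n) (2 * M) T
  obtain ⟨C₄, hC₄, hloc⟩ := exists_localPiece_bound (n := n) hp hε hε1 (fun X => (hw.pos X).le)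
    hD₁.le (fun X Y h => (s₁ X Y (h.trans hε2)).2) K
  set q : ℝ := 1 / (2 * ε) ^ 2 + 2 with hq
  have hq0 : 0 < q := by positivity
  -- The two summands are the constants of the near and of the far region.
  refine ⟨ε, hε, hε1, K, C₃ * C₄ * (D₂ * 2 ^ (2 * n + 2) + T ^ (2 * M) * q ^ M * C₂),
    by positivity, fun f C hC hf t ht X Z => ?_⟩
  have hh := planck_pos ρ δ Z
  have hs : |t * planck ρ δ Z| ≤ T * planck ρ δ Z := by
    rw [abs_mul, abs_of_pos hh]; gcongr
  have hsT : |t * planck ρ δ Z| ≤ T :=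
    hs.trans (mul_le_of_le_one_right T.2 (planck_le_one hp Z))
  obtain ⟨j1, j2⟩ := hJ (localPiece hp hε (hε1.trans (by norm_num)) f Z) _ (2 * ε) (by linarith)
    (fun W hW => localPiece_eq_zero hp hε _ f hW) (fun j hj W => hloc f C hC hf Z j hj W)
    (t * planck ρ δ Z) hsT (coframe ρ δ Z (X - Z))
  have hvX : 0 < w X * planck ρ δ X ^ n := hv.pos X
  have hvZ : 0 < w Z * planck ρ δ Z ^ n := hv.pos Z
  have hQ : 0 < (1 + ‖coframe ρ δ X (X - Z)‖) ^ (2 * n + 2) := by positivity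
  rw [← div_eq_mul_inv, le_div_iff₀ hQ]
  rcases le_or_gt ‖coframe ρ δ Z (X - Z)‖ (2 * ε) with h | h
  · have h1 := lam_slow hp (h.trans (by linarith : 2 * ε ≤ 1 / 100))
    have h2 := norm_coframe_le_of_comparable hp h1.1 h1.2 (X - Z)
    have h3 : 1 + ‖coframe ρ δ X (X - Z)‖ ≤ 2 := by linarith
    have h4 := (s₂ Z X (h.trans hε3)).1
    calc _ ≤ C₃ * (C₄ * (C * (planck ρ δ Z ^ n * w Z))) * 2 ^ (2 * n + 2) := by
          have := hw.pos Z
          gcongr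
      _ = C₃ * C₄ * C * 2 ^ (2 * n + 2) * (w Z * planck ρ δ Z ^ n) := by ring
      _ ≤ C₃ * C₄ * C * 2 ^ (2 * n + 2) * (D₂ * (w X * planck ρ δ X ^ n)) := by gcongr
      _ = C₃ * C₄ * (D₂ * 2 ^ (2 * n + 2) + 0) * C * (w X * planck ρ δ X ^ n) := by ring
      _ ≤ _ := by gcongr; positivity
  · have h1 := one_add_dualG_le_of_far hp hε h
    rw [← hq] at h1
    have h2 := j2 h
    have hG := dualG_nonneg ρ δ Z (X - Z)
    have hG' : 0 < 1 + dualG ρ δ Z (X - Z) := by linarith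
    have hW : 0 < ‖coframe ρ δ Z (X - Z)‖ := lt_trans (by positivity) h
    have h5 := hM X Z
    set r := ‖coframe ρ δ Z (X - Z)‖
    set G := dualG ρ δ Z (X - Z)
    set h₀ := planck ρ δ Z
    set Jv := ‖J (t * h₀) (localPiece hp hε (hε1.trans (by norm_num)) f Z)
          (coframe ρ δ Z (X - Z))‖
    have h3 : (1 + G) ^ M * h₀ ^ (2 * M) ≤ q ^ M * r ^ (2 * M) := by
      rw [pow_mul, pow_mul, ← mul_pow, ← mul_pow]
      refine pow_le_pow_left₀ (by positivity) ?_ M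
      calc (1 + G) * h₀ ^ 2 ≤ q * (r / h₀) ^ 2 * h₀ ^ 2 := by gcongr
        _ = _ := by field_simp
    have h4 : Jv * (1 + G) ^ M ≤ q ^ M * T ^ (2 * M) * (C₃ * (C₄ * (C * (h₀ ^ n * w Z)))) := by
      refine le_of_mul_le_mul_right ?_ (pow_pos hh (2 * M))
      calc Jv * (1 + G) ^ M * h₀ ^ (2 * M) = Jv * ((1 + G) ^ M * h₀ ^ (2 * M)) := by ring
        _ ≤ Jv * (q ^ M * r ^ (2 * M)) := by gcongr
        _ = q ^ M * (r ^ (2 * M) * Jv) := by ring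
        _ ≤ q ^ M * (|t * h₀| ^ (2 * M) * (C₃ * (C₄ * (C * (h₀ ^ n * w Z))))) := by gcongr
        _ ≤ q ^ M * ((T * h₀) ^ (2 * M) * (C₃ * (C₄ * (C * (h₀ ^ n * w Z))))) := by
          have := hw.pos Z
          gcongr
        _ = _ := by rw [mul_pow]; ring
    refine le_of_mul_le_mul_right ?_ (pow_pos hG' M)
    calc _ = Jv * (1 + G) ^ M * (1 + ‖coframe ρ δ X (X - Z)‖) ^ (2 * n + 2) := by ring
      _ ≤ q ^ M * T ^ (2 * M) * (C₃ * (C₄ * (C * (h₀ ^ n * w Z)))) *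
          (1 + ‖coframe ρ δ X (X - Z)‖) ^ (2 * n + 2) := by gcongr
      _ = q ^ M * T ^ (2 * M) * C₃ * C₄ * C * (w Z * h₀ ^ n *
          (1 + ‖coframe ρ δ X (X - Z)‖) ^ (2 * n + 2)) := by ring
      _ ≤ q ^ M * T ^ (2 * M) * C₃ * C₄ * C * (C₂ * (w X * planck ρ δ X ^ n) * (1 + G) ^ M) := by
          gcongr
      _ = C₃ * C₄ * (0 + T ^ (2 * M) * q ^ M * C₂) * C * (w X * planck ρ δ X ^ n) *
          (1 + G) ^ M := by ring
      _ ≤ _ := by gcongr; positivity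

theorem integral_one_add_norm_inv_pos :
    0 < ∫ W : Phase n, ((1 + ‖W‖) ^ (2 * n + 2))⁻¹ := by
  have h0 : ∀ W : Phase n, 0 < ((1 + ‖W‖) ^ (2 * n + 2))⁻¹ := fun W => by positivity
  rw [integral_pos_iff_support_of_nonneg (fun W => (h0 W).le) integrable_one_add_norm_inv,
    Function.support_eq_univ (fun W => (h0 W).ne')]
  exact isOpen_univ.measure_pos volume Set.univ_nonempty

theorem integral_coframe_inv (X : Phase n) :
    Integrable (fun Z => ((1 + ‖coframe ρ δ X (X - Z)‖) ^ (2 * n + 2))⁻¹) ∧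
    planck ρ δ X ^ n * ∫ Z, ((1 + ‖coframe ρ δ X (X - Z)‖) ^ (2 * n + 2))⁻¹ =
      ∫ W : Phase n, ((1 + ‖W‖) ^ (2 * n + 2))⁻¹ := by
  have h := integral_coframe (ρ := ρ) (δ := δ)
    (fun W : Phase n => ((((1 + ‖W‖) ^ (2 * n + 2))⁻¹ : ℝ) : ℂ)) X
  rw [integral_complex_ofReal, integral_complex_ofReal, ← integral_sub_right_eq_self _ X] at h
  simp only [map_sub (coframe ρ δ X) _ X, norm_sub_rev _ (coframe ρ δ X X)] at h
  simp only [map_sub]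
  have h2 : planck ρ δ X ^ n *
      ∫ Z, ((1 + ‖coframe ρ δ X X - coframe ρ δ X Z‖) ^ (2 * n + 2))⁻¹ =
      ∫ W : Phase n, ((1 + ‖W‖) ^ (2 * n + 2))⁻¹ := by exact_mod_cast h
  -- Integrability again follows from the integral being nonzero.
  refine ⟨.of_integral_ne_zero fun h0 => ?_, h2⟩
  rw [h0, mul_zero] at h2
  exact integral_one_add_norm_inv_pos.ne h2

/-- The operators `J t` map bounded sets of symbols to functions bounded by the weight. -/
theorem exists_norm_J_le (hp : Admissible ρ δ) {w : Phase n → ℝ} (hw : TW ρ δ w) (T : NNReal) :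
    ∃ K : ℕ, ∃ C₀ : ℝ, 0 ≤ C₀ ∧ ∀ (f : 𝓢(Phase n, ℂ)) (C : ℝ), 0 ≤ C → SymBd ρ δ w K C f →
      ∀ t : ℝ, |t| ≤ T → ∀ X, ‖J t f X‖ ≤ C₀ * C * w X := by
  obtain ⟨ε, hε, hε2, K, C₀, hC₀, h⟩ := exists_J_localPiece_le hp hw T
  refine ⟨K, C₀ * ∫ W : Phase n, ((1 + ‖W‖) ^ (2 * n + 2))⁻¹,
    mul_nonneg hC₀ integral_one_add_norm_inv_pos.le, fun f C hC hf t ht X => ?_⟩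
  obtain ⟨h1, h2⟩ := integral_coframe_inv (ρ := ρ) (δ := δ) X
  rw [J_eq_integral_phiPiece hp hε (hε2.trans (by norm_num)) hε2]
  refine (norm_integral_le_of_norm_le
    (h1.const_mul (C₀ * C * (w X * planck ρ δ X ^ n))) (.of_forall fun Z => ?_)).trans_eq ?_
  · rw [J_phiPiece]
    exact h f C hC hf t ht X Z
  -- The factor h(X)^n of the kernel bound cancels the Jacobian of the integration over Z.
  · rw [integral_const_mul, ← h2]; ring

end Estimate
-- Bounds for all derivatives and for the Taylor remainder.
section Remainder

variable {n : ℕ} {ρ δ : ℝ}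

theorem symNorm_succ_le {f : Phase n → ℂ} (hf : ContDiff ℝ ∞ f) (j : ℕ) (X : Phase n) :
    symNorm ρ δ (j + 1) f X ≤
      ∑ i, (pwt ρ δ i X)⁻¹ * symNorm ρ δ j (fun Y => fderiv ℝ f Y (pvec i)) X := by
  have hq : ∀ i : Fin n ⊕ Fin n, 0 ≤ (pwt ρ δ i X)⁻¹ := fun i => (inv_pos.2 (pwt_pos i X)).le
  refine ContinuousMultilinearMap.opNorm_le_bound
    (Finset.sum_nonneg fun i _ => mul_nonneg (hq i) (symNorm_nonneg _ _ _)) fun t => ?_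
  rw [ContinuousMultilinearMap.compContinuousLinearMap_apply, iteratedFDeriv_succ_apply_right]
  have hfd : ContDiff ℝ ∞ (fderiv ℝ f) := hf.fderiv_right (by simp)
  have e1 : frame ρ δ X (t (Fin.last j)) =
      ∑ i, (pcoord i (t (Fin.last j)) * (pwt ρ δ i X)⁻¹) • pvec i := by
    conv_lhs => rw [← sum_pcoord (t (Fin.last j)), map_sum]
    simp only [map_smul, frame_pvec, smul_smul]
  rw [e1, map_sum, Finset.sum_mul]
  refine (norm_sum_le _ _).trans (Finset.sum_le_sum fun i _ => ?_)
  have e2 : (iteratedFDeriv ℝ j (fderiv ℝ f) X (Fin.init fun l => frame ρ δ X (t l))) (pvec i) =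
      (iteratedFDeriv ℝ j (fun Y => fderiv ℝ f Y (pvec i)) X).compContinuousLinearMap
        (fun _ => frame ρ δ X) (Fin.init t) := by
    have e3 : (fun X => fderiv ℝ f X (pvec i)) =
      (ContinuousLinearMap.apply ℝ ℂ (pvec i : Phase n)) ∘ fderiv ℝ f := rfl
    rw [e3, ContinuousLinearMap.iteratedFDeriv_comp_left _ hfd.contDiffAt
      (by exact_mod_cast le_top)]
    rfl
  rw [map_smul, norm_smul, e2, norm_mul, Real.norm_of_nonneg (hq i)]
  have h1 := ((iteratedFDeriv ℝ j (fun Y => fderiv ℝ f Y (pvec i)) X).compContinuousLinearMap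
        (fun _ => frame ρ δ X)).le_opNorm (Fin.init t)
  have h2 : ‖pcoord i (t (Fin.last j))‖ ≤ ‖t (Fin.last j)‖ := abs_pcoord_le _ _
  rw [Fin.prod_univ_castSucc]
  have h0 := hq i
  have h3 := symNorm_nonneg (ρ := ρ) (δ := δ) j (fun Y => fderiv ℝ f Y (pvec i)) X
  calc _ ≤ ‖t (Fin.last j)‖ * (pwt ρ δ i X)⁻¹ *
        (symNorm ρ δ j (fun Y => fderiv ℝ f Y (pvec i)) X * ∏ l, ‖Fin.init t l‖) := by
        gcongr
        exact h1
    _ = _ := by simp only [Fin.init]; ring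

/-- Converse to `SymBd.pderiv`: the last slot is expanded in the 2n basis vectors, each of which
`frame` stretches by the inverse of its g-length. Bounds of higher order thus reduce to bounds of
order zero for derivatives. -/
theorem SymBd.of_pderiv {w : Phase n → ℝ} {k : ℕ} {C C' : ℝ} {f : Phase n → ℂ}
    (hf : ContDiff ℝ ∞ f) (hw : ∀ X, 0 ≤ w X) (hC : 0 ≤ C) (hC' : 0 ≤ C') (h0 : SymBd ρ δ w 0 C f)
    (h : ∀ i, SymBd ρ δ (fun X => w X * pwt ρ δ i X) k C' (fun X => fderiv ℝ f X (pvec i))) :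
    SymBd ρ δ w (k + 1) (C + 2 * n * C') f := by
  intro j hj X
  have hwX := hw X
  rcases j with _ | j
  · calc _ ≤ C * w X := h0 0 le_rfl X
      _ ≤ _ := by gcongr; linarith [show 0 ≤ 2 * n * C' by positivity]
  · calc symNorm ρ δ (j + 1) f X ≤ _ := symNorm_succ_le hf j X
      _ ≤ ∑ i : Fin n ⊕ Fin n, C' * w X := by
          refine Finset.sum_le_sum fun i _ => ?_
          rw [inv_mul_le_iff₀ (pwt_pos i X)]
          exact (h i j (by omega) X).trans_eq (by ring)
      _ = 2 * n * C' * w X := by simp; ring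
      _ ≤ _ := by gcongr; linarith

theorem coe_lineDeriv (f : 𝓢(Phase n, ℂ)) (v : Phase n) :
    ⇑(∂_{v} f : 𝓢(Phase n, ℂ)) = fun X => fderiv ℝ f X v :=
  funext fun _ => lineDerivOp_apply_eq_fderiv _ _ _

theorem SymBd.lineDeriv {w : Phase n → ℝ} {k : ℕ} {C : ℝ} {f : 𝓢(Phase n, ℂ)}
    (h : SymBd ρ δ w (k + 1) C f) (i : Fin n ⊕ Fin n) :
    SymBd ρ δ (fun X => w X * pwt ρ δ i X) k C (∂_{pvec i} f : 𝓢(Phase n, ℂ)) := by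
  rw [coe_lineDeriv]
  exact h.pderiv f.smooth' i

theorem symNorm_fun_zero (j : ℕ) (X : Phase n) : symNorm ρ δ j (fun _ => 0) X = 0 := by
  rw [symNorm_eq_comp contDiff_const]
  simp [iteratedFDeriv_fun_zero]

theorem SymBd.sum {ι : Type*} (s : Finset ι) {w : Phase n → ℝ} {k : ℕ} {C : ℝ}
    {F : ι → 𝓢(Phase n, ℂ)} (h : ∀ i ∈ s, SymBd ρ δ w k C (F i)) :
    SymBd ρ δ w k (s.card * C) (∑ i ∈ s, F i : 𝓢(Phase n, ℂ)) := by
  classical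
  induction s using Finset.induction_on with
  | empty =>
    intro j _ X
    have := symNorm_fun_zero (ρ := ρ) (δ := δ) j X
    simp only [Finset.sum_empty, Finset.card_empty, Nat.cast_zero, zero_mul]
    exact this.le
  | insert a s ha ih =>
    intro j hj X
    rw [Finset.sum_insert ha, Finset.card_insert_of_notMem ha]
    have := symNorm_add_le (ρ := ρ) (δ := δ) ((F a).smooth ⊤)
      ((∑ i ∈ s, F i : 𝓢(Phase n, ℂ)).smooth ⊤) j X
    refine this.trans ?_
    have h1 := h a (Finset.mem_insert_self _ _) j hj X
    have h2 := ih (fun i hi => h i (Finset.mem_insert_of_mem hi)) j hj X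
    rw [Nat.cast_add, Nat.cast_one]
    linarith

/-- The g-lengths of the j-th vectors in the x and ξ directions multiply to h. Each ⟨∂_x,∂_ξ⟩
therefore consumes two derivatives and gains one factor h. -/
theorem SymBd.crossLap_apply {w : Phase n → ℝ} {k : ℕ} {C : ℝ} {f : 𝓢(Phase n, ℂ)}
    (h : SymBd ρ δ w (k + 2) C f) :
    SymBd ρ δ (fun X => w X * planck ρ δ X) k (n * C) (crossLap n f) := by
  rw [crossLap_eq]
  have := SymBd.sum (ρ := ρ) (δ := δ) (w := fun X => w X * planck ρ δ X) (k := k) (C := C)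
    Finset.univ (F := fun j : Fin n =>
      ∂_{(pvec (.inl j) : Phase n)} (∂_{(pvec (.inr j) : Phase n)} f)) fun j _ => by
    have h1 := (h.lineDeriv (.inr j)).lineDeriv (.inl j)
    refine h1.mono le_rfl fun X => le_of_eq ?_
    have : pwt ρ δ (.inr j) X * pwt ρ δ (.inl j) X = planck ρ δ X := by
      simp only [pwt, lam_rpow_mul, planck]; ring_nf
    rw [mul_assoc (w X), this]
  simpa using this

theorem SymBd.crossLap_pow_apply {w : Phase n → ℝ} {k : ℕ} {C : ℝ} {f : 𝓢(Phase n, ℂ)} (N : ℕ)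
    (h : SymBd ρ δ w (k + 2 * N) C f) :
    SymBd ρ δ (fun X => w X * planck ρ δ X ^ N) k (n ^ N * C) ((crossLap n ^ N) f) := by
  induction N generalizing w C f with
  | zero => simpa using h
  | succ N ih =>
    rw [pow_succ (crossLap n), mul_apply_eq_comp]
    have h1 : SymBd ρ δ w ((k + 2 * N) + 2) C f := h
    refine (ih h1.crossLap_apply).mono le_rfl fun X => le_of_eq ?_
    ring

/-- The remainder is controlled by `J s` applied to the N-th power of `crossLap`, and the pointwise
bound is used for the weight w h^N. -/
theorem exists_norm_jrem_le (hp : Admissible ρ δ) {w : Phase n → ℝ} (hw : TW ρ δ w) (N : ℕ)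
    (t : ℝ) : ∃ K : ℕ, ∃ C₀ : ℝ, 0 ≤ C₀ ∧ ∀ (f : 𝓢(Phase n, ℂ)) (C : ℝ), 0 ≤ C →
      SymBd ρ δ w K C f → ∀ X, ‖jrem N t f X‖ ≤ C₀ * C * (w X * planck ρ δ X ^ N) := by
  obtain ⟨K, C₀, hC₀, h⟩ := exists_norm_J_le hp (hw.mul (TW.planck_pow hp N)) ‖t‖₊
  refine ⟨K + 2 * N, |t| ^ N * (C₀ * n ^ N), by positivity, fun f C hC hf X => ?_⟩
  refine (norm_jrem_le N t f X fun s hs => h _ _ (by positivity) (hf.crossLap_pow_apply N) s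
    (by simpa using hs) X).trans_eq ?_
  ring

/-- Derivatives commute with `jrem`, so the step from k to k+1 applies the induction hypothesis to
each ∂f. This lies in the class of the weight w times `pwt`, hence the induction runs over all
weights simultaneously. -/
theorem exists_symBd_jrem (hp : Admissible ρ δ) (N : ℕ) (t : ℝ) (k : ℕ) {w : Phase n → ℝ}
    (hw : TW ρ δ w) : ∃ K : ℕ, ∃ C₀ : ℝ, 0 ≤ C₀ ∧ ∀ (f : 𝓢(Phase n, ℂ)) (C : ℝ), 0 ≤ C →
      SymBd ρ δ w K C f → SymBd ρ δ (fun X => w X * planck ρ δ X ^ N) k (C₀ * C) (jrem N t f) := by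
  induction k generalizing w with
  | zero =>
    obtain ⟨K, C₀, hC₀, h⟩ := exists_norm_jrem_le hp hw N t
    refine ⟨K, C₀, hC₀, fun f C hC hf j hj X => ?_⟩
    obtain rfl : j = 0 := by omega
    rw [symNorm_zero]
    exact h f C hC hf X
  | succ k ih =>
    obtain ⟨K, C₀, hC₀, h⟩ := exists_norm_jrem_le hp hw N t
    choose K' C' hC' h' using fun i => ih (hw.mul (TW.pwt hp i))
    refine ⟨K + ∑ i, (K' i + 1), C₀ + 2 * n * ∑ i, C' i,
      add_nonneg hC₀ (mul_nonneg (by positivity) (Finset.sum_nonneg fun i _ => hC' i)),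
      fun f C hC hf => ?_⟩
    have hS : 0 ≤ ∑ i, C' i := Finset.sum_nonneg fun i _ => hC' i
    have hpos : ∀ X, 0 ≤ w X * planck ρ δ X ^ N := fun X => (hw.mul (TW.planck_pow hp N)).pos X |>.le
    have := SymBd.of_pderiv (ρ := ρ) (δ := δ) (w := fun X => w X * planck ρ δ X ^ N) (k := k)
      (C := C₀ * C) (C' := (∑ i, C' i) * C) (f := jrem N t f) (jrem N t f).smooth' hpos
      (by positivity) (by positivity) (fun j hj X => by
        obtain rfl : j = 0 := by omega
        rw [symNorm_zero]
        exact h f C hC (hf.mono (by omega) fun _ => le_rfl) X) fun i => by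
        have hK : K' i + 1 ≤ K + ∑ i, (K' i + 1) :=
          (Finset.single_le_sum (f := fun i => K' i + 1) (fun _ _ => Nat.zero_le _)
            (Finset.mem_univ i)).trans (by omega)
        have h1 := h' i _ C hC ((hf.mono hK fun _ => le_rfl).lineDeriv i)
        rw [← lineDeriv_jrem, coe_lineDeriv] at h1
        refine h1.mono le_rfl fun X => ?_
        have h2 : C' i ≤ ∑ i, C' i :=
          Finset.single_le_sum (fun i _ => hC' i) (Finset.mem_univ i)
        have h3 : 0 ≤ w X * planck ρ δ X ^ N * pwt ρ δ i X :=
          mul_nonneg (hpos X) (pwt_pos i X).le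
        calc _ = C' i * C * (w X * planck ρ δ X ^ N * pwt ρ δ i X) := by ring
          _ ≤ _ := by gcongr
    refine this.mono le_rfl fun X => le_of_eq ?_
    ring

theorem jrem_zero (t : ℝ) (f : 𝓢(Phase n, ℂ)) : jrem 0 t f = J t f := by
  ext X; simp [jrem_apply]

end Remainder
-- Extension from Schwartz functions to symbols.
section Extension

variable {n : ℕ} {ρ δ : ℝ}

/-- Membership in `S(g, w)`. -/
structure IsSym (ρ δ : ℝ) (w : Phase n → ℝ) (a : Phase n → ℂ) : Prop where
  contDiff : ContDiff ℝ ∞ a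
  bound : ∀ k, ∃ C, 0 ≤ C ∧ SymBd ρ δ w k C a

/-- Convergence in `S(g, w)` of Schwartz functions. -/
def SymConv (ρ δ : ℝ) (w : Phase n → ℝ) (f : ℕ → 𝓢(Phase n, ℂ)) (a : Phase n → ℂ) : Prop :=
  ∀ k : ℕ, ∀ ε > 0, ∀ᶠ i in Filter.atTop, SymBd ρ δ w k ε (fun X => f i X - a X)

theorem symNorm_le_of_tendsto {j : ℕ} {g : ℕ → Phase n → ℂ} {b : Phase n → ℂ} {X : Phase n} {B : ℝ}
    (h : Filter.Tendsto (fun l => iteratedFDeriv ℝ j (g l) X) Filter.atTop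
      (nhds (iteratedFDeriv ℝ j b X)))
    (hB : ∀ᶠ l in Filter.atTop, symNorm ρ δ j (g l) X ≤ B) : symNorm ρ δ j b X ≤ B := by
  obtain ⟨l, hl⟩ := hB.exists
  refine ContinuousMultilinearMap.opNorm_le_bound ((symNorm_nonneg _ _ _).trans hl) fun t => ?_
  have h1 : Filter.Tendsto (fun l => ‖iteratedFDeriv ℝ j (g l) X (fun i => frame ρ δ X (t i))‖)
      Filter.atTop (nhds ‖iteratedFDeriv ℝ j b X (fun i => frame ρ δ X (t i))‖) :=
    ((ContinuousMultilinearMap.apply ℝ (fun _ : Fin j => Phase n) ℂ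
      (fun i => frame ρ δ X (t i))).continuous.tendsto _ |>.comp h).norm
  refine le_of_tendsto h1 (hB.mono fun l hl => ?_)
  refine (((iteratedFDeriv ℝ j (g l) X).compContinuousLinearMap
    (fun _ => frame ρ δ X)).le_opNorm t).trans ?_
  gcongr
  exact hl

theorem norm_iteratedFDeriv_sub_le (hp : Admissible ρ δ) {w : Phase n → ℝ} {k : ℕ} {ε : ℝ}
    {f g : 𝓢(Phase n, ℂ)} (h : SymBd ρ δ w k ε (fun X => f X - g X)) {j : ℕ} (hj : j ≤ k)
    (X : Phase n) : ‖iteratedFDeriv ℝ j f X - iteratedFDeriv ℝ j g X‖ ≤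
      (lam X ^ (1 / 2 : ℝ)) ^ j * (ε * w X) := by
  have e : iteratedFDeriv ℝ j f X - iteratedFDeriv ℝ j g X =
      iteratedFDeriv ℝ j (fun X => f X - g X) X :=
    (iteratedFDeriv_sub_apply (f.smooth j).contDiffAt (g.smooth j).contDiffAt).symm
  rw [e]
  refine (norm_iteratedFDeriv_le_symNorm (ρ := ρ) (δ := δ) hp j _ X).trans ?_
  have := (lam_rpow_pos X (1 / 2)).le
  gcongr
  exact h j hj X

/-- Completeness of the symbol class. The limits of the derivatives converge locally uniformly,
hence they form a Taylor series of the limit function, which is then smooth. -/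
theorem exists_symConv (hp : Admissible ρ δ) {w : Phase n → ℝ} (hw : TW ρ δ w)
    (g : ℕ → 𝓢(Phase n, ℂ)) (hc : ∀ k : ℕ, ∀ ε > 0, ∃ I, ∀ i ≥ I, ∀ l ≥ I,
      SymBd ρ δ w k ε (fun X => g i X - g l X)) :
    ∃ b : Phase n → ℂ, ContDiff ℝ ∞ b ∧ SymConv ρ δ w g b ∧ ∀ j X, Filter.Tendsto
      (fun l => iteratedFDeriv ℝ j (g l) X) Filter.atTop (nhds (iteratedFDeriv ℝ j b X)) := by
  have hphi : ∀ j X, 0 < (lam X ^ (1 / 2 : ℝ)) ^ j * w X := fun j X =>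
    mul_pos (pow_pos (lam_rpow_pos X _) j) (hw.pos X)
  have hcau : ∀ (X : Phase n) j, ∃ L, Filter.Tendsto (fun l => iteratedFDeriv ℝ j (g l) X)
      Filter.atTop (nhds L) := fun X j => by
    refine cauchySeq_tendsto_of_complete (Metric.cauchySeq_iff.2 fun ε hε => ?_)
    obtain ⟨I, hI⟩ := hc j (ε / 2 / ((lam X ^ (1 / 2 : ℝ)) ^ j * w X))
      (div_pos (by positivity) (hphi j X))
    refine ⟨I, fun i hi l hl => ?_⟩
    rw [dist_eq_norm]
    refine (norm_iteratedFDeriv_sub_le hp (hI i hi l hl) le_rfl X).trans_lt ?_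
    have h0 := (hphi j X).ne'
    calc _ = ε / 2 / ((lam X ^ (1 / 2 : ℝ)) ^ j * w X) * ((lam X ^ (1 / 2 : ℝ)) ^ j * w X) := by
          ring
      _ = ε / 2 := div_mul_cancel₀ _ h0
      _ < ε := by linarith
  choose p hP using hcau
  have hlim : ∀ j, ∀ ε > 0, ∃ I, ∀ i ≥ I, ∀ X, ‖iteratedFDeriv ℝ j (g i) X - p X j‖ ≤
      (lam X ^ (1 / 2 : ℝ)) ^ j * (ε * w X) := fun j ε hε => by
    obtain ⟨I, hI⟩ := hc j ε hε
    refine ⟨I, fun i hi X => ?_⟩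
    refine le_of_tendsto ((tendsto_const_nhds.sub (hP X j)).norm)
      (Filter.eventually_atTop.2 ⟨I, fun l hl => ?_⟩)
    exact norm_iteratedFDeriv_sub_le hp (hI i hi l hl) le_rfl X
  obtain ⟨Cw, hCw, Nw, hwl⟩ := hw.exists_le_lam_pow
  have hunif : ∀ j, TendstoLocallyUniformly (fun l X => iteratedFDeriv ℝ j (g l) X)
      (fun X => p X j) Filter.atTop := fun j => by
    rw [Metric.tendstoLocallyUniformly_iff]
    intro ε hε x
    -- The weight itself need not be continuous; its majorant by a power of `lam` is, and it yields
    -- the local uniformity.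
    set φ : Phase n → ℝ := fun X => (lam X ^ (1 / 2 : ℝ)) ^ j * (Cw * lam X ^ Nw) with hφ
    have hφc : Continuous φ := ((continuous_lam_rpow _).pow j).mul
      (continuous_const.mul (contDiff_lam.continuous.pow Nw))
    have hφ0 : ∀ X, 0 < φ X := fun X =>
      mul_pos (pow_pos (lam_rpow_pos X _) j) (mul_pos hCw (pow_pos (lam_pos X) _))
    refine ⟨{y | φ y < φ x + 1}, (isOpen_lt hφc continuous_const).mem_nhds (by simp), ?_⟩
    have hx := hφ0 x
    obtain ⟨I, hI⟩ := hlim j (ε / (2 * (φ x + 1))) (by positivity)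
    filter_upwards [Filter.eventually_ge_atTop I] with l hl y hy
    rw [dist_comm, dist_eq_norm]
    have hy' : φ y < φ x + 1 := hy
    have := (lam_rpow_pos y (1 / 2)).le
    calc _ ≤ _ := hI l hl y
      _ ≤ (lam y ^ (1 / 2 : ℝ)) ^ j * (ε / (2 * (φ x + 1)) * (Cw * lam y ^ Nw)) := by
        gcongr; exact hwl y
      _ = ε / (2 * (φ x + 1)) * φ y := by rw [hφ]; ring
      _ ≤ ε / (2 * (φ x + 1)) * (φ x + 1) := by gcongr
      _ = ε / 2 := by field_simp
      _ < ε := by linarith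
  set b : Phase n → ℂ := fun X => (p X 0).curry0 with hb
  have hder : ∀ (m : ℕ) (x : Phase n), HasFDerivAt (fun y => p y m) (p x (m + 1)).curryLeft x := by
    intro m x
    refine hasFDerivAt_of_tendstoLocallyUniformlyOn (l := Filter.atTop) isOpen_univ
      (f := fun l X => iteratedFDeriv ℝ m (g l) X)
      (f' := fun l X => (iteratedFDeriv ℝ (m + 1) (g l) X).curryLeft)
      (g' := fun x => (p x (m + 1)).curryLeft)
      ?_ (fun l y _ => ?_) (fun y _ => hP y m) (Set.mem_univ x)
    · have := hunif (m + 1)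
      rw [tendstoLocallyUniformlyOn_univ]
      rw [Metric.tendstoLocallyUniformly_iff] at this ⊢
      intro ε hε x
      obtain ⟨t, ht, h⟩ := this ε hε x
      refine ⟨t, ht, h.mono fun l hl y hy => ?_⟩
      have h2 := (continuousMultilinearCurryLeftEquiv ℝ (fun _ : Fin (m + 1) => Phase n) ℂ).dist_map
        (p y (m + 1)) (iteratedFDeriv ℝ (m + 1) (g l) y)
      exact h2.trans_lt (hl y hy)
    · have h1 : DifferentiableAt ℝ (iteratedFDeriv ℝ m (g l)) y :=
        ((g l).smooth ⊤).differentiable_iteratedFDeriv (by exact_mod_cast ENat.natCast_lt_top m) y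
      have h2 := h1.hasFDerivAt
      rw [fderiv_iteratedFDeriv] at h2
      exact h2
  have htay : HasFTaylorSeriesUpTo ∞ b p :=
    ⟨fun x => rfl, fun m _ x => hder m x,
      fun m _ => continuous_iff_continuousAt.2 fun x => (hder m x).continuousAt⟩
  have hbs : ContDiff ℝ ∞ b := htay.contDiff
  have hconv : ∀ j X, Filter.Tendsto
      (fun l => iteratedFDeriv ℝ j (g l) X) Filter.atTop (nhds (iteratedFDeriv ℝ j b X)) :=
    fun j X => by
      rw [← htay.eq_iteratedFDeriv (by exact_mod_cast le_top) X]
      exact hP X j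
  refine ⟨b, hbs, fun k ε hε => ?_, hconv⟩
  obtain ⟨I, hI⟩ := hc k ε hε
  refine Filter.eventually_atTop.2 ⟨I, fun i hi j hj X => ?_⟩
  refine symNorm_le_of_tendsto (g := fun l X => g i X - g l X) ?_
    (Filter.eventually_atTop.2 ⟨I, fun l hl => hI i hi l hl j hj X⟩)
  have e1 : iteratedFDeriv ℝ j (fun X => g i X - b X) X =
      iteratedFDeriv ℝ j (g i) X - iteratedFDeriv ℝ j b X :=
    iteratedFDeriv_sub_apply ((g i).smooth j).contDiffAt
      (hbs.of_le (by exact_mod_cast le_top)).contDiffAt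
  have e2 : ∀ l, iteratedFDeriv ℝ j (fun X => g i X - g l X) X =
      iteratedFDeriv ℝ j (g i) X - iteratedFDeriv ℝ j (g l) X := fun l =>
    iteratedFDeriv_sub_apply ((g i).smooth j).contDiffAt ((g l).smooth j).contDiffAt
  simp only [e1, e2]
  exact tendsto_const_nhds.sub (hconv j X)

/-- Cutoff functions on balls of growing radius. -/
def cut (n i : ℕ) (X : Phase n) : ℂ :=
  ((⟨1, 2, one_pos, one_lt_two⟩ : ContDiffBump (0 : Phase n)) (((i : ℝ) + 1)⁻¹ • X) : ℝ)

theorem contDiff_cut (i : ℕ) : ContDiff ℝ ∞ (cut n i) :=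
  Complex.ofRealCLM.contDiff.comp
    ((ContDiffBump.contDiff _).comp (contDiff_const_smul (((i : ℝ) + 1)⁻¹)))

theorem norm_inv_smul_phase (i : ℕ) (X : Phase n) : ‖((i : ℝ) + 1)⁻¹ • X‖ = ‖X‖ / (i + 1) := by
  rw [norm_smul, norm_inv, Real.norm_of_nonneg (by positivity), inv_mul_eq_div]

theorem cut_eq_one {i : ℕ} {X : Phase n} (h : ‖X‖ ≤ i + 1) : cut n i X = 1 := by
  rw [cut, ContDiffBump.one_of_mem_closedBall]
  · simp
  · rw [mem_closedBall_zero_iff, norm_inv_smul_phase, div_le_iff₀ (by positivity)]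
    simpa using h

theorem cut_eq_zero {i : ℕ} {X : Phase n} (h : 2 * (i + 1) ≤ ‖X‖) : cut n i X = 0 := by
  rw [cut, ContDiffBump.zero_of_le_dist]
  · simp
  · rw [dist_zero_right, norm_inv_smul_phase, le_div_iff₀ (by positivity)]
    exact h

theorem norm_cut_le (i : ℕ) (X : Phase n) : ‖cut n i X‖ ≤ 1 := by
  rw [cut, Complex.norm_real, Real.norm_of_nonneg (ContDiffBump.nonneg _)]
  exact ContDiffBump.le_one _

theorem hasCompactSupport_cut (i : ℕ) : HasCompactSupport (cut n i) :=
  HasCompactSupport.of_support_subset_isCompact (isCompact_closedBall (0 : Phase n) (2 * (i + 1)))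
    fun X hX => by
      by_contra h
      exact hX (cut_eq_zero (by simpa using (not_le.1 (by simpa using h)).le))

/-- Where the derivatives of the cutoff live one has ‖X‖ ≤ 2(i+1), so `frame` has norm at most
λ^(1/2) ≤ 5(i+1). This compensates the factor 1/(i+1) that each derivative brings. -/
theorem exists_symBd_cut (hp : Admissible ρ δ) (k : ℕ) :
    ∃ C : ℝ, 0 ≤ C ∧ ∀ i, SymBd ρ δ (fun _ : Phase n => 1) k C (cut n i) := by
  have hcs : ∀ j, ∃ C, ∀ X, ‖iteratedFDeriv ℝ j (cut n 0) X‖ ≤ C := fun j =>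
    ((hasCompactSupport_cut 0).iteratedFDeriv (𝕜 := ℝ) j).exists_bound_of_continuous
      ((contDiff_cut 0).continuous_iteratedFDeriv (by exact_mod_cast le_top))
  choose C hC using hcs
  have key : ∀ i j X, symNorm ρ δ j (cut n i) X ≤ max 1 (5 ^ j * C j) := by
    intro i j X
    rcases j with _ | j
    · rw [symNorm_zero]
      exact (norm_cut_le i X).trans (le_max_left _ _)
    refine (symNorm_le hp _ _ X).trans ?_
    have e : cut n i = fun X => cut n 0 (((i : ℝ) + 1)⁻¹ • X) := by
      ext X; simp [cut]
    have hC0 : 0 ≤ C (j + 1) := (norm_nonneg _).trans (hC (j + 1) 0)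
    rcases lt_or_ge (2 * ((i : ℝ) + 1)) ‖X‖ with h | h
    · have he : cut n i =ᶠ[nhds X] fun _ => 0 := by
        filter_upwards [(isOpen_lt continuous_const continuous_norm).mem_nhds h] with V hV
        exact cut_eq_zero hV.le
      rw [(he.iteratedFDeriv ℝ _).eq_of_nhds]
      simp [iteratedFDeriv_fun_zero]
    · refine le_trans ?_ (le_max_right _ _)
      have h1 : lam X ^ (1 / 2 : ℝ) ≤ 5 * ((i : ℝ) + 1) := by
        rw [← Real.sqrt_eq_rpow]
        refine Real.sqrt_le_iff.2 ⟨by positivity, (lam_le_sq X).trans ?_⟩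
        have : 1 + ‖X‖ ≤ 3 * ((i : ℝ) + 1) := by linarith [show (0 : ℝ) ≤ i by positivity]
        calc 2 * (1 + ‖X‖) ^ 2 ≤ 2 * (3 * ((i : ℝ) + 1)) ^ 2 := by gcongr
          _ ≤ _ := by nlinarith [show (0 : ℝ) ≤ i by positivity]
      rw [e, iteratedFDeriv_comp_const_smul _ ((contDiff_cut 0).of_le (by exact_mod_cast le_top)),
        norm_smul, norm_pow, norm_inv, Real.norm_of_nonneg (by positivity : (0 : ℝ) ≤ i + 1)]
      have h0 := (lam_rpow_pos X (1 / 2)).le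
      calc _ ≤ (5 * ((i : ℝ) + 1)) ^ (j + 1) * ((((i : ℝ) + 1)⁻¹) ^ (j + 1) * C (j + 1)) := by
            gcongr; exact hC _ _
        _ = _ := by rw [← mul_assoc, ← mul_pow]; congr 2; field_simp
  refine ⟨∑ j ∈ Finset.range (k + 1), max 1 (5 ^ j * C j),
    Finset.sum_nonneg fun _ _ => zero_le_one.trans (le_max_left _ _), fun i j hj X => ?_⟩
  rw [mul_one]
  exact (key i j X).trans (Finset.single_le_sum (f := fun j => max 1 (5 ^ j * C j))
    (fun _ _ => zero_le_one.trans (le_max_left _ _)) (by simpa [Nat.lt_succ_iff] using hj))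

/-- The truncations of a symbol. -/
def trunc (a : Phase n → ℂ) (ha : ContDiff ℝ ∞ a) (i : ℕ) : 𝓢(Phase n, ℂ) :=
  ((hasCompactSupport_cut i).mul_right (f' := a)).toSchwartzMap ((contDiff_cut i).mul ha)

theorem trunc_apply {a : Phase n → ℂ} (ha : ContDiff ℝ ∞ a) (i : ℕ) (X : Phase n) :
    trunc a ha i X = cut n i X * a X := rfl

theorem trunc_eq {a : Phase n → ℂ} (ha : ContDiff ℝ ∞ a) {i : ℕ} {X : Phase n} (h : ‖X‖ ≤ i + 1) :
    trunc a ha i X = a X := by rw [trunc_apply, cut_eq_one h, one_mul]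

theorem IsSym.exists_symBd_trunc (hp : Admissible ρ δ) {w : Phase n → ℝ} {a : Phase n → ℂ}
    (ha : IsSym ρ δ w a) (k : ℕ) :
    ∃ C : ℝ, 0 ≤ C ∧ ∀ i, SymBd ρ δ w k C (trunc a ha.contDiff i) := by
  obtain ⟨C, hC, h⟩ := exists_symBd_cut (n := n) hp k
  obtain ⟨D, hD, h'⟩ := ha.bound k
  refine ⟨2 ^ k * (C * D), by positivity, fun i => ?_⟩
  refine (SymBd.mul (contDiff_cut i) ha.contDiff (h i) h').mono le_rfl fun X => ?_
  rw [one_mul]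

/-- In S(g,w) itself truncations are in general only bounded. The difference lives where ‖X‖ ≥ i+1,
and there the additional factor λ ≥ i+1 makes it small. -/
theorem IsSym.symConv_trunc (hp : Admissible ρ δ) {w : Phase n → ℝ} (hw : ∀ X, 0 ≤ w X)
    {a : Phase n → ℂ} (ha : IsSym ρ δ w a) :
    SymConv ρ δ (fun X => w X * lam X) (trunc a ha.contDiff) a := by
  intro k ε hε
  obtain ⟨C, hC, h⟩ := ha.exists_symBd_trunc hp k
  obtain ⟨D, hD, h'⟩ := ha.bound k
  obtain ⟨I, hI⟩ := exists_nat_ge ((C + D) / ε)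
  refine Filter.eventually_atTop.2 ⟨I, fun i hi j hj X => ?_⟩
  have hwX := hw X
  have hl := lam_pos X
  rcases lt_or_ge ‖X‖ ((i : ℝ) + 1) with hX | hX
  · have he : (fun X => trunc a ha.contDiff i X - a X) =ᶠ[nhds X] fun _ => 0 := by
      filter_upwards [(isOpen_lt continuous_norm continuous_const).mem_nhds hX] with V hV
      rw [trunc_eq ha.contDiff (le_of_lt hV), sub_self]
    rw [symNorm, (he.iteratedFDeriv ℝ _).eq_of_nhds]
    have h0 := symNorm_fun_zero (ρ := ρ) (δ := δ) j X
    rw [symNorm] at h0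
    rw [h0]; positivity
  · refine (symNorm_sub_le ((trunc a ha.contDiff i).smooth ⊤) ha.contDiff j X).trans ?_
    have h1 : (i : ℝ) + 1 ≤ lam X := by
      have := norm_sq_le_lam X
      nlinarith [show (0 : ℝ) ≤ i by positivity]
    have h2 : C + D ≤ ε * lam X := by
      rw [div_le_iff₀ hε] at hI
      have : (I : ℝ) ≤ i := by exact_mod_cast hi
      nlinarith
    calc _ ≤ C * w X + D * w X := add_le_add (h i j hj X) (h' j hj X)
      _ = (C + D) * w X := by ring
      _ ≤ ε * lam X * w X := by gcongr
      _ = _ := by ring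

theorem SymBd.sub {w : Phase n → ℝ} {k : ℕ} {C D : ℝ} {f g : Phase n → ℂ} (hf : ContDiff ℝ ∞ f)
    (hg : ContDiff ℝ ∞ g) (h : SymBd ρ δ w k C f) (h' : SymBd ρ δ w k D g) :
    SymBd ρ δ w k (C + D) (fun X => f X - g X) := fun j hj X =>
  (symNorm_sub_le hf hg j X).trans ((add_le_add (h j hj X) (h' j hj X)).trans_eq (by ring))

theorem SymConv.cauchy {w : Phase n → ℝ} {f g : ℕ → 𝓢(Phase n, ℂ)} {a : Phase n → ℂ}
    (ha : ContDiff ℝ ∞ a) (h : SymConv ρ δ w f a) (h' : SymConv ρ δ w g a) (k : ℕ) {ε : ℝ}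
    (hε : 0 < ε) : ∃ I, ∀ i ≥ I, ∀ l ≥ I, SymBd ρ δ w k ε (f i - g l : 𝓢(Phase n, ℂ)) := by
  obtain ⟨I, hI⟩ := Filter.eventually_atTop.1 (h k (ε / 2) (by positivity))
  obtain ⟨I', hI'⟩ := Filter.eventually_atTop.1 (h' k (ε / 2) (by positivity))
  refine ⟨max I I', fun i hi l hl => ?_⟩
  have := SymBd.sub (((f i).smooth ⊤).sub ha) (((g l).smooth ⊤).sub ha)
    (hI i ((le_max_left _ _).trans hi)) (hI' l ((le_max_right _ _).trans hl))
  rw [add_halves] at this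
  convert this using 1
  ext X
  simp

/-- The operators `jrem N t` extend to symbols. -/
theorem IsSym.exists_jrem (hp : Admissible ρ δ) {w : Phase n → ℝ} (hw : TW ρ δ w)
    {a : Phase n → ℂ} (ha : IsSym ρ δ w a) (N : ℕ) (t : ℝ) :
    ∃ b : Phase n → ℂ, IsSym ρ δ (fun X => w X * planck ρ δ X ^ N) b ∧
      ∀ f, SymConv ρ δ (fun X => w X * lam X) f a →
        SymConv ρ δ (fun X => w X * lam X) (fun i => jrem N t (f i)) b := by
  have hlam : TW ρ δ (fun X : Phase n => lam X) := by
    simpa using TW.lam_rpow (n := n) hp 1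
  have hW := hw.mul hlam
  have hWN : ∀ X : Phase n, w X * lam X * planck ρ δ X ^ N ≤ w X * lam X := fun X =>
    mul_le_of_le_one_right (hW.pos X).le
      (pow_le_one₀ (planck_pos ρ δ X).le (planck_le_one hp X))
  have hcont : ∀ k : ℕ, ∃ K : ℕ, ∀ ε > 0, ∃ η > 0, ∀ F : 𝓢(Phase n, ℂ),
      SymBd ρ δ (fun X => w X * lam X) K η F →
      SymBd ρ δ (fun X => w X * lam X) k ε (jrem N t F) := fun k => by
    obtain ⟨K, C₀, hC₀, h⟩ := exists_symBd_jrem hp N t k hW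
    refine ⟨K, fun ε hε => ⟨ε / (C₀ + 1), by positivity, fun F hF => ?_⟩⟩
    refine (h F _ (by positivity) hF).mono le_rfl fun X => ?_
    refine (mul_le_mul_of_nonneg_left (hWN X) (by positivity)).trans ?_
    have := (hW.pos X).le
    gcongr
    rw [mul_div_assoc', div_le_iff₀ (by positivity)]
    nlinarith
  have hconv : ∀ f g : ℕ → 𝓢(Phase n, ℂ), SymConv ρ δ (fun X => w X * lam X) f a →
      SymConv ρ δ (fun X => w X * lam X) g a → ∀ k : ℕ, ∀ ε > 0, ∃ I, ∀ i ≥ I, ∀ l ≥ I,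
      SymBd ρ δ (fun X => w X * lam X) k ε (fun X => jrem N t (f i) X - jrem N t (g l) X) := by
    intro f g hf hg k ε hε
    obtain ⟨K, hK⟩ := hcont k
    obtain ⟨η, hη, h⟩ := hK ε hε
    obtain ⟨I, hI⟩ := hf.cauchy ha.contDiff hg K hη
    refine ⟨I, fun i hi l hl => ?_⟩
    have := h _ (hI i hi l hl)
    rw [map_sub] at this
    exact this
  have ht := ha.symConv_trunc hp fun X => (hw.pos X).le
  obtain ⟨b, hb, hbc, hbt⟩ := exists_symConv hp hW (fun i => jrem N t (trunc a ha.contDiff i))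
    (hconv _ _ ht ht)
  refine ⟨b, ⟨hb, fun k => ?_⟩, fun f hf k ε hε => ?_⟩
  -- The convergence takes place for the larger weight, but the truncations are bounded in S(g,w);
  -- the sharp estimate is uniform along the sequence and passes to the pointwise limit.
  · obtain ⟨K, C₀, hC₀, h⟩ := exists_symBd_jrem hp N t k hw
    obtain ⟨C, hC, hCb⟩ := ha.exists_symBd_trunc hp K
    exact ⟨C₀ * C, by positivity, fun j hj X => symNorm_le_of_tendsto (hbt j X)
      (.of_forall fun i => h _ C hC (hCb i) j hj X)⟩
  · obtain ⟨I, hI⟩ := hconv _ _ hf ht k (ε / 2) (by positivity)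
    obtain ⟨I', hI'⟩ := Filter.eventually_atTop.1 (hbc k (ε / 2) (by positivity))
    refine Filter.eventually_atTop.2 ⟨max I I', fun i hi j hj X => ?_⟩
    have hm : max I I' ≥ I := le_max_left _ _
    have h1 := hI i (hm.le.trans hi) (max I I') hm j hj X
    have h2 := hI' (max I I') (le_max_right _ _) j hj X
    have h3 := symNorm_add_le (ρ := ρ) (δ := δ)
      (f := fun X => jrem N t (f i) X - jrem N t (trunc a ha.contDiff (max I I')) X)
      (g := fun X => jrem N t (trunc a ha.contDiff (max I I')) X - b X)
      (((jrem N t (f i)).smooth ⊤).sub ((jrem N t _).smooth ⊤))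
      (((jrem N t _).smooth ⊤).sub hb) j X
    simp only [sub_add_sub_cancel] at h3
    linarith

end Extension
-- Rapid decay of Fourier transforms of symbols along affine subspaces.
section FourierDecay

variable {n : ℕ} {ρ δ : ℝ}

theorem integrable_one_add_norm_euc :
    Integrable (fun y : Euc n => ((1 + ‖y‖) ^ (n + 1))⁻¹) := by
  have h := integrable_one_add_norm (E := Euc n) (μ := volume) (r := (n + 1 : ℕ))
    (by rw [finrank_euclideanSpace_fin]; push_cast; linarith)
  refine h.congr (.of_forall fun X => ?_)
  beta_reduce
  rw [Real.rpow_neg (by positivity), Real.rpow_natCast]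

theorem norm_iteratedFDeriv_affine_le {g : Phase n → ℂ} (hg : ContDiff ℝ ∞ g) (X : Phase n)
    (L : Euc n →L[ℝ] Phase n) (j : ℕ) (y : Euc n) :
    ‖iteratedFDeriv ℝ j (fun y => g (X + L y)) y‖ ≤
      symNorm ρ δ j g (X + L y) * ‖(coframe ρ δ (X + L y)).comp L‖ ^ j := by
  have h1 : ContDiff ℝ ∞ (fun Y => g (X + Y)) := hg.comp (contDiff_const.add contDiff_id)
  have := L.iteratedFDeriv_comp_right (f := fun Y => g (X + Y)) h1 y
    (i := j) (by exact_mod_cast le_top)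
  rw [Function.comp_def] at this
  rw [this, iteratedFDeriv_comp_add_left]
  refine ContinuousMultilinearMap.opNorm_le_bound
    (mul_nonneg (symNorm_nonneg _ _ _) (by positivity)) fun t => ?_
  rw [ContinuousMultilinearMap.compContinuousLinearMap_apply]
  refine (norm_iteratedFDeriv_apply_le (ρ := ρ) (δ := δ) j g _ _).trans ?_
  rw [mul_assoc]
  refine mul_le_mul_of_nonneg_left ?_ (symNorm_nonneg _ _ _)
  calc _ ≤ ∏ i, (‖(coframe ρ δ (X + L y)).comp L‖ * ‖t i‖) := by
        gcongr with i
        exact ((coframe ρ δ (X + L y)).comp L).le_opNorm (t i)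
    _ = _ := by rw [Finset.prod_mul_distrib]; simp

/-- A derivative along L costs λ^(δ/2), thus A^(δ/2) up to powers of 1+‖y‖ that the Schwartz factor
absorbs. That N does not depend on k is essential: later A is of size (1+‖q‖)², and the loss grows
with k only like ‖q‖^(kδ). -/
theorem exists_norm_iteratedFDeriv_mul_schwartz_le (hp : Admissible ρ δ) {W : Phase n → ℝ}
    (hW : TW ρ δ W) (M : ℝ) (hM : 1 ≤ M) : ∃ N : ℕ, ∀ k : ℕ,
      ∃ p : Seminorm ℂ 𝓢(Euc n, ℂ), Continuous p ∧
      ∀ (g : Phase n → ℂ) (ε A : ℝ) (X : Phase n) (L : Euc n →L[ℝ] Phase n) (v : 𝓢(Euc n, ℂ)),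
        ContDiff ℝ ∞ g → 0 ≤ ε → SymBd ρ δ W k ε g →
        (∀ Y, ‖(coframe ρ δ Y).comp L‖ ≤ M * lam Y ^ (δ / 2)) → 1 ≤ A →
        (∀ y, lam (X + L y) ≤ A * (1 + ‖y‖) ^ 2) → ∀ j ≤ k, ∀ y,
        ‖iteratedFDeriv ℝ j (fun y => g (X + L y) * v y) y‖ ≤
          ε * (A ^ (N + k * (δ / 2)) * p v) * ((1 + ‖y‖) ^ (n + 1))⁻¹ := by
  obtain ⟨Cw, hCw, N, hwl⟩ := hW.exists_le_lam_pow
  refine ⟨N, fun k => ?_⟩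
  -- The weight 2(N+k) absorbs the growth of g and of its derivatives, and n+1 is left over for
  -- integrability.
  set m : ℕ × ℕ := (2 * (N + k) + (n + 1), k) with hm
  set q : Seminorm ℂ 𝓢(Euc n, ℂ) := (Finset.Iic m).sup (schwartzSeminormFamily ℂ (Euc n) ℂ) with hq
  have hqc : Continuous q := Seminorm.continuous_finsetSup fun i _ =>
    (schwartz_withSeminorms ℂ (Euc n) ℂ).continuous_seminorm i
  set c : NNReal := ⟨2 ^ k * (Cw * M ^ k * 2 ^ m.1), by positivity⟩ with hc
  refine ⟨c • q, hqc.const_smul c, fun g ε A X L v hg hε hgb hL hA hlam j hj y => ?_⟩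
  have hδ := hp.nonneg
  have hAff : ContDiff ℝ ∞ (fun y => g (X + L y)) := hg.comp (contDiff_const.add L.contDiff)
  have h2 := norm_iteratedFDeriv_mul_le (𝕜 := ℝ) hAff (v.smooth ⊤) y
      (n := j) (by exact_mod_cast le_top)
  have hA0 : 0 < A := by linarith
  have hl := lam_pos (X + L y)
  have hy : 1 ≤ 1 + ‖y‖ := by linarith [norm_nonneg y]
  have hlA : lam (X + L y) ^ N * (lam (X + L y) ^ (δ / 2)) ^ k ≤
      A ^ (N + k * (δ / 2)) * (1 + ‖y‖) ^ (2 * (N + k)) := by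
    rw [lam_rpow_pow, ← Real.rpow_natCast, lam_rpow_mul]
    calc _ ≤ (A * (1 + ‖y‖) ^ 2) ^ (N + δ / 2 * k : ℝ) :=
          Real.rpow_le_rpow hl.le (hlam y) (by positivity)
      _ = A ^ (N + k * (δ / 2)) * ((1 + ‖y‖) ^ 2) ^ (N + δ / 2 * k : ℝ) := by
          rw [Real.mul_rpow hA0.le (by positivity), mul_comm (k : ℝ)]
      _ ≤ A ^ (N + k * (δ / 2)) * ((1 + ‖y‖) ^ 2) ^ ((N + k : ℕ) : ℝ) := by
          gcongr
          · exact one_le_pow₀ hy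
          · push_cast
            have := hp.lt_one
            nlinarith [show (0 : ℝ) ≤ k by positivity]
      _ = _ := by rw [Real.rpow_natCast, ← pow_mul]
  have h3 : ∀ i ∈ Finset.range (j + 1), (j.choose i : ℝ) *
      ‖iteratedFDeriv ℝ i (fun y => g (X + L y)) y‖ * ‖iteratedFDeriv ℝ (j - i) v y‖ ≤
      (j.choose i : ℝ) * (ε * (Cw * M ^ k * (A ^ (N + k * (δ / 2)))) * (2 ^ m.1 * q v) *
        ((1 + ‖y‖) ^ (n + 1))⁻¹) := by
    intro i hi
    have hi' : i ≤ j := by simpa [Nat.lt_succ_iff] using hi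
    have hik : i ≤ k := hi'.trans hj
    have h4 := SchwartzMap.one_add_le_sup_seminorm_apply (𝕜 := ℂ) (m := m)
      (k := m.1) (n := j - i) le_rfl ((Nat.sub_le _ _).trans hj) v y
    have h5 : ‖iteratedFDeriv ℝ i (fun y => g (X + L y)) y‖ ≤
        ε * (Cw * M ^ k * (A ^ (N + k * (δ / 2)) * (1 + ‖y‖) ^ (2 * (N + k)))) := by
      have hM0 : 0 ≤ M * lam (X + L y) ^ (δ / 2) := (norm_nonneg _).trans (hL (X + L y))
      have h1M : 1 ≤ M * lam (X + L y) ^ (δ / 2) :=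
        one_le_mul_of_one_le_of_one_le hM (one_le_lam_rpow _ (by linarith))
      calc _ ≤ symNorm ρ δ i g (X + L y) * ‖(coframe ρ δ (X + L y)).comp L‖ ^ i :=
            norm_iteratedFDeriv_affine_le hg X L i y
        _ ≤ (ε * W (X + L y)) * (M * lam (X + L y) ^ (δ / 2)) ^ i := by
            gcongr
            · exact (symNorm_nonneg _ _ _).trans (hgb i hik _)
            · exact hgb i hik _
            · exact hL _
        _ ≤ (ε * (Cw * lam (X + L y) ^ N)) * (M * lam (X + L y) ^ (δ / 2)) ^ k := by
            gcongr
            exact hwl _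
        _ = ε * (Cw * M ^ k * (lam (X + L y) ^ N * (lam (X + L y) ^ (δ / 2)) ^ k)) := by
            rw [mul_pow]; ring
        _ ≤ _ := by gcongr
    have hAe : 0 ≤ A ^ (N + k * (δ / 2)) := (Real.rpow_pos_of_pos hA0 _).le
    have h6 : (1 + ‖y‖) ^ (2 * (N + k)) * ‖iteratedFDeriv ℝ (j - i) v y‖ ≤
        (2 ^ m.1 * q v) * ((1 + ‖y‖) ^ (n + 1))⁻¹ := by
      rw [← div_eq_mul_inv, le_div_iff₀ (by positivity)]
      refine le_trans (le_of_eq ?_) h4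
      rw [hm]; simp only [pow_add]; ring
    rw [mul_assoc]
    refine mul_le_mul_of_nonneg_left ?_ (by positivity)
    calc _ ≤ ε * (Cw * M ^ k * (A ^ (N + k * (δ / 2)) * (1 + ‖y‖) ^ (2 * (N + k)))) *
          ‖iteratedFDeriv ℝ (j - i) v y‖ := by gcongr
      _ = ε * (Cw * M ^ k * (A ^ (N + k * (δ / 2)))) *
          ((1 + ‖y‖) ^ (2 * (N + k)) * ‖iteratedFDeriv ℝ (j - i) v y‖) := by ring
      _ ≤ ε * (Cw * M ^ k * (A ^ (N + k * (δ / 2)))) *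
          ((2 ^ m.1 * q v) * ((1 + ‖y‖) ^ (n + 1))⁻¹) := by gcongr
      _ = _ := by ring
  refine (h2.trans (Finset.sum_le_sum h3)).trans ?_
  rw [← Finset.sum_mul]
  have hS : ∑ i ∈ Finset.range (j + 1), (j.choose i : ℝ) = 2 ^ j := by
    exact_mod_cast Nat.sum_range_choose j
  have hAe : 0 ≤ A ^ (N + k * (δ / 2)) := (Real.rpow_pos_of_pos hA0 _).le
  have hqv : 0 ≤ q v := apply_nonneg _ _
  rw [hS]
  calc _ ≤ 2 ^ k * (ε * (Cw * M ^ k * (A ^ (N + k * (δ / 2)))) * (2 ^ m.1 * q v) *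
        ((1 + ‖y‖) ^ (n + 1))⁻¹) := by gcongr; norm_num
    _ = ε * (A ^ (N + k * (δ / 2)) * (2 ^ k * (Cw * M ^ k * 2 ^ m.1) * q v)) *
        ((1 + ‖y‖) ^ (n + 1))⁻¹ := by ring
    _ = _ := rfl

/-- The Fourier transform of a symbol times a Schwartz function along an affine subspace
decays rapidly. -/
theorem exists_fourier_decay (hp : Admissible ρ δ) {W : Phase n → ℝ} (hW : TW ρ δ W) (M B : ℝ)
    (hM : 1 ≤ M) (hB : 1 ≤ B) (D : ℕ) : ∃ k : ℕ, ∃ p : Seminorm ℂ 𝓢(Euc n, ℂ), Continuous p ∧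
      ∀ (g : Phase n → ℂ) (ε : ℝ) (X : Phase n) (L : Euc n →L[ℝ] Phase n) (v : 𝓢(Euc n, ℂ))
        (q : Euc n), ContDiff ℝ ∞ g → 0 ≤ ε → SymBd ρ δ W k ε g →
        (∀ Y, ‖(coframe ρ δ Y).comp L‖ ≤ M * lam Y ^ (δ / 2)) →
        (∀ y, lam (X + L y) ≤ B * (1 + ‖q‖) ^ 2 * (1 + ‖y‖) ^ 2) →
        Integrable (fun y => g (X + L y) * v y) ∧
        (1 + ‖q‖) ^ D * ‖𝓕 (fun y => g (X + L y) * v y) q‖ ≤ ε * p v := by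
  obtain ⟨N, h⟩ := exists_norm_iteratedFDeriv_mul_schwartz_le hp hW M hM
  -- Integrating by parts k times gains ‖q‖^k and loses ‖q‖^(2N+kδ). Since δ < 1, this choice of k
  -- leaves ‖q‖^(-D).
  obtain ⟨k, hk⟩ := exists_nat_ge ((2 * N + D) / (1 - δ))
  have hδ := hp.nonneg
  have h1δ : 0 < 1 - δ := by linarith [hp.lt_one]
  rw [div_le_iff₀ h1δ] at hk
  obtain ⟨p, hpc, hb⟩ := h k
  set I := ∫ y : Euc n, ((1 + ‖y‖) ^ (n + 1))⁻¹ with hI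
  have hI0 : 0 ≤ I := integral_nonneg fun y => by positivity
  set e : ℝ := N + k * (δ / 2) with he
  have he0 : 0 ≤ e := by positivity
  set c : NNReal := ⟨2 ^ k * (2 ^ k * (2 * (k + 1) * (B ^ e * I))), by positivity⟩ with hc
  refine ⟨k, c • p, hpc.const_smul c, fun g ε X L v q hg hε hgb hL hlam => ?_⟩
  set h := fun y => g (X + L y) * v y with hh
  have hsm : ContDiff ℝ ∞ h := (hg.comp (contDiff_const.add L.contDiff)).mul (v.smooth ⊤)
  set A := B * (1 + ‖q‖) ^ 2 with hA
  have hq1 : 1 ≤ 1 + ‖q‖ := by linarith [norm_nonneg q]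
  have hA1 : 1 ≤ A := one_le_mul_of_one_le_of_one_le hB (one_le_pow₀ hq1)
  have hbd := hb g ε A X L v hg hε hgb hL hA1 hlam
  have hint : ∀ j ≤ k, Integrable (fun y => ‖iteratedFDeriv ℝ j h y‖) := fun j hj =>
    (integrable_one_add_norm_euc.const_mul (ε * (A ^ e * p v))).mono'
      (hsm.continuous_iteratedFDeriv (by exact_mod_cast le_top)).norm.aestronglyMeasurable
      (.of_forall fun y => by rw [norm_norm]; exact hbd j hj y)
  have hintle : ∀ j ≤ k, ∫ y, ‖iteratedFDeriv ℝ j h y‖ ≤ ε * (A ^ e * p v) * I := fun j hj => by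
    rw [hI, ← integral_const_mul]
    exact integral_mono (hint j hj) (integrable_one_add_norm_euc.const_mul _) (hbd j hj)
  have hpv : 0 ≤ p v := apply_nonneg _ _
  have hAe : 0 ≤ A ^ e := Real.rpow_nonneg (by linarith) _
  have hmain : ∀ l ≤ k, ‖q‖ ^ l * ‖𝓕 h q‖ ≤ 2 ^ k * ((k + 1) * (ε * (A ^ e * p v) * I)) := by
    intro l hl
    have := Real.pow_mul_norm_iteratedFDeriv_fourier_le (f := h) (K := 0) (N := k)
      (hsm.of_le (by exact_mod_cast le_top)) (fun i j hi hj => by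
        obtain rfl : i = 0 := by simpa using hi
        simpa using hint j (by exact_mod_cast hj)) (k := 0) (n := l) le_rfl
        (by exact_mod_cast hl) q
    simp only [norm_iteratedFDeriv_zero, pow_zero, one_mul, zero_add, Finset.range_one,
      Finset.sum_product, Finset.sum_singleton, CharP.cast_eq_zero, mul_zero] at this
    refine this.trans ?_
    have hs : ∑ j ∈ Finset.range (l + 1), ∫ y, ‖iteratedFDeriv ℝ j h y‖ ≤
        (l + 1 : ℕ) * (ε * (A ^ e * p v) * I) := by
      have h0 := Finset.sum_le_card_nsmul (Finset.range (l + 1))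
        (fun j => ∫ y, ‖iteratedFDeriv ℝ j h y‖) _ fun j hj =>
          hintle j (by have : j < l + 1 := by simpa using hj
                       omega)
      rwa [Finset.card_range, nsmul_eq_mul] at h0
    push_cast at hs
    have hlk : (l : ℝ) ≤ k := by exact_mod_cast hl
    calc _ ≤ (2 : ℝ) ^ l * ((l + 1) * (ε * (A ^ e * p v) * I)) := by gcongr
      _ ≤ (2 : ℝ) ^ k * ((l + 1) * (ε * (A ^ e * p v) * I)) := by gcongr; norm_num
      _ ≤ _ := by gcongr
  refine ⟨?_, ?_⟩
  · have := hint 0 (Nat.zero_le _)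
    simp only [norm_iteratedFDeriv_zero] at this
    exact (integrable_norm_iff hsm.continuous.aestronglyMeasurable).1 this
  · have h1 : (1 + ‖q‖) ^ k * ‖𝓕 h q‖ ≤
        2 ^ k * (2 * (2 ^ k * ((k + 1) * (ε * (A ^ e * p v) * I)))) := by
      have : (1 + ‖q‖) ^ k ≤ 2 ^ k * (‖q‖ ^ 0 + ‖q‖ ^ k) := by
        rcases le_total ‖q‖ 1 with h | h
        · calc (1 + ‖q‖) ^ k ≤ 2 ^ k := by gcongr; linarith
            _ ≤ _ := le_mul_of_one_le_right (by positivity) (by simp)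
        · calc (1 + ‖q‖) ^ k ≤ (2 * ‖q‖) ^ k := by gcongr; linarith
            _ = 2 ^ k * ‖q‖ ^ k := mul_pow _ _ _
            _ ≤ _ := by gcongr; simp
      calc _ ≤ 2 ^ k * (‖q‖ ^ 0 + ‖q‖ ^ k) * ‖𝓕 h q‖ := by gcongr
        _ = 2 ^ k * (‖q‖ ^ 0 * ‖𝓕 h q‖ + ‖q‖ ^ k * ‖𝓕 h q‖) := by ring
        _ ≤ 2 ^ k * (2 ^ k * ((k + 1) * (ε * (A ^ e * p v) * I)) +
            2 ^ k * ((k + 1) * (ε * (A ^ e * p v) * I))) :=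
            mul_le_mul_of_nonneg_left (add_le_add (hmain 0 (Nat.zero_le _)) (hmain k le_rfl))
              (by positivity)
        _ = _ := by ring
    have h2 : A ^ e = B ^ e * (1 + ‖q‖) ^ (2 * N + k * δ) := by
      rw [hA, Real.mul_rpow (by linarith) (by positivity), ← Real.rpow_natCast (1 + ‖q‖) 2,
        ← Real.rpow_mul (by linarith)]
      congr 2
      rw [he]; push_cast; ring
    have h3 : (1 + ‖q‖) ^ D * (1 + ‖q‖) ^ (2 * N + k * δ) ≤ (1 + ‖q‖) ^ k := by
      rw [← Real.rpow_natCast, ← Real.rpow_natCast, ← Real.rpow_add (by linarith)]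
      apply Real.rpow_le_rpow_of_exponent_le hq1
      linarith
    have hpos : 0 < (1 + ‖q‖) ^ (2 * N + k * δ) := Real.rpow_pos_of_pos (by linarith) _
    refine le_of_mul_le_mul_right ?_ hpos
    calc (1 + ‖q‖) ^ D * ‖𝓕 h q‖ * (1 + ‖q‖) ^ (2 * N + k * δ)
        = (1 + ‖q‖) ^ D * (1 + ‖q‖) ^ (2 * N + k * δ) * ‖𝓕 h q‖ := by ring
      _ ≤ (1 + ‖q‖) ^ k * ‖𝓕 h q‖ := by gcongr
      _ ≤ _ := h1
      _ = ε * (2 ^ k * (2 ^ k * (2 * (k + 1) * (B ^ e * I))) * p v) *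
          (1 + ‖q‖) ^ (2 * N + k * δ) := by rw [h2]; ring
      _ = _ := rfl

end FourierDecay
-- Convergence of the iterated integral and its continuity in the symbol.
section InnerIntegral

variable {n : ℕ} {ρ δ : ℝ}

theorem tauIntegrand_eq (τ : ℝ) (g : Phase n → ℂ) (u : Euc n → ℂ) (x ξ y : Euc n) :
    tauIntegrand τ g u x ξ y = Complex.exp (Complex.I * (inner ℝ x ξ : ℝ)) *
      (Complex.exp ((-2 * Real.pi * inner ℝ y ((2 * Real.pi)⁻¹ • ξ) : ℝ) * Complex.I) •
        (g (((1 - τ) • x, ξ) + (τ • ContinuousLinearMap.inl ℝ (Euc n) (Euc n)) y) * u y)) := by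
  have h1 : -2 * Real.pi * inner ℝ y ((2 * Real.pi)⁻¹ • ξ) = -inner ℝ y ξ := by
    rw [inner_smul_right]
    field_simp
  have h2 : (((1 - τ) • x, ξ) : Phase n) + (τ • ContinuousLinearMap.inl ℝ (Euc n) (Euc n)) y =
      ((1 - τ) • x + τ • y, ξ) := by simp
  rw [h1, h2, smul_eq_mul, ← mul_assoc, ← Complex.exp_add, tauIntegrand, inner_sub_left, mul_assoc]
  congr 2
  push_cast; ring

theorem integral_tauIntegrand (τ : ℝ) (g : Phase n → ℂ) (u : Euc n → ℂ) (x ξ : Euc n) :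
    ∫ y, tauIntegrand τ g u x ξ y = Complex.exp (Complex.I * (inner ℝ x ξ : ℝ)) *
      𝓕 (fun y => g (((1 - τ) • x, ξ) + (τ • ContinuousLinearMap.inl ℝ (Euc n) (Euc n)) y) * u y)
        ((2 * Real.pi)⁻¹ • ξ) := by
  simp_rw [tauIntegrand_eq]
  rw [integral_const_mul, Real.fourier_eq']

theorem norm_exp_I_mul (r : ℝ) : ‖Complex.exp (Complex.I * r)‖ = 1 := by
  rw [mul_comm]; exact Complex.norm_exp_ofReal_mul_I r

theorem norm_coframe_comp_smul_inl_le (τ : ℝ) (Y : Phase n) :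
    ‖(coframe ρ δ Y).comp (τ • ContinuousLinearMap.inl ℝ (Euc n) (Euc n))‖ ≤
      (1 + |τ|) * lam Y ^ (δ / 2) := by
  have hl := (lam_rpow_pos Y (δ / 2)).le
  refine ContinuousLinearMap.opNorm_le_bound _ (by positivity) fun y => ?_
  simp only [ContinuousLinearMap.comp_apply, coframe, dil_apply, smul_apply,
    ContinuousLinearMap.inl_apply, Prod.smul_fst, Prod.smul_snd, smul_zero, Prod.norm_mk, norm_zero,
    norm_smul, Real.norm_eq_abs, abs_of_pos (lam_rpow_pos Y (δ / 2))]
  rw [max_eq_left (by positivity)]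
  nlinarith [mul_nonneg hl (norm_nonneg y)]

theorem lam_add_smul_inl_le (τ : ℝ) (x q y : Euc n) :
    lam ((((1 - τ) • x, (2 * Real.pi) • q) : Phase n) +
        (τ • ContinuousLinearMap.inl ℝ (Euc n) (Euc n)) y) ≤
      2 * (1 + ‖(1 - τ) • x‖ + 2 * Real.pi + |τ|) ^ 2 * (1 + ‖q‖) ^ 2 * (1 + ‖y‖) ^ 2 := by
  refine (lam_le_sq _).trans ?_
  rw [mul_assoc, mul_assoc, ← mul_pow, ← mul_pow]
  gcongr
  have h : ‖(((1 - τ) • x, (2 * Real.pi) • q) : Phase n) +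
        (τ • ContinuousLinearMap.inl ℝ (Euc n) (Euc n)) y‖ ≤
      ‖(1 - τ) • x‖ + |τ| * ‖y‖ + 2 * Real.pi * ‖q‖ := by
    rw [Prod.norm_def]
    simp only [Prod.fst_add, Prod.snd_add, smul_apply, ContinuousLinearMap.inl_apply,
      Prod.smul_fst, Prod.smul_snd, smul_zero, add_zero]
    refine max_le ?_ ?_
    · refine (norm_add_le _ _).trans ?_
      rw [norm_smul τ, Real.norm_eq_abs]
      have : 0 ≤ 2 * Real.pi * ‖q‖ := by positivity
      linarith
    · rw [norm_smul, Real.norm_eq_abs, abs_of_pos (by positivity)]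
      have : 0 ≤ ‖(1 - τ) • x‖ + |τ| * ‖y‖ := by positivity
      linarith
  refine (add_le_add_right h 1).trans ?_
  have h1 := norm_nonneg ((1 - τ) • x)
  generalize ‖(1 - τ) • x‖ = A at *
  have h2 := norm_nonneg q
  have h3 := norm_nonneg y
  have h4 := abs_nonneg τ
  have h5 := Real.pi_pos
  have e : (1 + A + 2 * Real.pi + |τ|) * ((1 + ‖q‖) * (1 + ‖y‖)) =
    (1 + (A + |τ| * ‖y‖ + 2 * Real.pi * ‖q‖)) + ((1 + A) * (‖q‖ + ‖y‖ + ‖q‖ * ‖y‖) +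
      2 * Real.pi * (1 + ‖y‖ + ‖q‖ * ‖y‖) + |τ| * (1 + ‖q‖ + ‖q‖ * ‖y‖)) := by ring
  rw [e]
  have : 0 ≤ (1 + A) * (‖q‖ + ‖y‖ + ‖q‖ * ‖y‖) +
      2 * Real.pi * (1 + ‖y‖ + ‖q‖ * ‖y‖) + |τ| * (1 + ‖q‖ + ‖q‖ * ‖y‖) := by positivity
  linarith

/-- The inner integral is a Fourier transform at the frequency q = ξ/2π, while the symbol is
evaluated along a line of base point ((1-τ)x, ξ). Base point and frequency grow together, which is
the situation covered by `exists_fourier_decay`. -/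
theorem exists_integral_tauIntegrand_bound (hp : Admissible ρ δ) {W : Phase n → ℝ} (hW : TW ρ δ W)
    (τ : ℝ) (x : Euc n) : ∃ k : ℕ, ∀ u : 𝓢(Euc n, ℂ), ∃ C : ℝ, 0 ≤ C ∧ ∀ (g : Phase n → ℂ) (ε : ℝ),
      ContDiff ℝ ∞ g → 0 ≤ ε → SymBd ρ δ W k ε g → ∀ ξ,
        Integrable (fun y => tauIntegrand τ g u x ξ y) ∧
        ‖∫ y, tauIntegrand τ g u x ξ y‖ ≤ ε * C * ((1 + ‖ξ‖) ^ (n + 1))⁻¹ := by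
  have hπ := Real.pi_pos
  have hπ3 := Real.pi_gt_three
  obtain ⟨k, p, -, h⟩ := exists_fourier_decay hp hW (1 + |τ|)
    (2 * (1 + ‖(1 - τ) • x‖ + 2 * Real.pi + |τ|) ^ 2) (by linarith [abs_nonneg τ])
    (by nlinarith [norm_nonneg ((1 - τ) • x), abs_nonneg τ]) (n + 1)
  refine ⟨k, fun u => ⟨(2 * Real.pi) ^ (n + 1) * p u,
    mul_nonneg (by positivity) (apply_nonneg _ _), fun g ε hg hε hgb ξ => ?_⟩⟩
  obtain ⟨h1, h2⟩ := h g ε ((1 - τ) • x, ξ) (τ • ContinuousLinearMap.inl ℝ (Euc n) (Euc n)) u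
    ((2 * Real.pi)⁻¹ • ξ) hg hε hgb (norm_coframe_comp_smul_inl_le τ) fun y => by
      have := lam_add_smul_inl_le τ x ((2 * Real.pi)⁻¹ • ξ) y
      rwa [smul_smul, mul_inv_cancel₀ (by positivity), one_smul] at this
  refine ⟨?_, ?_⟩
  · simp_rw [tauIntegrand_eq]
    refine Integrable.const_mul ?_ _
    refine h1.norm.mono' (Continuous.aestronglyMeasurable ?_) (.of_forall fun y => ?_)
    · have := hg.continuous
      have := u.continuous
      fun_prop
    · rw [norm_smul, Complex.norm_exp_ofReal_mul_I, one_mul]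
  · rw [integral_tauIntegrand, norm_mul, norm_exp_I_mul, one_mul, ← div_eq_mul_inv,
      le_div_iff₀ (by positivity), mul_comm]
    have h3 : 1 + ‖ξ‖ ≤ 2 * Real.pi * (1 + ‖(2 * Real.pi)⁻¹ • ξ‖) := by
      rw [norm_smul, norm_inv, Real.norm_eq_abs, abs_of_pos (by positivity), mul_add,
        mul_inv_cancel_left₀ (by positivity)]
      linarith
    calc _ ≤ (2 * Real.pi * (1 + ‖(2 * Real.pi)⁻¹ • ξ‖)) ^ (n + 1) * _ :=
          mul_le_mul_of_nonneg_right (by gcongr) (norm_nonneg _)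
      _ = (2 * Real.pi) ^ (n + 1) * ((1 + ‖(2 * Real.pi)⁻¹ • ξ‖) ^ (n + 1) * _) := by
          rw [mul_pow, mul_assoc]
      _ ≤ (2 * Real.pi) ^ (n + 1) * (ε * p u) := by gcongr
      _ = _ := by ring

theorem continuous_tauIntegrand (τ : ℝ) {g : Phase n → ℂ} (hg : Continuous g) {u : Euc n → ℂ}
    (hu : Continuous u) (x : Euc n) :
    Continuous (fun p : Euc n × Euc n => tauIntegrand τ g u x p.1 p.2) := by
  unfold tauIntegrand; fun_prop

theorem aestronglyMeasurable_integral_tauIntegrand (τ : ℝ) {g : Phase n → ℂ} (hg : Continuous g)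
    {u : Euc n → ℂ} (hu : Continuous u) (x : Euc n) :
    AEStronglyMeasurable (fun ξ => ∫ y, tauIntegrand τ g u x ξ y) :=
  (continuous_tauIntegrand τ hg hu x).stronglyMeasurable.integral_prod_right'.aestronglyMeasurable

/-- The iterated integral `(2π)ⁿ Op^τ(g)u(x)`. -/
def tauInt (τ : ℝ) (g : Phase n → ℂ) (u : Euc n → ℂ) (x : Euc n) : ℂ :=
  ∫ ξ, ∫ y, tauIntegrand τ g u x ξ y

/-- The bound is linear in ε, so that it also serves for differences of symbols and yields
continuity of `tauInt` under `SymConv`. -/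
theorem integrable_tauIntegrand_of_symBd (hp : Admissible ρ δ) {W : Phase n → ℝ} (hW : TW ρ δ W)
    (τ : ℝ) (x : Euc n) : ∃ k : ℕ, ∀ u : 𝓢(Euc n, ℂ), ∃ C : ℝ, 0 ≤ C ∧ ∀ (g : Phase n → ℂ) (ε : ℝ),
      ContDiff ℝ ∞ g → 0 ≤ ε → SymBd ρ δ W k ε g →
        (∀ ξ, Integrable (fun y => tauIntegrand τ g u x ξ y)) ∧
        Integrable (fun ξ => ∫ y, tauIntegrand τ g u x ξ y) ∧ ‖tauInt τ g u x‖ ≤ ε * C := by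
  obtain ⟨k, h⟩ := exists_integral_tauIntegrand_bound hp hW τ x
  refine ⟨k, fun u => ?_⟩
  obtain ⟨C, hC, h⟩ := h u
  refine ⟨C * ∫ ξ : Euc n, ((1 + ‖ξ‖) ^ (n + 1))⁻¹,
    mul_nonneg hC (integral_nonneg fun y => by positivity), fun g ε hg hε hb => ?_⟩
  have h := h g ε hg hε hb
  refine ⟨fun ξ => (h ξ).1, (integrable_one_add_norm_euc.const_mul (ε * C)).mono'
    (aestronglyMeasurable_integral_tauIntegrand τ hg.continuous u.continuous x)
    (.of_forall fun ξ => (h ξ).2), ?_⟩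
  refine (norm_integral_le_of_norm_le (integrable_one_add_norm_euc.const_mul (ε * C))
    (.of_forall fun ξ => (h ξ).2)).trans ?_
  rw [integral_const_mul, mul_assoc]

theorem IsSym.integrable_tauIntegrand (hp : Admissible ρ δ) {W : Phase n → ℝ} (hW : TW ρ δ W)
    {a : Phase n → ℂ} (ha : IsSym ρ δ W a) (τ : ℝ) (u : 𝓢(Euc n, ℂ)) (x : Euc n) :
    (∀ ξ, Integrable (fun y => tauIntegrand τ a u x ξ y)) ∧
      Integrable (fun ξ => ∫ y, tauIntegrand τ a u x ξ y) := by
  obtain ⟨k, h⟩ := integrable_tauIntegrand_of_symBd hp hW τ x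
  obtain ⟨C, -, h⟩ := h u
  obtain ⟨B, hB, hb⟩ := ha.bound k
  exact ⟨(h a B ha.contDiff hB hb).1, (h a B ha.contDiff hB hb).2.1⟩

theorem tauIntegrand_sub (τ : ℝ) (f g : Phase n → ℂ) (u : Euc n → ℂ) (x ξ y : Euc n) :
    tauIntegrand τ (fun X => f X - g X) u x ξ y =
      tauIntegrand τ f u x ξ y - tauIntegrand τ g u x ξ y := by
  unfold tauIntegrand; ring

theorem SymConv.tendsto_tauInt (hp : Admissible ρ δ) {W : Phase n → ℝ} (hW : TW ρ δ W)
    {a : Phase n → ℂ} (ha : IsSym ρ δ W a) {f : ℕ → 𝓢(Phase n, ℂ)} (hf : SymConv ρ δ W (fun i => f i) a)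
    (τ : ℝ) (u : 𝓢(Euc n, ℂ)) (x : Euc n) :
    Filter.Tendsto (fun i => tauInt τ (f i) u x) Filter.atTop (nhds (tauInt τ a u x)) := by
  obtain ⟨k, h⟩ := integrable_tauIntegrand_of_symBd hp hW τ x
  obtain ⟨C, hC, h⟩ := h u
  obtain ⟨h1, h2⟩ := ha.integrable_tauIntegrand hp hW τ u x
  have key : ∀ ε > 0, ∀ i, SymBd ρ δ W k ε (fun X => f i X - a X) →
      ‖tauInt τ (f i) u x - tauInt τ a u x‖ ≤ ε * C := by
    intro ε hε i hb
    obtain ⟨h3, h4, h5⟩ := h _ ε (((f i).smooth ⊤).sub ha.contDiff) hε.le hb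
    have e1 : ∀ ξ, ∫ y, tauIntegrand τ (f i) u x ξ y =
        (∫ y, tauIntegrand τ (fun X => f i X - a X) u x ξ y) + ∫ y, tauIntegrand τ a u x ξ y := by
      intro ξ
      rw [← integral_add (h3 ξ) (h1 ξ)]
      simp_rw [tauIntegrand_sub, sub_add_cancel]
    have e2 : tauInt τ (f i) u x = tauInt τ (fun X => f i X - a X) u x + tauInt τ a u x := by
      unfold tauInt
      rw [← integral_add h4 h2]
      simp_rw [e1]
    rwa [e2, add_sub_cancel_right]
  rw [Metric.tendsto_atTop]
  intro ε hε
  have h6 : 0 < ε / (C + 1) := by positivity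
  obtain ⟨N, hN⟩ := Filter.eventually_atTop.1 (hf k _ h6)
  refine ⟨N, fun i hi => ?_⟩
  rw [dist_eq_norm]
  refine (key _ h6 i (hN i hi)).trans_lt ?_
  rw [div_mul_eq_mul_div, div_lt_iff₀ (by positivity)]
  nlinarith

end InnerIntegral
-- Change of quantization: kernels, and the relation `IsJ` for symbols.
section SchwartzChange

variable {n : ℕ} {ρ δ : ℝ}

theorem exists_norm_schwartz_le (f : 𝓢(Phase n, ℂ)) :
    ∃ C : ℝ, 0 ≤ C ∧ ∀ X, ‖f X‖ ≤ C * ((1 + ‖X‖) ^ (n + 1))⁻¹ := by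
  set m : ℕ × ℕ := (n + 1, 0)
  refine ⟨2 ^ m.1 * ((Finset.Iic m).sup fun m => SchwartzMap.seminorm ℂ m.1 m.2) f,
    mul_nonneg (by positivity) (apply_nonneg _ _), fun X => ?_⟩
  have := SchwartzMap.one_add_le_sup_seminorm_apply (𝕜 := ℂ) (m := m)
      (k := n + 1) (n := 0) le_rfl le_rfl f X
  rw [norm_iteratedFDeriv_zero] at this
  rw [← div_eq_mul_inv, le_div_iff₀ (by positivity), mul_comm]
  exact this

theorem exists_norm_schwartz_snd_le (f : 𝓢(Phase n, ℂ)) :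
    ∃ C : ℝ, 0 ≤ C ∧ ∀ X, ‖f X‖ ≤ C * ((1 + ‖X.2‖) ^ (n + 1))⁻¹ := by
  obtain ⟨C, hC, h⟩ := exists_norm_schwartz_le f
  refine ⟨C, hC, fun X => (h X).trans ?_⟩
  have := norm_snd_le X
  gcongr

theorem exists_norm_schwartz_fst_le (f : 𝓢(Phase n, ℂ)) :
    ∃ C : ℝ, 0 ≤ C ∧ ∀ X, ‖f X‖ ≤ C * ((1 + ‖X.1‖) ^ (n + 1))⁻¹ := by
  obtain ⟨C, hC, h⟩ := exists_norm_schwartz_le f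
  refine ⟨C, hC, fun X => (h X).trans ?_⟩
  have := norm_fst_le X
  gcongr

/-- The inverse Fourier transform in the first variable. -/
def fstIFT (G : 𝓢(Phase n, ℂ)) (z q : Euc n) : ℂ :=
  ∫ p, Complex.exp ((2 * Real.pi * inner ℝ z p : ℝ) * Complex.I) * G (p, q)

theorem continuous_fstIFT (G : 𝓢(Phase n, ℂ)) (z : Euc n) : Continuous (fstIFT G z) := by
  obtain ⟨C, hC, h⟩ := exists_norm_schwartz_fst_le G
  have hG := G.continuous
  refine continuous_of_dominated (bound := fun p => C * ((1 + ‖p‖) ^ (n + 1))⁻¹)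
    (fun q => Continuous.aestronglyMeasurable (by fun_prop)) (fun q => .of_forall fun p => ?_)
    (integrable_one_add_norm_euc.const_mul C) (.of_forall fun p => by fun_prop)
  rw [norm_mul, Complex.norm_exp_ofReal_mul_I, one_mul]
  exact h (p, q)

theorem integrable_exp_mul_schwartz (G : 𝓢(Phase n, ℂ)) (z ξ : Euc n) :
    Integrable (fun Ω : Phase n => pchar (z, ξ) Ω * G Ω) := by
  refine G.integrable.norm.mono' (Continuous.aestronglyMeasurable
    ((continuous_pchar_right _).mul G.continuous)) (.of_forall fun Ω => ?_)
  rw [norm_mul, norm_pchar, one_mul]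

theorem pchar_mk (z ξ p q : Euc n) : pchar ((z, ξ) : Phase n) (p, q) =
    Complex.exp ((2 * Real.pi * inner ℝ q ξ : ℝ) * Complex.I) *
      Complex.exp ((2 * Real.pi * inner ℝ z p : ℝ) * Complex.I) := by
  rw [pchar, ppair, ← Complex.exp_add, real_inner_comm q ξ]
  congr 1
  push_cast; ring

theorem integrable_fstIFT (G : 𝓢(Phase n, ℂ)) (z : Euc n) : Integrable (fstIFT G z) := by
  have h := integrable_exp_mul_schwartz G z 0
  rw [Measure.volume_eq_prod] at h
  have := h.integral_prod_right
  refine this.congr (.of_forall fun q => ?_)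
  simp [fstIFT, pchar_mk]

theorem fourierInv_fstIFT (G : 𝓢(Phase n, ℂ)) (z ξ : Euc n) :
    𝓕⁻ (fstIFT G z) ξ = phaseIFT n G (z, ξ) := by
  have h := integrable_exp_mul_schwartz G z ξ
  rw [phaseIFT_apply, Measure.volume_eq_prod, integral_prod_symm _ h, Real.fourierInv_eq']
  congr 1 with q
  rw [fstIFT, smul_eq_mul, ← integral_const_mul]
  congr 1 with p
  simp only [pchar_mk, mul_assoc]

theorem integrable_slice (f : 𝓢(Phase n, ℂ)) (z : Euc n) : Integrable (fun ξ => f (z, ξ)) := by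
  obtain ⟨C, hC, h⟩ := exists_norm_schwartz_snd_le f
  have hf := f.continuous
  exact (integrable_one_add_norm_euc.const_mul C).mono'
    (Continuous.aestronglyMeasurable (by fun_prop)) (.of_forall fun ξ => h (z, ξ))

/-- The Fourier transform in the second variable, with the sign and the normalization of the
kernel of a pseudodifferential operator. -/
def sndFT (f : Phase n → ℂ) (z w : Euc n) : ℂ :=
  ∫ ξ, Complex.exp (Complex.I * (inner ℝ w ξ : ℝ)) * f (z, ξ)

/-- Inverting the full transform in the first variable only leaves the transform in the second; the
slice is recovered by Fourier inversion. -/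
theorem sndFT_eq (f : 𝓢(Phase n, ℂ)) (z w : Euc n) :
    sndFT f z w = fstIFT (phaseFT n f) z (-((2 * Real.pi)⁻¹ • w)) := by
  have h1 : 𝓕⁻ (fstIFT (phaseFT n f) z) = fun ξ => f (z, ξ) := by
    ext ξ
    rw [fourierInv_fstIFT, phaseIFT_phaseFT]
  have h2 : Integrable (𝓕 (fstIFT (phaseFT n f) z)) := by
    have : 𝓕 (fstIFT (phaseFT n f) z) = fun ξ => 𝓕⁻ (fstIFT (phaseFT n f) z) (-ξ) := by
      ext ξ
      rw [Real.fourierInv_eq_fourier_neg, neg_neg]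
    rw [this, h1]
    exact (integrable_slice f z).comp_neg
  rw [← (continuous_fstIFT (phaseFT n f) z).fourier_fourierInv_eq (integrable_fstIFT _ z) h2, h1,
    Real.fourier_eq', sndFT]
  congr 1 with ξ
  rw [smul_eq_mul]
  congr 2
  rw [inner_neg_right, inner_smul_right, real_inner_comm w ξ]
  have := Real.pi_ne_zero
  rw [show -2 * Real.pi * -((2 * Real.pi)⁻¹ * inner ℝ w ξ) = inner ℝ w ξ by field_simp, mul_comm]

theorem phaseFT_J (s : ℝ) (f : 𝓢(Phase n, ℂ)) (Ω : Phase n) :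
    phaseFT n (J s f) Ω = jmult s Ω * phaseFT n f Ω := by
  rw [J_eq, phaseFT_phaseIFT, smulLeftCLM_apply_apply (jmult_temperate s), smul_eq_mul]

/-- At q = -w/2π the multiplier equals exp(2πi s⟨w,p⟩), that is, translation by s w in the first
variable. -/
theorem sndFT_J (s : ℝ) (f : 𝓢(Phase n, ℂ)) (z w : Euc n) :
    sndFT (J s f) z w = sndFT f (z + s • w) w := by
  rw [sndFT_eq, sndFT_eq, fstIFT, fstIFT]
  congr 1 with p
  rw [phaseFT_J, ← mul_assoc, jmult, ← Complex.exp_add]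
  congr 2
  rw [← add_mul, ← Complex.ofReal_add]
  congr 2
  have := Real.pi_ne_zero
  simp only [inner_neg_right, inner_smul_right, inner_add_left, inner_smul_left, real_inner_comm w p]
  simp only [conj_trivial]
  field_simp
  ring

/-- Schwartz decay permits Fubini's theorem. The base point (1-τ)x + τy is written as x plus a
multiple of x - y, in order to match the translation in `sndFT_J`. -/
theorem tauInt_schwartz (τ : ℝ) (f : 𝓢(Phase n, ℂ)) (u : 𝓢(Euc n, ℂ)) (x : Euc n) :
    tauInt τ f u x = ∫ y, sndFT f (x + (-τ) • (x - y)) (x - y) * u y := by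
  obtain ⟨C, hC, h⟩ := exists_norm_schwartz_snd_le f
  have hint : Integrable (Function.uncurry fun ξ y => tauIntegrand τ f u x ξ y)
      ((volume : Measure (Euc n)).prod (volume : Measure (Euc n))) := by
    refine Integrable.mono' (g := fun p : Euc n × Euc n =>
      (C * ((1 + ‖p.1‖) ^ (n + 1))⁻¹) * ‖u p.2‖)
      ((integrable_one_add_norm_euc.const_mul C).mul_prod u.integrable.norm)
      (continuous_tauIntegrand τ f.continuous u.continuous x).aestronglyMeasurable
      (.of_forall fun p => ?_)
    simp only [Function.uncurry, tauIntegrand, norm_mul, norm_exp_I_mul, one_mul]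
    gcongr
    exact h _
  rw [tauInt, integral_integral_swap hint]
  congr 1 with y
  rw [sndFT, ← integral_mul_const]
  congr 1 with ξ
  rw [tauIntegrand]
  congr 4
  rw [sub_smul, one_smul, neg_smul, smul_sub]
  abel

/-- Passing from the `τ`-quantization to the standard one. -/
theorem tauInt_J (τ : ℝ) (f : 𝓢(Phase n, ℂ)) (u : 𝓢(Euc n, ℂ)) (x : Euc n) :
    tauInt 0 (J (-τ) f) u x = tauInt τ f u x := by
  simp_rw [tauInt_schwartz, sndFT_J, neg_zero, zero_smul, add_zero]

/-- `b` is the symbol `e^{it⟨∂_x, ∂_ξ⟩} a`. -/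
def IsJ (ρ δ : ℝ) (w : Phase n → ℝ) (t : ℝ) (a b : Phase n → ℂ) : Prop :=
  ∀ f : ℕ → 𝓢(Phase n, ℂ), SymConv ρ δ (fun X => w X * lam X) (fun i => f i) a →
    SymConv ρ δ (fun X => w X * lam X) (fun i => J t (f i)) b

theorem IsSym.exists_isJ (hp : Admissible ρ δ) {w : Phase n → ℝ} (hw : TW ρ δ w)
    {a : Phase n → ℂ} (ha : IsSym ρ δ w a) (t : ℝ) :
    ∃ b, IsSym ρ δ w b ∧ IsJ ρ δ w t a b := by
  obtain ⟨b, hb, h⟩ := ha.exists_jrem hp hw 0 t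
  refine ⟨b, by simpa using hb, fun f hf => ?_⟩
  have := h f hf
  simpa only [jrem_zero] using this

theorem TW.mul_lam (hp : Admissible ρ δ) {w : Phase n → ℝ} (hw : TW ρ δ w) :
    TW ρ δ (fun X => w X * lam X) := by
  have hlam : TW ρ δ (fun X : Phase n => lam X) := by
    simpa using TW.lam_rpow (n := n) hp 1
  exact hw.mul hlam

theorem IsSym.mul_lam {w : Phase n → ℝ} (hw : TW ρ δ w)
    {a : Phase n → ℂ} (ha : IsSym ρ δ w a) : IsSym ρ δ (fun X => w X * lam X) a := by
  refine ⟨ha.contDiff, fun k => ?_⟩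
  obtain ⟨C, hC, h⟩ := ha.bound k
  exact ⟨C, hC, h.mono le_rfl fun X => mul_le_mul_of_nonneg_left
    (le_mul_of_one_le_right (hw.pos X).le (one_le_lam X)) hC⟩

/-- The identity `tauInt_J` holds along the truncations, and both sides are continuous for the class
of weight w λ in which these converge. -/
theorem IsJ.tauInt_eq (hp : Admissible ρ δ) {w : Phase n → ℝ} (hw : TW ρ δ w)
    {a c : Phase n → ℂ} (ha : IsSym ρ δ w a) (hc : IsSym ρ δ w c) {τ : ℝ} (h : IsJ ρ δ w (-τ) a c)
    (u : 𝓢(Euc n, ℂ)) (x : Euc n) : tauInt 0 c u x = tauInt τ a u x := by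
  have hW := hw.mul_lam hp
  have ht := ha.symConv_trunc hp fun X => (hw.pos X).le
  have h1 := ht.tendsto_tauInt hp hW (ha.mul_lam hw) τ u x
  have h2 := (h _ ht).tendsto_tauInt hp hW (hc.mul_lam hw) 0 u x
  simp_rw [tauInt_J] at h2
  exact tendsto_nhds_unique h2 h1

/-- For symbols the absolute convergence demanded by `IsOpTau` is automatic, so only the formula has
to be checked. -/
theorem IsSym.isOpTau_iff (hp : Admissible ρ δ) {w : Phase n → ℝ} (hw : TW ρ δ w)
    {a : Phase n → ℂ} (ha : IsSym ρ δ w a) {τ : ℝ} {A : 𝓢(Euc n, ℂ) →L[ℂ] 𝓢(Euc n, ℂ)} :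
    IsOpTau τ a A ↔ ∀ u x, A u x = ((2 * Real.pi : ℝ) : ℂ)⁻¹ ^ n * tauInt τ a u x := by
  refine ⟨fun h u x => (h u x).2.2, fun h u x => ?_⟩
  obtain ⟨h1, h2⟩ := ha.integrable_tauIntegrand hp hw τ u x
  exact ⟨h1, h2, h u x⟩

theorem IsJ.isOpTau_iff (hp : Admissible ρ δ) {w : Phase n → ℝ} (hw : TW ρ δ w)
    {a c : Phase n → ℂ} (ha : IsSym ρ δ w a) (hc : IsSym ρ δ w c) {τ : ℝ} (h : IsJ ρ δ w (-τ) a c)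
    {A : 𝓢(Euc n, ℂ) →L[ℂ] 𝓢(Euc n, ℂ)} : IsOpTau τ a A ↔ IsOpTau 0 c A := by
  rw [ha.isOpTau_iff hp hw, hc.isOpTau_iff hp hw]
  simp_rw [h.tauInt_eq hp hw ha hc]

end SchwartzChange
-- The quantization τ = 0 as a continuous operator on Schwartz space.
section StandardQuantization

variable {n : ℕ} {ρ δ : ℝ}

/-- The integrand of the standard quantization. -/
def stdInt (c : Phase n → ℂ) (v : Euc n → ℂ) (x η : Euc n) : ℂ :=
  Complex.exp ((2 * Real.pi * inner ℝ x η : ℝ) * Complex.I) * (c (x, (2 * Real.pi) • η) * v η)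

/-- The standard quantization applied to the inverse Fourier transform of `v`. -/
def stdQuant (c : Phase n → ℂ) (v : Euc n → ℂ) (x : Euc n) : ℂ := ∫ η, stdInt c v x η

theorem norm_stdInt (c : Phase n → ℂ) (v : Euc n → ℂ) (x η : Euc n) :
    ‖stdInt c v x η‖ = ‖c (x, (2 * Real.pi) • η)‖ * ‖v η‖ := by
  rw [stdInt, norm_mul, Complex.norm_exp_ofReal_mul_I, one_mul, norm_mul]

theorem continuous_stdInt {c : Phase n → ℂ} (hc : Continuous c) {v : Euc n → ℂ} (hv : Continuous v)
    (x : Euc n) : Continuous (stdInt c v x) := by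
  unfold stdInt; fun_prop

theorem exists_stdInt_bound {W : Phase n → ℝ} (hW : TW ρ δ W) {c : Phase n → ℂ}
    (hc : IsSym ρ δ W c) (v : 𝓢(Euc n, ℂ)) (x₀ : Euc n) :
    ∃ bd : Euc n → ℝ, Integrable bd ∧ ∀ x ∈ Metric.ball x₀ 1, ∀ η, ‖stdInt c v x η‖ ≤ bd η := by
  obtain ⟨C, hC, hb⟩ := hc.bound 0
  obtain ⟨Cw, hCw, N, hw⟩ := hW.exists_le_lam_pow
  set A : ℝ := 1 + (‖x₀‖ + 1) ^ 2 + (2 * Real.pi) ^ 2 with hA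
  set m : ℕ × ℕ := (2 * N + (n + 1), 0)
  set q := 2 ^ m.1 * ((Finset.Iic m).sup fun m => SchwartzMap.seminorm ℂ m.1 m.2) v with hq
  refine ⟨fun η => C * (Cw * A ^ N) * q * ((1 + ‖η‖) ^ (n + 1))⁻¹,
    integrable_one_add_norm_euc.const_mul _, fun x hx η => ?_⟩
  have h1 := SchwartzMap.one_add_le_sup_seminorm_apply (𝕜 := ℂ) (m := m)
      (k := m.1) (n := 0) le_rfl le_rfl v η
  rw [norm_iteratedFDeriv_zero, ← hq] at h1
  have hx' : ‖x‖ ≤ ‖x₀‖ + 1 := by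
    have : ‖x - x₀‖ < 1 := by rwa [← dist_eq_norm]
    linarith [norm_le_norm_add_norm_sub' x x₀]
  have h2 : lam (x, (2 * Real.pi) • η) ≤ A * (1 + ‖η‖) ^ 2 := by
    have h3 : ‖(2 * Real.pi) • η‖ = 2 * Real.pi * ‖η‖ := by
      rw [norm_smul, Real.norm_eq_abs, abs_of_pos (by positivity)]
    have h4 : ‖x‖ ^ 2 ≤ (‖x₀‖ + 1) ^ 2 := by gcongr
    have h5 := norm_nonneg η
    have h6 : 1 ≤ (1 + ‖η‖) ^ 2 := one_le_pow₀ (by linarith)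
    have h7 : ‖η‖ ^ 2 ≤ (1 + ‖η‖) ^ 2 := by gcongr; linarith
    calc lam (x, (2 * Real.pi) • η) = 1 + ‖x‖ ^ 2 + (2 * Real.pi) ^ 2 * ‖η‖ ^ 2 := by
          rw [lam, h3, mul_pow]
      _ ≤ (1 + (‖x₀‖ + 1) ^ 2) * (1 + ‖η‖) ^ 2 + (2 * Real.pi) ^ 2 * (1 + ‖η‖) ^ 2 := by
          refine add_le_add ?_ (by gcongr)
          exact (add_le_add_right h4 1).trans (le_mul_of_one_le_right (by positivity) h6)
      _ = _ := by rw [hA]; ring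
  rw [norm_stdInt]
  have hl := lam_pos (x, (2 * Real.pi) • η)
  calc _ ≤ C * (Cw * (A * (1 + ‖η‖) ^ 2) ^ N) * ‖v η‖ := by
        refine mul_le_mul_of_nonneg_right ((hb.norm_le _).trans ?_) (norm_nonneg _)
        refine mul_le_mul_of_nonneg_left ((hw _).trans ?_) hC
        gcongr
    _ = C * (Cw * A ^ N) * ((1 + ‖η‖) ^ (2 * N) * ‖v η‖) := by rw [mul_pow, ← pow_mul]; ring
    _ ≤ C * (Cw * A ^ N) * (q * ((1 + ‖η‖) ^ (n + 1))⁻¹) := by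
        refine mul_le_mul_of_nonneg_left ?_ (by positivity)
        rw [← div_eq_mul_inv, le_div_iff₀ (by positivity)]
        refine le_trans (le_of_eq ?_) h1
        rw [pow_add]; ring
    _ = _ := by ring

theorem integrable_stdInt {W : Phase n → ℝ} (hW : TW ρ δ W) {c : Phase n → ℂ}
    (hc : IsSym ρ δ W c) (v : 𝓢(Euc n, ℂ)) (x : Euc n) : Integrable (stdInt c v x) := by
  obtain ⟨bd, hbd, h⟩ := exists_stdInt_bound hW hc v x
  exact hbd.mono' (continuous_stdInt hc.contDiff.continuous v.continuous x).aestronglyMeasurable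
    (.of_forall (h x (Metric.mem_ball_self one_pos)))

theorem stdQuant_eq_fourier (c : Phase n → ℂ) (v : Euc n → ℂ) (x : Euc n) : stdQuant c v x =
    𝓕 (fun η => c ((x, 0) + ((2 * Real.pi) • ContinuousLinearMap.inr ℝ (Euc n) (Euc n)) η) * v η)
      (-x) := by
  rw [Real.fourier_eq', stdQuant]
  congr 1 with η
  have e : -2 * Real.pi * -inner ℝ x η = 2 * Real.pi * inner ℝ x η := by ring
  rw [stdInt, smul_eq_mul, inner_neg_right, real_inner_comm x η, e]
  simp

/-- Here -x plays the role of the frequency and the integration runs over η. A derivative in ξ costs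
at most a constant, since its g-length λ^(-ρ/2) is at most one. -/
theorem exists_stdQuant_decay (hp : Admissible ρ δ) {W : Phase n → ℝ} (hW : TW ρ δ W)
    {c : Phase n → ℂ} (hc : IsSym ρ δ W c) (D : ℕ) :
    ∃ p : Seminorm ℂ 𝓢(Euc n, ℂ), Continuous p ∧
      ∀ (v : 𝓢(Euc n, ℂ)) (x), (1 + ‖x‖) ^ D * ‖stdQuant c v x‖ ≤ p v := by
  have hπ := Real.pi_pos
  obtain ⟨k, p, hpc, h⟩ := exists_fourier_decay hp hW (1 + 2 * Real.pi)
    (2 * (1 + 2 * Real.pi) ^ 2) (by linarith) (by nlinarith) D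
  obtain ⟨C, hC, hb⟩ := hc.bound k
  set C' : NNReal := ⟨C, hC⟩
  refine ⟨C' • p, hpc.const_smul C', fun v x => ?_⟩
  rw [stdQuant_eq_fourier, ← norm_neg x]
  refine (h c C (x, 0) ((2 * Real.pi) • ContinuousLinearMap.inr ℝ (Euc n) (Euc n)) v (-x)
    hc.contDiff hC hb (fun Y => ?_) fun y => ?_).2
  · have hl := lam_rpow_pos Y (-ρ / 2)
    have h1 : 1 ≤ lam Y ^ (δ / 2) := one_le_lam_rpow _ (by linarith [hp.nonneg])
    have h2 : lam Y ^ (-ρ / 2) ≤ 1 := lam_rpow_le_one _ (by linarith [hp.pos])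
    refine ContinuousLinearMap.opNorm_le_bound _ (by positivity) fun y => ?_
    simp only [ContinuousLinearMap.comp_apply, coframe, dil_apply, smul_apply,
      ContinuousLinearMap.inr_apply, Prod.smul_fst, Prod.smul_snd, smul_zero, Prod.norm_mk,
      norm_zero, norm_smul, Real.norm_eq_abs, abs_of_pos hl, abs_of_pos (show 0 < 2 * Real.pi by positivity)]
    rw [max_eq_right (by positivity)]
    calc _ ≤ 1 * (2 * Real.pi * ‖y‖) := by gcongr
      _ ≤ lam Y ^ (δ / 2) * ((1 + 2 * Real.pi) * ‖y‖) := by gcongr; linarith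
      _ = _ := by ring
  · refine (lam_le_sq _).trans ?_
    rw [mul_assoc, mul_assoc, ← mul_pow, ← mul_pow]
    gcongr
    rw [norm_neg]
    have h3 : ‖((x, 0) : Phase n) + ((2 * Real.pi) • ContinuousLinearMap.inr ℝ (Euc n) (Euc n)) y‖ ≤
        ‖x‖ + 2 * Real.pi * ‖y‖ := by
      rw [Prod.norm_def]
      simp only [Prod.fst_add, Prod.snd_add, smul_apply, ContinuousLinearMap.inr_apply,
        Prod.smul_fst, Prod.smul_snd, smul_zero, add_zero, zero_add, norm_smul, Real.norm_eq_abs,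
        abs_of_pos (show 0 < 2 * Real.pi by positivity)]
      refine max_le ?_ ?_
      · have : 0 ≤ 2 * Real.pi * ‖y‖ := by positivity
        linarith
      · have := norm_nonneg x
        linarith
    have h4 := norm_nonneg x
    have h5 := norm_nonneg y
    have e : (1 + 2 * Real.pi) * ((1 + ‖x‖) * (1 + ‖y‖)) = 1 + (‖x‖ + 2 * Real.pi * ‖y‖) +
      (‖y‖ + ‖x‖ * ‖y‖ + 2 * Real.pi * (1 + ‖x‖ + ‖x‖ * ‖y‖)) := by ring
    rw [e]
    have : 0 ≤ ‖y‖ + ‖x‖ * ‖y‖ + 2 * Real.pi * (1 + ‖x‖ + ‖x‖ * ‖y‖) := by positivity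
    linarith

theorem coord_temperate (j : Fin n) :
    Function.HasTemperateGrowth (fun η : Euc n => 2 * Real.pi * Complex.I * (η j : ℂ)) := by
  have : (fun η : Euc n => (η j : ℂ)) =
      Complex.ofRealCLM.comp (EuclideanSpace.proj j : Euc n →L[ℝ] ℝ) := rfl
  have h := (Complex.ofRealCLM.comp (EuclideanSpace.proj j : Euc n →L[ℝ] ℝ)).hasTemperateGrowth
  rw [← this] at h
  exact (Function.HasTemperateGrowth.const (E := Euc n) (2 * Real.pi * Complex.I)).mul h

/-- Multiplication by `2πiη_j`. -/
def mulCoord (j : Fin n) : 𝓢(Euc n, ℂ) →L[ℂ] 𝓢(Euc n, ℂ) :=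
  smulLeftCLM ℂ (fun η : Euc n => 2 * Real.pi * Complex.I * (η j : ℂ))

theorem mulCoord_apply (j : Fin n) (v : 𝓢(Euc n, ℂ)) (η : Euc n) :
    mulCoord j v η = 2 * Real.pi * Complex.I * (η j : ℂ) * v η := by
  rw [mulCoord, smulLeftCLM_apply_apply (coord_temperate j), smul_eq_mul]

/-- The `j`-th coordinate as a complex-valued form. -/
def coordForm (j : Fin n) : Euc n →L[ℝ] ℂ :=
  Complex.ofRealCLM.comp (EuclideanSpace.proj j : Euc n →L[ℝ] ℝ)

@[simp] theorem coordForm_apply (j : Fin n) (e : Euc n) : coordForm j e = (e j : ℂ) := rfl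

theorem IsSym.pderiv {W : Phase n → ℝ} {c : Phase n → ℂ} (hc : IsSym ρ δ W c) (i : Fin n ⊕ Fin n) :
    IsSym ρ δ (fun X => W X * pwt ρ δ i X) (fun X => fderiv ℝ c X (pvec i)) := by
  refine ⟨?_, fun k => ?_⟩
  · have hfd : ContDiff ℝ ∞ (fderiv ℝ c) := hc.contDiff.fderiv_right (by simp)
    exact hfd.clm_apply contDiff_const
  · obtain ⟨C, hC, h⟩ := hc.bound (k + 1)
    exact ⟨C, hC, h.pderiv hc.contDiff i⟩

/-- The integrand of the derivative of `stdQuant c v` in the direction of `e_j`. -/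
def stdIntDeriv (c : Phase n → ℂ) (v : 𝓢(Euc n, ℂ)) (j : Fin n) (x η : Euc n) : ℂ :=
  stdInt c (mulCoord j v) x η + stdInt (fun X => fderiv ℝ c X (pvec (.inl j))) v x η

theorem hasFDerivAt_stdInt {c : Phase n → ℂ} (hc : ContDiff ℝ ∞ c) (v : 𝓢(Euc n, ℂ))
    (x η : Euc n) :
    HasFDerivAt (fun x => stdInt c v x η) (∑ j, stdIntDeriv c v j x η • coordForm j) x := by
  have h1 : HasFDerivAt (fun x : Euc n => ((2 * Real.pi * inner ℝ x η : ℝ) : ℂ) * Complex.I)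
      ((2 * Real.pi * Complex.I) • (Complex.ofRealCLM.comp ((innerSL ℝ).flip η : Euc n →L[ℝ] ℝ))) x := by
    have := ((Complex.ofRealCLM.comp ((innerSL ℝ).flip η : Euc n →L[ℝ] ℝ)).hasFDerivAt (x := x)).const_smul
      (2 * Real.pi * Complex.I)
    refine this.congr_of_eventuallyEq (.of_forall fun y => ?_)
    change ((2 * Real.pi * inner ℝ y η : ℝ) : ℂ) * Complex.I =
      (2 * Real.pi * Complex.I) • ((inner ℝ y η : ℝ) : ℂ)
    rw [smul_eq_mul]
    push_cast
    ring
  have h2 : HasFDerivAt (fun x : Euc n => c (x, (2 * Real.pi) • η))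
      ((fderiv ℝ c (x, (2 * Real.pi) • η)).comp (ContinuousLinearMap.inl ℝ (Euc n) (Euc n))) x :=
    ((hc.differentiable (by simp)).differentiableAt.hasFDerivAt).comp x
      (hasFDerivAt_prodMk_left x ((2 * Real.pi) • η))
  refine (h1.cexp.mul (h2.mul_const (v η))).congr_fderiv ?_
  ext e
  have he : fderiv ℝ c (x, (2 * Real.pi) • η) (e, 0) =
      ∑ j, (e j : ℂ) * fderiv ℝ c (x, (2 * Real.pi) • η) (pvec (.inl j)) := by
    have : ((e, 0) : Phase n) = ∑ j, e j • pvec (.inl j) := by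
      conv_lhs => rw [← euc_sum_stdVec e]
      ext1 <;> simp [pvec, Prod.fst_sum, Prod.snd_sum]
    rw [this, map_sum]
    simp
  have hin : ((inner ℝ e η : ℝ) : ℂ) = ∑ j, (e j : ℂ) * (η j : ℂ) := by
    rw [PiLp.inner_apply, Complex.ofReal_sum]
    congr 1 with j
    simp [mul_comm]
  simp only [add_apply, smul_apply, ContinuousLinearMap.comp_apply, ContinuousLinearMap.inl_apply,
    sum_apply, coordForm_apply, smul_eq_mul, stdIntDeriv, stdInt, mulCoord_apply]
  rw [he]
  simp only [ContinuousLinearMap.flip_apply, innerSL_apply_apply, Complex.ofRealCLM_apply, hin, Finset.mul_sum,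
    ← Finset.sum_add_distrib]
  refine Finset.sum_congr rfl fun j _ => ?_
  ring

theorem integrable_sum_smul_const {α ι E : Type*} [MeasurableSpace α] {μ : Measure α} [Fintype ι]
    [NormedAddCommGroup E] [NormedSpace ℂ E] {f : ι → α → ℂ} (hf : ∀ j, Integrable (f j) μ)
    (L : ι → E) : Integrable (fun η => ∑ j, f j η • L j) μ :=
  integrable_finsetSum _ fun j _ => (hf j).smul_const (L j)

theorem hasFDerivAt_stdQuant (hp : Admissible ρ δ) {W : Phase n → ℝ} (hW : TW ρ δ W)
    {c : Phase n → ℂ} (hc : IsSym ρ δ W c) (v : 𝓢(Euc n, ℂ)) (x : Euc n) :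
    HasFDerivAt (stdQuant c v) (∑ j, (stdQuant c (mulCoord j v) x +
      stdQuant (fun X => fderiv ℝ c X (pvec (.inl j))) v x) • coordForm j) x := by
  have h1 := fun j => exists_stdInt_bound hW hc (mulCoord j v) x
  have h2 := fun j : Fin n => exists_stdInt_bound (hW.mul (TW.pwt hp (.inl j))) (hc.pderiv (.inl j)) v x
  choose b₁ hb₁ hb₁' using h1
  choose b₂ hb₂ hb₂' using h2
  have hint1 := fun j => integrable_stdInt hW hc (mulCoord j v) x
  have hint2 := fun j : Fin n =>
    integrable_stdInt (hW.mul (TW.pwt hp (.inl j))) (hc.pderiv (.inl j)) v x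
  have hint : ∀ j, Integrable (fun η => stdIntDeriv c v j x η) := fun j => by
    simp only [stdIntDeriv]
    exact (hint1 j).add (hint2 j)
  have hF' : Integrable (fun η => ∑ j, stdIntDeriv c v j x η • (coordForm j : Euc n →L[ℝ] ℂ)) :=
    integrable_sum_smul_const hint _
  have hbi : Integrable (fun η => ∑ j : Fin n, (b₁ j η + b₂ j η) * ‖(coordForm j : Euc n →L[ℝ] ℂ)‖) :=
    integrable_finsetSum _ fun j _ => ((hb₁ j).add (hb₂ j)).mul_const _
  have hbb : ∀ η, ∀ y ∈ Metric.ball x 1,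
      ‖∑ j, stdIntDeriv c v j y η • (coordForm j : Euc n →L[ℝ] ℂ)‖ ≤
        ∑ j : Fin n, (b₁ j η + b₂ j η) * ‖(coordForm j : Euc n →L[ℝ] ℂ)‖ := fun η y hy => by
    refine (norm_sum_le _ _).trans (Finset.sum_le_sum fun j _ => ?_)
    rw [norm_smul, stdIntDeriv]
    exact mul_le_mul_of_nonneg_right
      ((norm_add_le _ _).trans (add_le_add (hb₁' j y hy η) (hb₂' j y hy η))) (norm_nonneg _)
  have : HasFDerivAt (fun y => ∫ η, stdInt c v y η)
      (∫ η, ∑ j, stdIntDeriv c v j x η • (coordForm j : Euc n →L[ℝ] ℂ)) x :=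
    hasFDerivAt_integral_of_dominated_of_fderiv_le (μ := volume) (𝕜 := ℝ)
    (F := stdInt c v) (F' := fun x η => ∑ j, stdIntDeriv c v j x η • coordForm j) (x₀ := x)
    (bound := fun η => ∑ j : Fin n, (b₁ j η + b₂ j η) * ‖(coordForm j : Euc n →L[ℝ] ℂ)‖)
    (Metric.ball_mem_nhds x one_pos)
    (.of_forall fun y =>
      (continuous_stdInt hc.contDiff.continuous v.continuous y).aestronglyMeasurable)
    (integrable_stdInt hW hc v x)
    hF'.aestronglyMeasurable (.of_forall hbb) hbi
    (.of_forall fun η y _ => hasFDerivAt_stdInt hc.contDiff v y η)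
  change HasFDerivAt (fun y => ∫ η, stdInt c v y η) _ x
  refine this.congr_fderiv ?_
  rw [integral_finsetSum _ fun j _ => (hint j).smul_const (coordForm j : Euc n →L[ℝ] ℂ)]
  refine Finset.sum_congr rfl fun j _ => ?_
  rw [integral_smul_const]
  congr 1
  simp only [stdIntDeriv, stdQuant]
  exact integral_add (hint1 j) (hint2 j)

/-- A derivative in x_j either multiplies v by 2πiη_j or differentiates the symbol, which replaces W
by W times `pwt`. Both terms are again of the form `stdQuant`, so induction on k over all weights
and symbols applies. -/
theorem exists_stdQuant_seminorm (hp : Admissible ρ δ) (D k : ℕ) {W : Phase n → ℝ} (hW : TW ρ δ W)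
    {c : Phase n → ℂ} (hc : IsSym ρ δ W c) : ∃ p : Seminorm ℂ 𝓢(Euc n, ℂ), Continuous p ∧
      ∀ v : 𝓢(Euc n, ℂ), ContDiff ℝ k (stdQuant c v) ∧
        ∀ x, (1 + ‖x‖) ^ D * ‖iteratedFDeriv ℝ k (stdQuant c v) x‖ ≤ p v := by
  induction k generalizing W c with
  | zero =>
    obtain ⟨p, hpc, h⟩ := exists_stdQuant_decay hp hW hc D
    refine ⟨p, hpc, fun v => ⟨?_, fun x => by simpa using h v x⟩⟩
    rw [Nat.cast_zero, contDiff_zero]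
    exact continuous_iff_continuousAt.2 fun x => (hasFDerivAt_stdQuant hp hW hc v x).continuousAt
  | succ k ih =>
    obtain ⟨p, hpc, h⟩ := ih hW hc
    have h2 := fun j : Fin n => ih (hW.mul (TW.pwt hp (.inl j))) (hc.pderiv (.inl j))
    choose q hqc h2 using h2
    let T : Fin n → ℂ →L[ℝ] (Euc n →L[ℝ] ℂ) := fun j =>
      (ContinuousLinearMap.id ℝ ℂ).smulRight (coordForm j)
    refine ⟨∑ j, ‖T j‖₊ • (p.comp (mulCoord j).toLinearMap + q j), ?_, fun v => ?_⟩
    · refine Seminorm.continuous_finsetSum fun j _ => ?_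
      exact ((hpc.comp (mulCoord j).continuous).add (hqc j)).const_smul _
    · have e : fderiv ℝ (stdQuant c v) = fun x => ∑ j, (T j ∘ fun x => stdQuant c (mulCoord j v) x +
          stdQuant (fun X => fderiv ℝ c X (pvec (.inl j))) v x) x := by
        ext1 x
        exact (hasFDerivAt_stdQuant hp hW hc v x).fderiv
      have hcd : ∀ j, ContDiff ℝ k (fun x => stdQuant c (mulCoord j v) x +
          stdQuant (fun X => fderiv ℝ c X (pvec (.inl j))) v x) := fun j =>
        (h (mulCoord j v)).1.add (h2 j v).1
      refine ⟨?_, fun x => ?_⟩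
      · rw [Nat.cast_add, Nat.cast_one, contDiff_succ_iff_fderiv]
        refine ⟨fun x => (hasFDerivAt_stdQuant hp hW hc v x).differentiableAt, by simp, ?_⟩
        rw [e]
        exact ContDiff.sum fun j _ => (T j).contDiff.comp (hcd j)
      · rw [← norm_iteratedFDeriv_fderiv, e, iteratedFDeriv_fun_sum_apply fun j _ =>
          ((T j).contDiff.comp (hcd j)).contDiffAt]
        have e2 : (∑ j, ‖T j‖₊ • (p.comp (mulCoord j).toLinearMap + q j)) v =
            ∑ j, ‖T j‖ * (p (mulCoord j v) + q j v) := by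
          change FunLike.coeAddMonoidHom _ _ _ (∑ j, ‖T j‖₊ • (p.comp (mulCoord j).toLinearMap + q j)) v = _
          rw [map_sum, Finset.sum_apply]
          rfl
        rw [e2]
        calc _ ≤ (1 + ‖x‖) ^ D * ∑ j, ‖T j‖ * (‖iteratedFDeriv ℝ k (stdQuant c (mulCoord j v)) x‖ +
            ‖iteratedFDeriv ℝ k (stdQuant (fun X => fderiv ℝ c X (pvec (.inl j))) v) x‖) := by
              gcongr
              refine (norm_sum_le _ _).trans (Finset.sum_le_sum fun j _ => ?_)
              refine ((T j).norm_iteratedFDeriv_comp_left (hcd j).contDiffAt le_rfl).trans ?_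
              gcongr
              refine (congrArg norm (iteratedFDeriv_add_apply (h (mulCoord j v)).1.contDiffAt
                (h2 j v).1.contDiffAt)).trans_le ?_
              exact norm_add_le _ _
          _ = ∑ j, ‖T j‖ * ((1 + ‖x‖) ^ D * ‖iteratedFDeriv ℝ k (stdQuant c (mulCoord j v)) x‖ +
            (1 + ‖x‖) ^ D *
              ‖iteratedFDeriv ℝ k (stdQuant (fun X => fderiv ℝ c X (pvec (.inl j))) v) x‖) := by
              rw [Finset.mul_sum]
              refine Finset.sum_congr rfl fun j _ => ?_
              ring
          _ ≤ _ := by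
              gcongr with j
              · exact (h (mulCoord j v)).2 x
              · exact (h2 j v).2 x

theorem exists_stdQuant_clm (hp : Admissible ρ δ) {W : Phase n → ℝ} (hW : TW ρ δ W)
    {c : Phase n → ℂ} (hc : IsSym ρ δ W c) : ∃ B : 𝓢(Euc n, ℂ) →L[ℂ] 𝓢(Euc n, ℂ),
      ∀ v x, B v x = stdQuant c v x := by
  refine ⟨mkCLM (𝕜 := ℂ) (σ := RingHom.id ℂ) (fun v => stdQuant c v) (fun f g x => ?_)
    (fun a f x => ?_) (fun f => ?_) (fun m => ?_), fun v x => rfl⟩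
  · rw [stdQuant, stdQuant, stdQuant,
      ← integral_add (integrable_stdInt hW hc f x) (integrable_stdInt hW hc g x)]
    congr 1 with η
    simp only [stdInt, add_apply]
    ring
  · rw [stdQuant, stdQuant, smul_eq_mul, RingHom.id_apply, ← integral_const_mul]
    congr 1 with η
    simp only [stdInt, smul_apply, smul_eq_mul]
    ring
  · exact contDiff_infty.2 fun k => by
      obtain ⟨p, -, h⟩ := exists_stdQuant_seminorm hp 0 k hW hc
      exact (h f).1
  · obtain ⟨p, hpc, h⟩ := exists_stdQuant_seminorm hp m.1 m.2 hW hc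
    obtain ⟨s, C, -, hs⟩ := Seminorm.bound_of_continuous (schwartz_withSeminorms ℂ (Euc n) ℂ) p hpc
    refine ⟨s, C, C.2, fun f x => ?_⟩
    calc _ ≤ (1 + ‖x‖) ^ m.1 * ‖iteratedFDeriv ℝ m.2 (stdQuant c f) x‖ := by
          gcongr; linarith
      _ ≤ p f := (h f).2 x
      _ ≤ _ := hs f

/-- For τ = 0 the symbol does not involve y, so the inner integral is the Fourier transform of u;
the substitution ξ = 2πη produces the power of 2π. -/
theorem tauInt_zero (c : Phase n → ℂ) (u : 𝓢(Euc n, ℂ)) (x : Euc n) :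
    tauInt 0 c u x = ((2 * Real.pi : ℝ) : ℂ) ^ n * stdQuant c (𝓕 u : 𝓢(Euc n, ℂ)) x := by
  have hπ := Real.pi_pos
  have h1 : ∀ ξ, ∫ y, tauIntegrand 0 c u x ξ y = stdInt c (𝓕 u : 𝓢(Euc n, ℂ)) x ((2 * Real.pi)⁻¹ • ξ) := by
    intro ξ
    rw [integral_tauIntegrand, stdInt, fourier_coe, smul_smul, mul_inv_cancel₀ (by positivity),
      one_smul, inner_smul_right, mul_inv_cancel_left₀ (by positivity), mul_comm Complex.I]
    congr 1
    have e : ∀ y, (((1 - 0 : ℝ) • x, ξ) : Phase n) +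
        ((0 : ℝ) • ContinuousLinearMap.inl ℝ (Euc n) (Euc n)) y = (x, ξ) := fun y => by
      ext1 <;> simp
    simp only [e]
    rw [Real.fourier_eq', Real.fourier_eq', ← integral_const_mul]
    congr 1 with y
    simp only [smul_eq_mul]
    ring
  rw [tauInt]
  simp_rw [h1]
  rw [Measure.integral_comp_inv_smul, finrank_euclideanSpace_fin, abs_of_pos (by positivity),
    Complex.real_smul, Complex.ofReal_pow]
  rfl

/-- Every symbol is the `0`-symbol of a continuous operator. -/
theorem IsSym.exists_isOpTau_zero (hp : Admissible ρ δ) {W : Phase n → ℝ} (hW : TW ρ δ W)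
    {c : Phase n → ℂ} (hc : IsSym ρ δ W c) : ∃ A, IsOpTau 0 c A := by
  obtain ⟨B, hB⟩ := exists_stdQuant_clm hp hW hc
  refine ⟨B.comp (FourierTransform.fourierCLM ℂ 𝓢(Euc n, ℂ)), ?_⟩
  rw [hc.isOpTau_iff hp hW]
  intro u x
  have := Real.pi_ne_zero
  rw [tauInt_zero, ContinuousLinearMap.comp_apply, hB, inv_pow, inv_mul_cancel_left₀ (by simp)]
  rfl

end StandardQuantization
-- Uniqueness of symbols and the group law of `IsJ`.
section Uniqueness

variable {n : ℕ} {ρ δ : ℝ}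

/-- For fixed x the difference of the symbols, times a phase, integrates to zero against every test
function of η, hence vanishes almost everywhere and by continuity everywhere. -/
theorem eq_of_stdQuant_eq {W : Phase n → ℝ} (hW : TW ρ δ W) {c d : Phase n → ℂ}
    (hc : IsSym ρ δ W c) (hd : IsSym ρ δ W d)
    (h : ∀ (v : 𝓢(Euc n, ℂ)) (x), stdQuant c v x = stdQuant d v x) : c = d := by
  have key : ∀ x η, c (x, (2 * Real.pi) • η) = d (x, (2 * Real.pi) • η) := by
    intro x
    set f : Euc n → ℂ := fun η => Complex.exp ((2 * Real.pi * inner ℝ x η : ℝ) * Complex.I) *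
      (c (x, (2 * Real.pi) • η) - d (x, (2 * Real.pi) • η)) with hf
    have hfc : Continuous f := by
      have := hc.contDiff.continuous
      have := hd.contDiff.continuous
      fun_prop
    have h0 := ae_eq_zero_of_integral_contDiff_smul_eq_zero (μ := volume)
      hfc.locallyIntegrable fun g hg hgs => by
        set v : 𝓢(Euc n, ℂ) := HasCompactSupport.toSchwartzMap (f := fun η => (g η : ℂ))
          (hgs.comp_left (g := fun r : ℝ => (r : ℂ)) (by simp))
          (Complex.ofRealCLM.contDiff.comp hg) with hv
        have h1 := sub_eq_zero.2 (h v x)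
        rw [stdQuant, stdQuant, ← integral_sub (integrable_stdInt hW hc v x)
          (integrable_stdInt hW hd v x)] at h1
        rw [← h1]
        congr 1 with η
        have : v η = (g η : ℂ) := rfl
        rw [stdInt, stdInt, this, hf, Complex.real_smul]
        ring
    have h1 := (hfc.ae_eq_iff_eq (g := fun _ => 0) volume continuous_const).1 h0
    intro η
    have h2 := congrFun h1 η
    rw [hf] at h2
    exact sub_eq_zero.1 ((mul_eq_zero.1 h2).resolve_left (Complex.exp_ne_zero _))
  ext ⟨x, ξ⟩
  have := key x ((2 * Real.pi)⁻¹ • ξ)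
  rwa [smul_smul, mul_inv_cancel₀ (by positivity), one_smul] at this

theorem IsOpTau.eq_of_zero (hp : Admissible ρ δ) {W : Phase n → ℝ} (hW : TW ρ δ W)
    {c d : Phase n → ℂ} (hc : IsSym ρ δ W c) (hd : IsSym ρ δ W d)
    {A : 𝓢(Euc n, ℂ) →L[ℂ] 𝓢(Euc n, ℂ)} (h : IsOpTau 0 c A) (h' : IsOpTau 0 d A) : c = d := by
  rw [hc.isOpTau_iff hp hW] at h
  rw [hd.isOpTau_iff hp hW] at h'
  refine eq_of_stdQuant_eq hW hc hd fun v x => ?_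
  have h1 := (h (𝓕⁻ v) x).symm.trans (h' (𝓕⁻ v) x)
  have := Real.pi_ne_zero
  rw [tauInt_zero, tauInt_zero, FourierTransform.fourier_fourierInv_eq] at h1
  exact mul_left_cancel₀ (by simp) (mul_left_cancel₀ (by simp) h1)

theorem SymConv.tendsto {W : Phase n → ℝ} (hW : ∀ X, 0 < W X) {f : ℕ → 𝓢(Phase n, ℂ)}
    {a : Phase n → ℂ} (h : SymConv ρ δ W f a) (X : Phase n) :
    Filter.Tendsto (fun i => f i X) Filter.atTop (nhds (a X)) := by
  rw [Metric.tendsto_atTop]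
  intro ε hε
  have hw := hW X
  obtain ⟨N, hN⟩ := Filter.eventually_atTop.1 (h 0 (ε / (2 * W X)) (by positivity))
  refine ⟨N, fun i hi => ?_⟩
  rw [dist_eq_norm]
  refine ((hN i hi).norm_le X).trans_lt ?_
  rw [div_mul_eq_mul_div, div_lt_iff₀ (by positivity)]
  nlinarith [mul_pos hε hw]

theorem SymConv.unique {W : Phase n → ℝ} (hW : ∀ X, 0 < W X) {f : ℕ → 𝓢(Phase n, ℂ)}
    {a b : Phase n → ℂ} (h : SymConv ρ δ W f a) (h' : SymConv ρ δ W f b) : a = b :=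
  funext fun X => tendsto_nhds_unique (h.tendsto hW X) (h'.tendsto hW X)

/-- `IsJ` refers to all approximating sequences, not only to truncations; the image of one such
sequence is therefore admissible for the next step, and the group law passes to symbols. -/
theorem IsJ.comp {w : Phase n → ℝ} {s t : ℝ} {a b c : Phase n → ℂ} (h : IsJ ρ δ w s a b)
    (h' : IsJ ρ δ w t b c) : IsJ ρ δ w (t + s) a c := fun f hf => by
  have := h' _ (h f hf)
  simpa only [J_J] using this

theorem IsJ.unique (hp : Admissible ρ δ) {w : Phase n → ℝ} (hw : TW ρ δ w) {t : ℝ}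
    {a b c : Phase n → ℂ} (ha : IsSym ρ δ w a) (h : IsJ ρ δ w t a b) (h' : IsJ ρ δ w t a c) : b = c :=
  have ht := ha.symConv_trunc hp fun X => (hw.pos X).le
  (h _ ht).unique (hw.mul_lam hp).pos (h' _ ht)

theorem isJ_zero {w : Phase n → ℝ} (a : Phase n → ℂ) : IsJ ρ δ w 0 a a := fun f hf => by
  simpa only [J_zero] using hf

/-- The `τ`-symbol in a given class is unique. -/
theorem IsOpTau.unique (hp : Admissible ρ δ) {w : Phase n → ℝ} (hw : TW ρ δ w)
    {a b : Phase n → ℂ} (ha : IsSym ρ δ w a) (hb : IsSym ρ δ w b) {τ : ℝ}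
    {A : 𝓢(Euc n, ℂ) →L[ℂ] 𝓢(Euc n, ℂ)} (h : IsOpTau τ a A) (h' : IsOpTau τ b A) : a = b := by
  obtain ⟨c, hc, hac⟩ := ha.exists_isJ hp hw (-τ)
  obtain ⟨d, hd, hbd⟩ := hb.exists_isJ hp hw (-τ)
  have hcd : c = d := ((hac.isOpTau_iff hp hw ha hc).1 h).eq_of_zero hp hw hc hd
    ((hbd.isOpTau_iff hp hw hb hd).1 h')
  subst hcd
  -- Both symbols have the same 0-symbol c; going back with time τ recovers each of them from c.
  obtain ⟨e, -, hce⟩ := hc.exists_isJ hp hw τ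
  have h1 := hac.comp hce
  have h2 := hbd.comp hce
  rw [add_neg_cancel] at h1 h2
  rw [(isJ_zero a).unique hp hw ha h1, (isJ_zero b).unique hp hw hb h2]

/-- Every symbol is the `τ`-symbol of a continuous operator. -/
theorem IsSym.exists_isOpTau (hp : Admissible ρ δ) {w : Phase n → ℝ} (hw : TW ρ δ w)
    {a : Phase n → ℂ} (ha : IsSym ρ δ w a) (τ : ℝ) : ∃ A, IsOpTau τ a A := by
  obtain ⟨c, hc, hac⟩ := ha.exists_isJ hp hw (-τ)
  obtain ⟨A, hA⟩ := hc.exists_isOpTau_zero hp hw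
  exact ⟨A, (hac.isOpTau_iff hp hw ha hc).2 hA⟩

/-- Change of quantization. -/
theorem IsJ.isOpTau_of_isOpTau (hp : Admissible ρ δ) {w : Phase n → ℝ} (hw : TW ρ δ w)
    {a b : Phase n → ℂ} (ha : IsSym ρ δ w a) (hb : IsSym ρ δ w b) {τ τ' : ℝ}
    (h : IsJ ρ δ w (τ - τ') a b) {A : 𝓢(Euc n, ℂ) →L[ℂ] 𝓢(Euc n, ℂ)} (hA : IsOpTau τ' a A) :
    IsOpTau τ b A := by
  obtain ⟨c, hc, hbc⟩ := hb.exists_isJ hp hw (-τ)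
  -- The τ'-symbol a and the τ-symbol b lead to the same 0-symbol c, because the times add up to
  -- -τ'.
  have h1 := h.comp hbc
  rw [show -τ + (τ - τ') = -τ' by ring] at h1
  exact (hbc.isOpTau_iff hp hw hb hc).2 ((h1.isOpTau_iff hp hw ha hc).1 hA)

end Uniqueness

/-! ### Linear substitutions in the base variable. -/

section LinearChange

variable {n : ℕ} {ρ δ : ℝ}

theorem transposeMap_transposeMap_symm (κ : Euc n ≃L[ℝ] Euc n) (ξ : Euc n) :
    transposeMap κ (transposeMap κ.symm ξ) = ξ := by
  refine ext_inner_right ℝ fun y => ?_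
  simp [transposeMap, ContinuousLinearMap.adjoint_inner_left]

theorem transposeMap_symm_transposeMap (κ : Euc n ≃L[ℝ] Euc n) (ξ : Euc n) :
    transposeMap κ.symm (transposeMap κ ξ) = ξ := by
  refine ext_inner_right ℝ fun y => ?_
  simp [transposeMap, ContinuousLinearMap.adjoint_inner_left]

/-- The transpose as an equivalence. -/
def transposeEquiv (κ : Euc n ≃L[ℝ] Euc n) : Euc n ≃L[ℝ] Euc n :=
  ContinuousLinearEquiv.equivOfInverse (transposeMap κ) (transposeMap κ.symm)
    (transposeMap_symm_transposeMap κ) (transposeMap_transposeMap_symm κ)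

theorem det_transposeMap (κ : Euc n ≃L[ℝ] Euc n) :
    (transposeMap κ).det = (κ : Euc n →L[ℝ] Euc n).det := by
  have h := LinearMap.toMatrix_adjoint (stdOrthonormalBasis ℝ (Euc n)) (stdOrthonormalBasis ℝ (Euc n))
    ((κ : Euc n →L[ℝ] Euc n) : Euc n →ₗ[ℝ] Euc n)
  have h2 : LinearMap.adjoint ((κ : Euc n →L[ℝ] Euc n) : Euc n →ₗ[ℝ] Euc n) =
      ((transposeMap κ : Euc n →L[ℝ] Euc n) : Euc n →ₗ[ℝ] Euc n) := rfl
  rw [h2] at h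
  have h3 := congrArg Matrix.det h
  rw [LinearMap.det_toMatrix, Matrix.det_conjTranspose, LinearMap.det_toMatrix] at h3
  simpa [ContinuousLinearMap.det] using h3

theorem abs_det_symm_mul_abs_det_transposeMap (κ : Euc n ≃L[ℝ] Euc n) :
    |(κ.symm : Euc n →L[ℝ] Euc n).det| * |(transposeMap κ).det| = 1 := by
  have h : (κ.symm : Euc n →L[ℝ] Euc n).det * (κ : Euc n →L[ℝ] Euc n).det = 1 := by
    rw [ContinuousLinearMap.det, ContinuousLinearMap.det, ← LinearMap.det_comp]
    have : (((κ.symm : Euc n →L[ℝ] Euc n) : Euc n →ₗ[ℝ] Euc n) ∘ₗ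
        ((κ : Euc n →L[ℝ] Euc n) : Euc n →ₗ[ℝ] Euc n)) = LinearMap.id := by
      ext1 x
      simp
    rw [this, LinearMap.det_id]
  rw [det_transposeMap, ← abs_mul, h, abs_one]

theorem integral_comp_equiv (e : Euc n ≃L[ℝ] Euc n) (f : Euc n → ℂ) :
    ∫ y, f (e y) = (|(e : Euc n →L[ℝ] Euc n).det|⁻¹ : ℝ) * ∫ y, f y := by
  have hdet : LinearMap.det ((e : Euc n →L[ℝ] Euc n) : Euc n →ₗ[ℝ] Euc n) ≠ 0 :=
    (LinearEquiv.isUnit_det' e.toLinearEquiv).ne_zero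
  have hmap := Measure.map_linearMap_addHaar_eq_smul_addHaar (μ := (volume : Measure (Euc n)))
    (f := ((e : Euc n →L[ℝ] Euc n) : Euc n →ₗ[ℝ] Euc n)) hdet
  have he : MeasurableEmbedding e := e.toHomeomorph.measurableEmbedding
  rw [← he.integral_map (μ := volume) f]
  change ∫ y, f y ∂(Measure.map ((e : Euc n →L[ℝ] Euc n) : Euc n →ₗ[ℝ] Euc n) _) = _
  rw [hmap, integral_smul_measure, ENNReal.toReal_ofReal (abs_nonneg _), Complex.real_smul, abs_inv]

/-- The symplectic map `(x, ξ) ↦ (κ⁻¹x, ᵗκξ)`. -/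
def liftMap (κ : Euc n ≃L[ℝ] Euc n) : Phase n →L[ℝ] Phase n :=
  (κ.symm : Euc n →L[ℝ] Euc n).prodMap (transposeMap κ)

@[simp] theorem liftMap_apply (κ : Euc n ≃L[ℝ] Euc n) (X : Phase n) :
    liftMap κ X = (κ.symm X.1, transposeMap κ X.2) := rfl

theorem tauIntegrand_comp_liftMap (τ : ℝ) (κ : Euc n ≃L[ℝ] Euc n) (a : Phase n → ℂ)
    (u : Euc n → ℂ) (x ξ y : Euc n) : tauIntegrand τ (fun X => a (liftMap κ X)) u x ξ y =
      tauIntegrand τ a (u ∘ κ) (κ.symm x) (transposeEquiv κ ξ) (κ.symm y) := by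
  have h : (inner ℝ (κ.symm x - κ.symm y) (transposeEquiv κ ξ) : ℝ) = inner ℝ (x - y) ξ := by
    change inner ℝ (κ.symm x - κ.symm y) (transposeMap κ ξ) = _
    rw [transposeMap, ContinuousLinearMap.adjoint_inner_right]
    simp
  rw [tauIntegrand, tauIntegrand, h]
  simp only [liftMap_apply, map_add, map_smul, Function.comp_apply,
    ContinuousLinearEquiv.apply_symm_apply]
  rfl

/-- Substituting κ⁻¹ for y and ᵗκ for ξ preserves the phase, and the two Jacobians cancel. -/
theorem tauInt_comp_liftMap (τ : ℝ) (κ : Euc n ≃L[ℝ] Euc n) (a : Phase n → ℂ)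
    (u : Euc n → ℂ) (x : Euc n) :
    tauInt τ (fun X => a (liftMap κ X)) u x = tauInt τ a (u ∘ κ) (κ.symm x) := by
  rw [tauInt]
  simp_rw [tauIntegrand_comp_liftMap]
  have h1 : ∀ ξ, ∫ y, tauIntegrand τ a (u ∘ κ) (κ.symm x) (transposeEquiv κ ξ) (κ.symm y) =
      (|(κ.symm : Euc n →L[ℝ] Euc n).det|⁻¹ : ℝ) *
        ∫ y, tauIntegrand τ a (u ∘ κ) (κ.symm x) (transposeEquiv κ ξ) y := fun ξ =>
    integral_comp_equiv κ.symm (tauIntegrand τ a (u ∘ κ) (κ.symm x) (transposeEquiv κ ξ))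
  simp_rw [h1]
  rw [integral_const_mul, integral_comp_equiv (transposeEquiv κ)
    (fun ξ => ∫ y, tauIntegrand τ a (u ∘ κ) (κ.symm x) ξ y), ← mul_assoc, ← Complex.ofReal_mul,
    ← mul_inv]
  have := abs_det_symm_mul_abs_det_transposeMap κ
  change |(κ.symm : Euc n →L[ℝ] Euc n).det| *
    |((transposeEquiv κ : Euc n ≃L[ℝ] Euc n) : Euc n →L[ℝ] Euc n).det| = 1 at this
  rw [this, inv_one, Complex.ofReal_one, one_mul, tauInt]

theorem lam_liftMap_le (κ : Euc n ≃L[ℝ] Euc n) : ∃ M, 1 ≤ M ∧ ∀ X : Phase n,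
    lam (liftMap κ X) ≤ M * lam X ∧ lam X ≤ M * lam (liftMap κ X) := by
  set B : ℝ := 1 + ‖(κ.symm : Euc n →L[ℝ] Euc n)‖ + ‖transposeMap κ‖ + ‖(κ : Euc n →L[ℝ] Euc n)‖ +
    ‖transposeMap κ.symm‖ with hB
  have b1 := norm_nonneg (κ.symm : Euc n →L[ℝ] Euc n)
  have b2 := norm_nonneg (transposeMap κ)
  have b3 := norm_nonneg (κ : Euc n →L[ℝ] Euc n)
  have b4 := norm_nonneg (transposeMap κ.symm)
  have h1B : 1 ≤ B := by linarith
  have key : ∀ (a b c d : ℝ), 0 ≤ c → 0 ≤ d → c ≤ B * a → d ≤ B * b →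
      1 + c ^ 2 + d ^ 2 ≤ B ^ 2 * (1 + a ^ 2 + b ^ 2) := by
    intro a b c d hc hd h1 h2
    have h3 : c ^ 2 ≤ B ^ 2 * a ^ 2 := by rw [← mul_pow]; gcongr
    have h4 : d ^ 2 ≤ B ^ 2 * b ^ 2 := by rw [← mul_pow]; gcongr
    have h5 : 1 ≤ B ^ 2 := one_le_pow₀ h1B
    linarith
  have op : ∀ (T : Euc n →L[ℝ] Euc n) (y : Euc n), ‖T‖ ≤ B → ‖T y‖ ≤ B * ‖y‖ := fun T y h =>
    T.le_of_opNorm_le h y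
  refine ⟨B ^ 2, one_le_pow₀ h1B, fun X => ⟨?_, ?_⟩⟩
  · exact key _ _ _ _ (norm_nonneg _) (norm_nonneg _)
      (op (κ.symm : Euc n →L[ℝ] Euc n) X.1 (by linarith)) (op (transposeMap κ) X.2 (by linarith))
  · refine key _ _ _ _ (norm_nonneg _) (norm_nonneg _) ?_ ?_
    · have := op (κ : Euc n →L[ℝ] Euc n) (κ.symm X.1) (by linarith)
      simpa using this
    · have := op (transposeMap κ.symm) (transposeMap κ X.2) (by linarith)
      rwa [transposeMap_symm_transposeMap] at this

/-- The map is block diagonal and thus commutes with the dilations of the two blocks. What remains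
are ratios of powers of `lam` at X and at its image, which are bounded as the two values are
comparable. -/
theorem exists_norm_coframe_liftMap_frame_le (hp : Admissible ρ δ) (κ : Euc n ≃L[ℝ] Euc n) :
    ∃ M, ∀ X : Phase n, ‖(coframe ρ δ (liftMap κ X)).comp ((liftMap κ).comp (frame ρ δ X))‖ ≤ M := by
  obtain ⟨M, hM, h⟩ := lam_liftMap_le κ
  have hM0 : 0 < M := by linarith
  have hκ := norm_nonneg (liftMap κ)
  refine ⟨M * ‖liftMap κ‖, fun X => ?_⟩
  have hc : (coframe ρ δ (liftMap κ X)).comp ((liftMap κ).comp (frame ρ δ X)) =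
      (dil n (lam (liftMap κ X) ^ (δ / 2) * lam X ^ (-δ / 2))
        (lam (liftMap κ X) ^ (-ρ / 2) * lam X ^ (ρ / 2))).comp (liftMap κ) := by
    ext T <;> simp [coframe, frame, smul_smul]
  have hr : ∀ (a b s : ℝ), 0 < a → 0 < b → a ≤ M * b → 0 ≤ s → s ≤ 1 → a ^ s * b ^ (-s) ≤ M := by
    intro a b s ha hb hab h0 h1
    rw [Real.rpow_neg hb.le, ← div_eq_mul_inv, ← Real.div_rpow ha.le hb.le]
    have h2 : a / b ≤ M := by rwa [div_le_iff₀ hb]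
    calc (a / b) ^ s ≤ M ^ s := Real.rpow_le_rpow (by positivity) h2 h0
      _ ≤ M ^ (1 : ℝ) := Real.rpow_le_rpow_of_exponent_le hM h1
      _ = M := Real.rpow_one M
  have l1 := lam_pos (liftMap κ X)
  have l2 := lam_pos X
  rw [hc]
  refine (ContinuousLinearMap.opNorm_comp_le _ _).trans ?_
  gcongr
  refine norm_dil_le ?_ ?_
  · rw [abs_of_pos (mul_pos (lam_rpow_pos _ _) (lam_rpow_pos _ _)), neg_div]
    exact hr _ _ _ l1 l2 (h X).1 (by linarith [hp.nonneg]) (by linarith [hp.lt_one])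
  · rw [abs_of_pos (mul_pos (lam_rpow_pos _ _) (lam_rpow_pos _ _)), neg_div, mul_comm]
    exact hr _ _ _ l2 l1 (h X).2 (by linarith [hp.pos]) (by linarith [hp.le_one])

theorem IsSym.comp_liftMap (hp : Admissible ρ δ) {w : Phase n → ℝ} {κ : Euc n ≃L[ℝ] Euc n}
    (hw : ∀ X, w (liftMap κ X) = w X) {a : Phase n → ℂ} (ha : IsSym ρ δ w a) :
    IsSym ρ δ w (fun X => a (liftMap κ X)) := by
  obtain ⟨M, hM⟩ := exists_norm_coframe_liftMap_frame_le hp κ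
  refine ⟨ha.contDiff.comp (liftMap κ).contDiff, fun k => ?_⟩
  obtain ⟨C, hC, h⟩ := ha.bound k
  refine ⟨C * (1 + |M|) ^ k, by positivity, fun j hj X => ?_⟩
  have hCw : 0 ≤ C * w X := (norm_nonneg _).trans (by rw [← hw]; exact h.norm_le (liftMap κ X))
  have e := (liftMap κ).iteratedFDeriv_comp_right (f := a) ha.contDiff X
    (i := j) (by exact_mod_cast le_top)
  rw [Function.comp_def] at e
  have hj' : (1 + |M|) ^ j ≤ (1 + |M|) ^ k := pow_le_pow_right₀ (by linarith [abs_nonneg M]) hj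
  refine ContinuousMultilinearMap.opNorm_le_bound
    (by rw [mul_right_comm]; exact mul_nonneg hCw (by positivity)) fun t => ?_
  rw [ContinuousMultilinearMap.compContinuousLinearMap_apply, e,
    ContinuousMultilinearMap.compContinuousLinearMap_apply]
  refine (norm_iteratedFDeriv_apply_le (ρ := ρ) (δ := δ) j a _ _).trans ?_
  have h2 : ∏ i, ‖coframe ρ δ (liftMap κ X) (liftMap κ (frame ρ δ X (t i)))‖ ≤
      ∏ i, ((1 + |M|) * ‖t i‖) := by
    gcongr with i
    exact ContinuousLinearMap.le_of_opNorm_le _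
      ((hM X).trans ((le_abs_self M).trans (by linarith))) (t i)
  rw [Finset.prod_mul_distrib] at h2
  simp only [Finset.prod_const, Finset.card_univ, Fintype.card_fin] at h2
  have hpr : 0 ≤ ∏ i, ‖t i‖ := Finset.prod_nonneg fun _ _ => norm_nonneg _
  calc _ ≤ (C * w X) * ((1 + |M|) ^ j * ∏ i, ‖t i‖) := by
        refine mul_le_mul ((h j hj _).trans_eq (by rw [hw])) h2
          (Finset.prod_nonneg fun _ _ => norm_nonneg _) hCw
    _ ≤ (C * w X) * ((1 + |M|) ^ k * ∏ i, ‖t i‖) := by gcongr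
    _ = _ := by ring

/-- The symbol of the conjugated operator. -/
theorem IsOpTau.conjOp (hp : Admissible ρ δ) {w : Phase n → ℝ} (hw : TW ρ δ w)
    {κ : Euc n ≃L[ℝ] Euc n} (hκ : ∀ X, w (liftMap κ X) = w X) {a : Phase n → ℂ}
    (ha : IsSym ρ δ w a) {τ : ℝ} {A : 𝓢(Euc n, ℂ) →L[ℂ] 𝓢(Euc n, ℂ)} (hA : IsOpTau τ a A) :
    IsOpTau τ (fun X => a (liftMap κ X)) (conjOp κ A) := by
  rw [(ha.comp_liftMap hp hκ).isOpTau_iff hp hw]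
  rw [ha.isOpTau_iff hp hw] at hA
  intro u x
  rw [conjOp_apply, hA, tauInt_comp_liftMap]
  rfl

theorem IsOpTau.op_unique (hp : Admissible ρ δ) {w : Phase n → ℝ} (hw : TW ρ δ w)
    {a : Phase n → ℂ} (ha : IsSym ρ δ w a) {τ : ℝ} {A B : 𝓢(Euc n, ℂ) →L[ℂ] 𝓢(Euc n, ℂ)}
    (hA : IsOpTau τ a A) (hB : IsOpTau τ a B) : A = B := by
  rw [ha.isOpTau_iff hp hw] at hA hB
  ext u x
  rw [hA, hB]

end LinearChange
-- Iterated directional derivatives and the chain rule for linear maps.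
section DirectionalDerivatives

variable {V V' : Type*} [NormedAddCommGroup V] [NormedSpace ℝ V] [NormedAddCommGroup V']
  [NormedSpace ℝ V'] {n : ℕ}

theorem ContDiff.dirDeriv {f : V → ℂ} (hf : ContDiff ℝ ∞ f) (v : V) :
    ContDiff ℝ ∞ (dirDeriv v f) :=
  (hf.fderiv_right (m := ∞) (by simp)).clm_apply contDiff_const

theorem ContDiff.iterate_dirDeriv {f : V → ℂ} (hf : ContDiff ℝ ∞ f) (v : V) (k : ℕ) :
    ContDiff ℝ ∞ ((_root_.dirDeriv v)^[k] f) := by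
  induction k with
  | zero => exact hf
  | succ k ih => rw [Function.iterate_succ_apply']; exact ih.dirDeriv v

theorem ContDiff.foldr_dirDeriv {f : V → ℂ} (hf : ContDiff ℝ ∞ f) (v : Fin n → V) (α : Fin n → ℕ)
    (L : List (Fin n)) :
    ContDiff ℝ ∞ (L.foldr (fun j h => (_root_.dirDeriv (v j))^[α j] h) f) := by
  induction L with
  | nil => exact hf
  | cons j L ih => exact ih.iterate_dirDeriv (v j) (α j)

theorem ContDiff.multiDeriv {f : V → ℂ} (hf : ContDiff ℝ ∞ f) (v : Fin n → V) (α : Fin n → ℕ) :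
    ContDiff ℝ ∞ (multiDeriv v α f) := hf.foldr_dirDeriv v α _

theorem Filter.EventuallyEq.dirDeriv {f g : V → ℂ} {x : V} (h : f =ᶠ[nhds x] g) (v : V) :
    dirDeriv v f =ᶠ[nhds x] dirDeriv v g :=
  (h.fderiv (𝕜 := ℝ)).mono fun y hy => by simp only [_root_.dirDeriv, hy]

theorem Filter.EventuallyEq.iterate_dirDeriv {f g : V → ℂ} {x : V} (h : f =ᶠ[nhds x] g) (v : V)
    (k : ℕ) : (_root_.dirDeriv v)^[k] f =ᶠ[nhds x] (_root_.dirDeriv v)^[k] g := by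
  induction k with
  | zero => exact h
  | succ k ih => rw [Function.iterate_succ_apply', Function.iterate_succ_apply']; exact ih.dirDeriv v

theorem Filter.EventuallyEq.multiDeriv {f g : V → ℂ} {x : V} (h : f =ᶠ[nhds x] g) (v : Fin n → V)
    (α : Fin n → ℕ) : multiDeriv v α f =ᶠ[nhds x] multiDeriv v α g := by
  unfold _root_.multiDeriv
  induction List.finRange n with
  | nil => exact h
  | cons j L ih => exact ih.iterate_dirDeriv (v j) (α j)

theorem iterate_dirDeriv_comp {f : V → ℂ} (hf : ContDiff ℝ ∞ f) (T : V' →L[ℝ] V) (c : ℝ) {v : V'}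
    {e : V} (hv : T v = c • e) (z : ℂ) (k : ℕ) : (dirDeriv v)^[k] (fun x => z * f (T x)) =
      fun x => ((c : ℂ) ^ k * z) * (dirDeriv e)^[k] f (T x) := by
  induction k with
  | zero => simp
  | succ k ih =>
    rw [Function.iterate_succ_apply', Function.iterate_succ_apply', ih]
    have hg := hf.iterate_dirDeriv e k
    generalize (dirDeriv e)^[k] f = g at *
    ext x
    have h1 : HasFDerivAt (fun x => g (T x)) ((fderiv ℝ g (T x)).comp (T : V' →L[ℝ] V)) x :=
      ((hg.differentiable (by simp)).differentiableAt.hasFDerivAt).comp x T.hasFDerivAt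
    rw [dirDeriv, (h1.const_mul _).fderiv]
    simp only [smul_apply, ContinuousLinearMap.comp_apply, hv, map_smul, smul_eq_mul, dirDeriv,
      Complex.real_smul]
    ring

/-- The scalar z is carried along so that the rule can be applied several times in succession, as
needed for the x, y and ξ derivatives of an amplitude. -/
theorem multiDeriv_comp {f : V → ℂ} (hf : ContDiff ℝ ∞ f) (T : V' →L[ℝ] V) (c : ℝ)
    {v : Fin n → V'} {e : Fin n → V} (hv : ∀ j, T (v j) = c • e j) (z : ℂ) (α : Fin n → ℕ) :
    multiDeriv v α (fun x => z * f (T x)) =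
      fun x => ((c : ℂ) ^ multiLength α * z) * multiDeriv e α f (T x) := by
  have key : ∀ L : List (Fin n), L.foldr (fun j h => (dirDeriv (v j))^[α j] h)
      (fun x => z * f (T x)) = fun x => ((c : ℂ) ^ (L.map α).sum * z) *
        L.foldr (fun j h => (dirDeriv (e j))^[α j] h) f (T x) := by
    intro L
    induction L with
    | nil => simp
    | cons j L ih =>
      rw [List.foldr_cons, List.foldr_cons, ih,
        iterate_dirDeriv_comp (hf.foldr_dirDeriv e α L) T c (hv j)]
      simp only [List.map_cons, List.sum_cons, pow_add, mul_assoc]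
  have h := key (List.finRange n)
  rwa [← Fin.sum_univ_def] at h

end DirectionalDerivatives

/-! ### Identification of the asymptotic expansion with the Taylor polynomial. -/

section Expansion

variable {n : ℕ} {ρ δ : ℝ}

/-- The multi-index derivative of a Schwartz function. -/
def schwartzMultiDeriv (v : Fin n → Phase n) (α : Fin n → ℕ) (f : 𝓢(Phase n, ℂ)) :
    𝓢(Phase n, ℂ) :=
  (List.finRange n).foldr (fun j h => (fun g : 𝓢(Phase n, ℂ) => ∂_{v j} g)^[α j] h) f

theorem coe_iterate_lineDeriv (v : Phase n) (k : ℕ) (f : 𝓢(Phase n, ℂ)) :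
    ⇑((fun g : 𝓢(Phase n, ℂ) => ∂_{v} g)^[k] f) = (dirDeriv v)^[k] f := by
  induction k with
  | zero => rfl
  | succ k ih =>
    rw [Function.iterate_succ_apply', Function.iterate_succ_apply', ← ih, coe_lineDeriv]
    rfl

theorem coe_schwartzMultiDeriv (v : Fin n → Phase n) (α : Fin n → ℕ) (f : 𝓢(Phase n, ℂ)) :
    ⇑(schwartzMultiDeriv v α f) = multiDeriv v α f := by
  unfold schwartzMultiDeriv multiDeriv
  induction List.finRange n with
  | nil => rfl
  | cons j L ih => rw [List.foldr_cons, List.foldr_cons, coe_iterate_lineDeriv, ih]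

theorem phaseFT_iterate_lineDeriv (v : Phase n) (k : ℕ) (f : 𝓢(Phase n, ℂ)) (Ω : Phase n) :
    phaseFT n ((fun g : 𝓢(Phase n, ℂ) => ∂_{v} g)^[k] f) Ω =
      (2 * Real.pi * Complex.I * ppair Ω v) ^ k * phaseFT n f Ω := by
  induction k with
  | zero => simp
  | succ k ih =>
    rw [Function.iterate_succ_apply', phaseFT_lineDeriv, smul_apply, mulPair_apply, ih, smul_eq_mul]
    ring

theorem phaseFT_schwartzMultiDeriv (v : Fin n → Phase n) (α : Fin n → ℕ) (f : 𝓢(Phase n, ℂ))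
    (Ω : Phase n) : phaseFT n (schwartzMultiDeriv v α f) Ω =
      (∏ j, (2 * Real.pi * Complex.I * ppair Ω (v j)) ^ α j) * phaseFT n f Ω := by
  rw [schwartzMultiDeriv, Fin.prod_univ_def]
  induction List.finRange n with
  | nil => simp
  | cons j L ih =>
    rw [List.foldr_cons, phaseFT_iterate_lineDeriv, ih, List.map_cons, List.prod_cons]
    ring

theorem phaseFT_injective {f g : 𝓢(Phase n, ℂ)} (h : ∀ Ω, phaseFT n f Ω = phaseFT n g Ω) : f = g := by
  rw [← phaseIFT_phaseFT f, ← phaseIFT_phaseFT g]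
  congr 1
  ext Ω
  exact h Ω

theorem schwartzMultiDeriv_add (v : Fin n → Phase n) (α β : Fin n → ℕ) (f : 𝓢(Phase n, ℂ)) :
    schwartzMultiDeriv v α (schwartzMultiDeriv v β f) = schwartzMultiDeriv v (α + β) f := by
  refine phaseFT_injective fun Ω => ?_
  simp only [phaseFT_schwartzMultiDeriv, ← mul_assoc, ← Finset.prod_mul_distrib, Pi.add_apply,
    pow_add]

theorem trunc_eventuallyEq {a : Phase n → ℂ} (ha : ContDiff ℝ ∞ a) {X : Phase n} {i : ℕ}
    (hi : ‖X‖ < i + 1) : (trunc a ha i : Phase n → ℂ) =ᶠ[nhds X] a := by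
  have : ∀ᶠ Y : Phase n in nhds X, ‖Y‖ < i + 1 :=
    continuous_norm.continuousAt.eventually_lt continuousAt_const hi
  exact this.mono fun Y hY => trunc_eq ha hY.le

/-- The statement is local, so f may be replaced by a truncation. For Schwartz functions the
derivatives become products of linear forms on the Fourier side, which commute. -/
theorem multiDeriv_multiDeriv {f : Phase n → ℂ} (hf : ContDiff ℝ ∞ f) (v : Fin n → Phase n)
    (α β : Fin n → ℕ) : multiDeriv v α (multiDeriv v β f) = multiDeriv v (α + β) f := by
  ext X
  obtain ⟨i, hi⟩ := exists_nat_gt ‖X‖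
  have h := trunc_eventuallyEq hf (X := X) (i := i) (by linarith)
  rw [← ((h.multiDeriv v β).multiDeriv v α).eq_of_nhds, ← (h.multiDeriv v (α + β)).eq_of_nhds,
    ← coe_schwartzMultiDeriv, ← coe_schwartzMultiDeriv, ← coe_schwartzMultiDeriv,
    schwartzMultiDeriv_add]

/-- A pair (β,γ) is a single multi-index over the doubled index set. For each degree k this is the
multinomial theorem for the 2n numbers p z_j and q z_j. -/
theorem sum_multiPairs_eq (N : ℕ) (p q : ℂ) (z : Fin n → ℂ) :
    ∑ P ∈ multiPairs n N, 1 / ((multiFactorial P.1 : ℂ) * multiFactorial P.2) *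
      p ^ multiLength P.1 * q ^ multiLength P.2 * ∏ j, z j ^ (P.1 + P.2) j =
    ∑ k ∈ Finset.range N, ((p + q) * ∑ j, z j) ^ k / k.factorial := by
  have hlen : ∀ P : (Fin n → ℕ) × (Fin n → ℕ),
      multiLength (P.1 + P.2) = multiLength P.1 + multiLength P.2 := fun P => by
    simp [multiLength, Finset.sum_add_distrib]
  rw [← Finset.sum_fiberwise_of_maps_to (g := fun P => multiLength (P.1 + P.2))
    (t := Finset.range N) fun P hP => by simpa [mem_multiPairs] using hP]
  refine Finset.sum_congr rfl fun k hk => ?_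
  have hk' : k < N := by simpa using hk
  have h1 : (p + q) * ∑ j, z j =
      ∑ i : Fin n ⊕ Fin n, Sum.elim (fun j => p * z j) (fun j => q * z j) i := by
    rw [Fintype.sum_sum_type, add_mul, Finset.mul_sum, Finset.mul_sum]
    rfl
  rw [h1, Finset.sum_pow_eq_sum_piAntidiag, Finset.sum_div]
  refine Finset.sum_bij' (fun P _ => Sum.elim P.1 P.2) (fun l _ => (l ∘ Sum.inl, l ∘ Sum.inr))
    (fun P hP => ?_) (fun l hl => ?_) (fun P _ => rfl) (fun l _ => Sum.elim_comp_inl_inr l)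
    (fun P hP => ?_)
  · have hP' := (Finset.mem_filter.1 hP).2
    rw [hlen] at hP'
    simpa [multiLength] using hP'
  · have hl' := (Finset.mem_piAntidiag.1 hl).1
    have hs : multiLength ((l ∘ Sum.inl : Fin n → ℕ) + (l ∘ Sum.inr : Fin n → ℕ)) = k := by
      rw [hlen (l ∘ Sum.inl, l ∘ Sum.inr), ← hl', Fintype.sum_sum_type]
      rfl
    rw [Finset.mem_filter, mem_multiPairs]
    exact ⟨hs.trans_lt hk', hs⟩
  · have hP' := (Finset.mem_filter.1 hP).2
    rw [hlen] at hP'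
    have hm := Nat.multinomial_spec (Finset.univ : Finset (Fin n ⊕ Fin n)) (Sum.elim P.1 P.2)
    rw [Fintype.prod_sum_type, Fintype.sum_sum_type] at hm
    simp only [Sum.elim_inl, Sum.elim_inr] at hm
    change multiFactorial P.1 * multiFactorial P.2 * _ =
      (multiLength P.1 + multiLength P.2).factorial at hm
    rw [hP'] at hm
    have hm' : (multiFactorial P.1 : ℂ) * multiFactorial P.2 *
        (Nat.multinomial Finset.univ (Sum.elim P.1 P.2) : ℂ) = (k.factorial : ℂ) := by
      exact_mod_cast hm
    have f1 : (multiFactorial P.1 : ℂ) ≠ 0 := by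
      simp [multiFactorial, Finset.prod_eq_zero_iff, Nat.factorial_ne_zero]
    have f2 : (multiFactorial P.2 : ℂ) ≠ 0 := by
      simp [multiFactorial, Finset.prod_eq_zero_iff, Nat.factorial_ne_zero]
    have f3 : (k.factorial : ℂ) ≠ 0 := by exact_mod_cast Nat.factorial_ne_zero k
    have h2 : ∏ i : Fin n ⊕ Fin n, (Sum.elim (fun j => p * z j) (fun j => q * z j) i) ^
        (Sum.elim P.1 P.2 i) = p ^ multiLength P.1 * q ^ multiLength P.2 *
          ∏ j, z j ^ (P.1 + P.2) j := by
      rw [Fintype.prod_sum_type]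
      simp only [Sum.elim_inl, Sum.elim_inr, mul_pow, Finset.prod_mul_distrib, Pi.add_apply, pow_add,
        Finset.prod_pow_eq_pow_sum, multiLength]
      ring
    have f4 : (Nat.multinomial Finset.univ (Sum.elim P.1 P.2) : ℂ) ≠ 0 := fun h0 => by
      rw [h0, mul_zero] at hm'
      exact f3 hm'.symm
    rw [h2, ← hm']
    field_simp

theorem phaseFT_crossLap_pow (k : ℕ) (f : 𝓢(Phase n, ℂ)) (Ω : Phase n) :
    phaseFT n ((crossLap n ^ k) f) Ω =
      ((-(4 * Real.pi ^ 2 * inner ℝ Ω.1 Ω.2) : ℝ) : ℂ) ^ k * phaseFT n f Ω := by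
  induction k with
  | zero => simp
  | succ k ih =>
    rw [_root_.pow_succ' (crossLap n), mul_apply_eq_comp, phaseFT_crossLap, ih]
    ring

/-- The asymptotic expansion of the change of quantization, for Schwartz functions. -/
theorem changeExpansion_schwartz (τ τ' : ℝ) (f : 𝓢(Phase n, ℂ)) (N : ℕ) (X : Phase n) :
    changeExpansion τ τ' f N X = ∑ k ∈ Finset.range N,
      ((Complex.I * (τ - τ' : ℝ)) ^ k / k.factorial) * (crossLap n ^ k) f X := by
  set co : (Fin n → ℕ) × (Fin n → ℕ) → ℂ := fun P =>
    ((1 / ((multiFactorial P.1 : ℝ) * multiFactorial P.2) *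
      τ ^ multiLength P.1 * (1 - τ) ^ multiLength P.2 *
      (τ' - 1) ^ multiLength P.1 * τ' ^ multiLength P.2 : ℝ) : ℂ) *
      (-Complex.I) ^ multiLength (P.1 + P.2) with hco
  have h : ∑ P ∈ multiPairs n N, co P • schwartzMultiDeriv (fun j => pvec (.inr j)) (P.1 + P.2)
      (schwartzMultiDeriv (fun j => pvec (.inl j)) (P.1 + P.2) f) =
      ∑ k ∈ Finset.range N, ((Complex.I * (τ - τ' : ℝ)) ^ k / k.factorial) • (crossLap n ^ k) f := by
    refine phaseFT_injective fun Ω => ?_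
    simp only [map_sum, map_smul, sum_apply, smul_apply, smul_eq_mul, phaseFT_schwartzMultiDeriv,
      phaseFT_crossLap_pow]
    have hz := sum_multiPairs_eq N ((-Complex.I) * (τ * (τ' - 1))) ((-Complex.I) * ((1 - τ) * τ'))
      (fun j : Fin n => (2 * Real.pi * Complex.I * ppair Ω (pvec (.inr j))) *
        (2 * Real.pi * Complex.I * ppair Ω (pvec (.inl j))))
    -- The identity τ(τ'-1) + (1-τ)τ' = τ'-τ is what collapses the double sum to the single time
    -- τ-τ'.
    have h1 : ((-Complex.I) * (τ * (τ' - 1)) + (-Complex.I) * ((1 - τ) * τ') : ℂ) =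
        Complex.I * (τ - τ' : ℝ) := by push_cast; ring
    have h2 : ∑ j : Fin n, (2 * Real.pi * Complex.I * ppair Ω (pvec (.inr j))) *
        (2 * Real.pi * Complex.I * ppair Ω (pvec (.inl j))) =
        ((-(4 * Real.pi ^ 2 * inner ℝ Ω.1 Ω.2) : ℝ) : ℂ) := by
      simp only [ppair_pvec_inl, ppair_pvec_inr, PiLp.inner_apply, RCLike.inner_apply, conj_trivial]
      push_cast
      rw [Finset.mul_sum, ← Finset.sum_neg_distrib]
      refine Finset.sum_congr rfl fun j _ => ?_
      linear_combination (4 * Real.pi ^ 2 * (Ω.1 j : ℂ) * Ω.2 j) * Complex.I_sq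
    rw [h1, h2] at hz
    have h3 := congrArg (· * phaseFT n f Ω) hz
    simp only [Finset.sum_mul] at h3
    refine Eq.trans (Finset.sum_congr rfl fun P _ => ?_) (h3.trans (Finset.sum_congr rfl fun k _ => ?_))
    · have hlen : multiLength (P.1 + P.2) = multiLength P.1 + multiLength P.2 := by
        simp [multiLength, Finset.sum_add_distrib]
      rw [hco]
      simp only [mul_pow, Finset.prod_mul_distrib, hlen, pow_add]
      push_cast
      ring
    · rw [mul_pow]; ring
  have hX := congrArg (fun F : 𝓢(Phase n, ℂ) => F X) h
  simp only [sum_apply, smul_apply, smul_eq_mul, coe_schwartzMultiDeriv] at hX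
  rw [← hX, changeExpansion]
  refine Finset.sum_congr rfl fun P _ => ?_
  rw [hco, ← mul_assoc]
  rfl

theorem changeExpansion_congr (τ τ' : ℝ) {f g : Phase n → ℂ} {X : Phase n} (h : f =ᶠ[nhds X] g)
    (N : ℕ) : changeExpansion τ τ' f N X = changeExpansion τ τ' g N X := by
  refine Finset.sum_congr rfl fun P _ => ?_
  rw [((h.multiDeriv _ _).multiDeriv _ _).eq_of_nhds]

/-- By the chain rule each x-derivative contributes 1-τ' and each y-derivative τ'. The sign in
(-D_x)^β turns 1-τ' into τ'-1, after which all derivatives fall on the first variable of f. -/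
theorem amplitudeTerm_comp (τ' : ℝ) {f : Phase n → ℂ} (hf : ContDiff ℝ ∞ f) (β γ : Fin n → ℕ)
    (X : Phase n) : amplitudeTerm (fun p => f ((1 - τ') • p.1 + τ' • p.2.1, p.2.2)) β γ X =
      (-Complex.I) ^ multiLength (β + γ) * ((τ' - 1 : ℝ) ^ multiLength β * (τ' : ℂ) ^ multiLength γ) *
        multiDeriv (fun j => ((0, stdVec j) : Phase n)) (β + γ)
          (multiDeriv (fun j => ((stdVec j, 0) : Phase n)) (β + γ) f) X := by
  let T : Euc n × Euc n × Euc n →L[ℝ] Phase n :=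
    ((1 - τ') • ContinuousLinearMap.fst ℝ (Euc n) (Euc n × Euc n) +
      τ' • (ContinuousLinearMap.fst ℝ (Euc n) (Euc n)).comp
        (ContinuousLinearMap.snd ℝ (Euc n) (Euc n × Euc n))).prod
      ((ContinuousLinearMap.snd ℝ (Euc n) (Euc n)).comp
        (ContinuousLinearMap.snd ℝ (Euc n) (Euc n × Euc n)))
  have hT : ∀ p, T p = ((1 - τ') • p.1 + τ' • p.2.1, p.2.2) := fun p => rfl
  have h0 : (fun p : Euc n × Euc n × Euc n => f ((1 - τ') • p.1 + τ' • p.2.1, p.2.2)) =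
      fun p => 1 * f (T p) := by ext p; rw [hT, one_mul]
  have hg1 := hf.multiDeriv (fun j => ((stdVec j, 0) : Phase n)) γ
  have hg2 := hg1.multiDeriv (fun j => ((stdVec j, 0) : Phase n)) β
  rw [amplitudeTerm, h0, multiDeriv_comp hf T τ' (e := fun j => ((stdVec j, 0) : Phase n))
      (fun j => by rw [hT]; ext1 <;> simp),
    multiDeriv_comp hg1 T (1 - τ') (e := fun j => ((stdVec j, 0) : Phase n))
      (fun j => by rw [hT]; ext1 <;> simp),
    multiDeriv_comp hg2 T 1 (e := fun j => ((0, stdVec j) : Phase n))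
      (fun j => by rw [hT]; ext1 <;> simp), multiDeriv_multiDeriv hf]
  have hTX : T (X.1, X.1, X.2) = X := by
    rw [hT]; ext1 <;> simp [← add_smul]
  have hlen : multiLength (β + γ) = multiLength β + multiLength γ := by
    simp [multiLength, Finset.sum_add_distrib]
  have hI : Complex.I ^ multiLength β * ((1 - τ' : ℝ) : ℂ) ^ multiLength β =
      (-Complex.I) ^ multiLength β * ((τ' - 1 : ℝ) : ℂ) ^ multiLength β := by
    rw [← mul_pow, ← mul_pow]
    congr 1
    push_cast; ring
  simp only [hTX, Complex.ofReal_one, one_pow, one_mul, mul_one, hlen, pow_add]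
  linear_combination ((-Complex.I) ^ multiLength γ * (τ' : ℂ) ^ multiLength γ *
    multiDeriv (fun j => ((0, stdVec j) : Phase n)) (β + γ)
          (multiDeriv (fun j => ((stdVec j, 0) : Phase n)) (β + γ) f) X) * hI

/-- The expansion for the conjugated operator is the expansion for the change of quantization of the
transformed symbol. -/
theorem conjExpansion_eq (τ τ' : ℝ) (κ : Euc n ≃L[ℝ] Euc n) {a : Phase n → ℂ} (ha : ContDiff ℝ ∞ a)
    (N : ℕ) (X : Phase n) :
    conjExpansion τ τ' κ a N X = changeExpansion τ τ' (fun X => a (liftMap κ X)) N X := by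
  have h : conjAmplitude τ' κ a =
      fun p => (fun X => a (liftMap κ X)) ((1 - τ') • p.1 + τ' • p.2.1, p.2.2) := by
    ext p
    rw [conjAmplitude, abs_det_symm_mul_abs_det_transposeMap, Complex.ofReal_one, mul_one]
    simp
  refine Finset.sum_congr rfl fun P _ => ?_
  rw [h, amplitudeTerm_comp τ' (f := fun X => a (liftMap κ X)) (ha.comp (liftMap κ).contDiff)]
  push_cast
  ring

/-- The remainder of the asymptotic expansion is a symbol. -/
theorem IsJ.exists_remainder (hp : Admissible ρ δ) {w : Phase n → ℝ} (hw : TW ρ δ w)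
    {a b : Phase n → ℂ} (ha : IsSym ρ δ w a) {τ τ' : ℝ} (h : IsJ ρ δ w (τ - τ') a b) (N : ℕ) :
    IsSym ρ δ (fun X => w X * planck ρ δ X ^ N) (fun X => b X - changeExpansion τ τ' a N X) ∧
      (n = 0 → 0 < N → ∀ X, b X - changeExpansion τ τ' a N X = 0) := by
  obtain ⟨r, hr, hrc⟩ := ha.exists_jrem hp hw N (τ - τ')
  have ht := ha.symConv_trunc hp fun X => (hw.pos X).le
  have hpos := (hw.mul_lam hp).pos
  have key : ∀ X, r X = b X - changeExpansion τ τ' a N X := by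
    intro X
    refine tendsto_nhds_unique ((hrc _ ht).tendsto hpos X) ?_
    -- Near a fixed X the truncations eventually coincide with a, so their expansions at X are
    -- eventually constant; this identifies the abstract remainder r.
    refine (((h _ ht).tendsto hpos X).sub tendsto_const_nhds).congr' ?_
    obtain ⟨I, hI⟩ := exists_nat_gt ‖X‖
    refine Filter.eventually_atTop.2 ⟨I, fun i hi => ?_⟩
    have hi' : (I : ℝ) ≤ i := by exact_mod_cast hi
    beta_reduce
    rw [jrem_apply, ← changeExpansion_schwartz,
      changeExpansion_congr τ τ' (trunc_eventuallyEq ha.contDiff (by linarith)) N]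
  refine ⟨funext key ▸ hr, fun hn hN X => ?_⟩
  subst hn
  rw [← key]
  refine tendsto_nhds_unique ((hrc _ ht).tendsto hpos X) ?_
  refine tendsto_const_nhds.congr fun i => ?_
  -- On a point every `J t` is the identity and `crossLap` is an empty sum, so a remainder of
  -- positive order vanishes.
  have hJ : ∀ f : 𝓢(Phase 0, ℂ), J (τ - τ') f = f := fun f => by
    have e : (jmult (τ - τ') : Phase 0 → ℂ) = jmult 0 := by
      ext Ω
      simp [jmult, Subsingleton.elim Ω 0]
    rw [J_eq, e, ← J_eq, J_zero]
  have hc : crossLap 0 = 0 := by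
    ext f X
    rw [crossLap_eq]
    simp
  obtain ⟨N, rfl⟩ := Nat.exists_eq_succ_of_ne_zero hN.ne'
  rw [jrem_apply, hJ, hc, Finset.sum_range_succ']
  simp

end Expansion
-- Return to the class `symbolClass` and the weight `hSigma`.
section SymbolClass

variable {n : ℕ} {ρ δ : ℝ}

theorem mem_symbolClass_iff_isSym {w : Phase n → ℝ} (hw : ∀ X, 0 ≤ w X) {a : Phase n → ℂ} :
    a ∈ symbolClass (stdMetric n ρ δ) w ↔ IsSym ρ δ w a :=
  (mem_symbolClass_iff hw).trans ⟨fun h => ⟨h.1, h.2⟩, fun h => ⟨h.1, h.2⟩⟩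

theorem hSigma_nonneg (X : Phase n) : 0 ≤ hSigma (stdMetric n ρ δ) X := Real.sqrt_nonneg _

/-- For n ≥ 1 the weight is the one with `planck`. For n = 0 the supremum defining `hSigma` is 0
while `planck` is 1, so for N > 0 the remainder has to vanish identically. -/
theorem IsJ.remainder_mem_symbolClass (hp : Admissible ρ δ) {m : Phase n → ℝ}
    (hm : IsTemperateWeight (stdMetric n ρ δ) m) {a b : Phase n → ℂ} (ha : IsSym ρ δ m a)
    {τ τ' : ℝ} (h : IsJ ρ δ m (τ - τ') a b) (N : ℕ) :
    (fun X => b X - changeExpansion τ τ' a N X) ∈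
      symbolClass (stdMetric n ρ δ) (fun X => hSigma (stdMetric n ρ δ) X ^ N * m X) := by
  obtain ⟨h1, h2⟩ := h.exists_remainder hp hm.tw ha N
  rw [mem_symbolClass_iff_isSym fun X => mul_nonneg (pow_nonneg (hSigma_nonneg X) N) (hm.pos X).le]
  rcases Nat.eq_zero_or_pos N with rfl | hN
  · simpa using h1
  rcases Nat.eq_zero_or_pos n with hn | hn
  · simp only [h2 hn hN]
    refine ⟨contDiff_const, fun k => ⟨0, le_rfl, fun j _ X => ?_⟩⟩
    rw [symNorm_fun_zero, zero_mul]
  · have : NeZero n := ⟨hn.ne'⟩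
    have e : (fun X : Phase n => hSigma (stdMetric n ρ δ) X ^ N * m X) =
        fun X => m X * planck ρ δ X ^ N := by
      ext X
      rw [hSigma_stdMetric, mul_comm]
      rfl
    rw [e]
    exact h1

end SymbolClass
end

theorem mainTheorem7 (n : ℕ) (ρ δ τ τ' : ℝ)
    (hρ : 0 ≤ 1 - ρ) (hρδ : 1 - ρ ≤ δ) (hδρ : δ < ρ) (hρ1 : ρ ≤ 1)
    (m : Phase n → ℝ) (hm : IsTemperateWeight (stdMetric n ρ δ) m)
    (κ : Euc n ≃L[ℝ] Euc n)
    (hκ : ∀ x ξ : Euc n, m (κ.symm x, transposeMap κ ξ) = m (x, ξ))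
    (a : Phase n → ℂ) (ha : a ∈ symbolClass (stdMetric n ρ δ) m) :
    ∃ A : 𝓢(Euc n, ℂ) →L[ℂ] 𝓢(Euc n, ℂ), IsOpTau τ' a A ∧
      ∃ b : Phase n → ℂ,
        (b ∈ symbolClass (stdMetric n ρ δ) m ∧ IsOpTau τ b (conjOp κ A)) ∧
        (∀ b' ∈ symbolClass (stdMetric n ρ δ) m, IsOpTau τ b' (conjOp κ A) → b' = b) ∧
        (∀ N : ℕ, (fun X => b X - conjExpansion τ τ' κ a N X) ∈
          symbolClass (stdMetric n ρ δ) (fun X => hSigma (stdMetric n ρ δ) X ^ N * m X)) ∧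
        ((∀ x ξ : Euc n, a (κ.symm x, transposeMap κ ξ) = a (x, ξ)) →
          ((κ : Euc n →L[ℝ] Euc n).det = 1 ∨ (κ : Euc n →L[ℝ] Euc n).det = -1) →
          conjOp κ A = A ∧
          ∀ N : ℕ, (fun X => b X - changeExpansion τ τ' a N X) ∈
            symbolClass (stdMetric n ρ δ) (fun X => hSigma (stdMetric n ρ δ) X ^ N * m X)) := by
  have hp : Admissible ρ δ := ⟨hρ.trans hρδ, hδρ, hρ1⟩
  have hw := hm.tw
  have hm0 : ∀ X, 0 ≤ m X := fun X => (hm.pos X).le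
  have hκ' : ∀ X, m (liftMap κ X) = m X := fun X => hκ X.1 X.2
  have haS : IsSym ρ δ m a := (mem_symbolClass_iff_isSym hm0).1 ha
  have haκ := haS.comp_liftMap hp hκ'
  obtain ⟨A, hA⟩ := haS.exists_isOpTau hp hw τ'
  have hA₁ := hA.conjOp hp hw hκ' haS
  -- The conjugated operator has the τ'-symbol a ∘ `liftMap κ`, and time τ - τ' carries it to the
  -- τ-symbol.
  obtain ⟨b, hb, hab⟩ := haκ.exists_isJ hp hw (τ - τ')
  have hbA := hab.isOpTau_of_isOpTau hp hw haκ hb hA₁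
  have hrem := fun N => hab.remainder_mem_symbolClass hp hm haκ N
  refine ⟨A, hA, b, ⟨(mem_symbolClass_iff_isSym hm0).2 hb, hbA⟩, fun b' hb' h' =>
    h'.unique hp hw ((mem_symbolClass_iff_isSym hm0).1 hb') hb hbA, fun N => ?_, fun hinv _ => ?_⟩
  · simp only [conjExpansion_eq τ τ' κ haS.contDiff]
    exact hrem N
  -- By invariance the conjugated operator and A share the τ'-symbol a, hence agree, and the
  -- remainder estimate for a ∘ `liftMap κ` is already the one for a.
  · have e : (fun X => a (liftMap κ X)) = a := funext fun X => hinv X.1 X.2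
    rw [e] at hA₁ hrem
    exact ⟨hA₁.op_unique hp hw haS hA, hrem⟩
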